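/- For $\ell>0$ let $\Gamma_\ell$ be the infinite periodic chain of rings of circumference $2\pi$ in which consecutive rings are joined by links of length $\ell$: the $n$-th period cell ($n\in\mathbb Z$) consists of a link of length $\ell$, an upper half-ring and a lower half-ring of length $\pi$, the two half-rings running from the right end of the $n$-th link to the left end of the $(n+1)$-st link. Let $H_\ell$ be the operator $\psi\mapsto-\psi''$ on $L^2(\Gamma_\ell)$ whose domain consists of the functions that are $H^2$ on the edges, with $\psi''\in L^2(\Gamma_\ell)$, and satisfy at each vertex the coupling condition $$(\psi_{j+1}-\psi_j)+i(\psi_{j+1}'+\psi_j')=0,\qquad j=1,2,3 \pmod 3,$$ where $\psi_j,\psi_j'$ are the boundary values and outward derivatives on the three edges meeting at the vertex, numbered counterclockwise. Let $H_\ell(\theta)$, $\theta\in[-\pi,\pi]$, be its Floquet fiber operators: the same operator on one period cell, with the Floquet condition that the function is multiplied by $e^{i\theta}$ when passing to the next cell. As $\ell\to0+$ the following holds. 1. The positive spectrum of $H_\ell$ fills $[0,\infty)$: for all $K,\varepsilon>0$ and all sufficiently small $\ell>0$, each point of $[0,K]$ has distance less than $\varepsilon$ from $\sigma(H_\ell)\cap(0,\infty)$;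 moreover, each fixed $x\ge0$ belongs to $\sigma(H_\ell)$ for all sufficiently small $\ell>0$. 2. For all sufficiently small $\ell>0$ the negative spectrum of each $H_\ell(\theta)$ consists of two points $E_-(\ell;\theta)<E_+(\ell;\theta)<0$, and the negative spectrum of $H_\ell$ is the union of two disjoint bands, the lower one $\{E_-(\ell;\theta):\theta\in[-\pi,\pi]\}=[E_-(\ell;\pi),E_-(\ell;0)]$ and the upper one $\{E_+(\ell;\theta):\theta\in[-\pi,\pi]\}=[E_+(\ell;0),E_+(\ell;\pi)]$. The lower edge of the upper band satisfies $$E_+(\ell;0)=-1-\ell\coth\tfrac{\pi}{2}+O(\ell^2),$$ and the width of this band is $$E_+(\ell;\pm\pi)-E_+(\ell;0)=\frac{2\ell}{\sinh\pi}+O(\ell^2).$$ 3. The lower band escapes to $-\infty$: $$E_-(\ell;\theta)=-\Big(\frac4\ell\Big)^{2/3}+O(1),$$ with the error term bounded uniformly in $\theta\in[-\pi,\pi]$. -/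

import Mathlib

open Set Filter Topology MeasureTheory

namespace RingChain

noncomputable section

/-! ### Spectrum of an unbounded operator -/

/-- `z` belongs to the resolvent set of `T`: the map `T - z` from the domain of `T` to the
whole space has an everywhere defined bounded two-sided inverse. -/
def InResolventSet {H : Type*} [NormedAddCommGroup H] [NormedSpace ℂ H]
    (T : H →ₗ.[ℂ] H) (z : ℂ) : Prop :=
  ∃ R : H →L[ℂ] H,
    (∀ y : H, ∃ x : T.domain, (x : H) = R y ∧ T x - z • (x : H) = y) ∧
    ∀ x : T.domain, R (T x - z • (x : H)) = x

/-- The spectrum of an unbounded operator. -/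
def spec {H : Type*} [NormedAddCommGroup H] [NormedSpace ℂ H] (T : H →ₗ.[ℂ] H) : Set ℂ :=
  {z | ¬ InResolventSet T z}

/-- The negative spectrum: the points of the spectrum on the open negative half-line. -/
def negSpec {H : Type*} [NormedAddCommGroup H] [NormedSpace ℂ H] (T : H →ₗ.[ℂ] H) : Set ℝ :=
  {x : ℝ | x < 0 ∧ (x : ℂ) ∈ spec T}

/-- The positive spectrum: the points of the spectrum on the open positive half-line. -/
def posSpec {H : Type*} [NormedAddCommGroup H] [NormedSpace ℂ H] (T : H →ₗ.[ℂ] H) : Set ℝ :=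
  {x : ℝ | 0 < x ∧ (x : ℂ) ∈ spec T}

/-! ### Laplacians on metric graphs -/

/-- The Hilbert space `L²` of a metric graph with edge set `E` and edge lengths `L`: the Hilbert
direct sum of the spaces `L²(0, L e)`. -/
abbrev GraphL2 {E : Type} (L : E → ℝ) : Type :=
  lp (fun e : E => Lp ℂ 2 (volume.restrict (Ioc 0 (L e)))) 2

/-- `u` is an `H²` function on `[0, L]` with `u' = v` and (in the weak sense) `u'' = w`;
here `w` will always be square integrable on `(0, L)`. -/
def IsH2With (L : ℝ) (u v w : ℝ → ℂ) : Prop :=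
  ∀ x ∈ Icc (0 : ℝ) L,
    u x = u 0 + (∫ t in (0 : ℝ)..x, v t) ∧ v x = v 0 + ∫ t in (0 : ℝ)..x, w t

/-- Boundary data: for each end of each edge (`false` is the end `x = 0`, `true` is the end
`x = L e`) the boundary value of a function and its derivative in the direction away from that
end, into the edge. -/
abbrev BoundaryData (E : Type) : Type := E × Bool → ℂ × ℂ

/-- Boundary data of a function with edge components `u e` and derivatives `v e`. -/
def boundaryData {E : Type} (L : E → ℝ) (u v : E → ℝ → ℂ) : BoundaryData E
  | (e, false) => (u e 0, v e 0)
  | (e, true) => (u e (L e), - v e (L e))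

lemma IsH2With.intervalIntegrable {L : ℝ} {u v w : ℝ → ℂ} (h : IsH2With L u v w)
    (hw : IntegrableOn w (Ioc 0 L)) {x : ℝ} (hx : x ∈ Icc (0 : ℝ) L) :
    IntervalIntegrable v volume 0 x := by
  have hL : (0 : ℝ) ≤ L := hx.1.trans hx.2
  have hc : ContinuousOn v (Icc 0 L) := by
    have h1 : ContinuousOn (fun x => v 0 + ∫ t in (0 : ℝ)..x, w t) (Icc 0 L) := by
      refine continuousOn_const.add ?_
      have := intervalIntegral.continuousOn_primitive_interval' (μ := volume) (f := w)
        (b₁ := 0) (b₂ := L) (a := 0)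
        ((intervalIntegrable_iff_integrableOn_Ioc_of_le hL).2 hw) (by simp)
      rwa [uIcc_of_le hL] at this
    exact h1.congr fun y hy => (h y hy).2
  refine ContinuousOn.intervalIntegrable ?_
  rw [uIcc_of_le hx.1]
  exact hc.mono (Icc_subset_Icc_right hx.2)

lemma integrableOn_coe {L : ℝ} (f : Lp ℂ 2 (volume.restrict (Ioc 0 L))) :
    IntegrableOn f (Ioc 0 L) :=
  (Lp.memLp f).integrable (by norm_num)

/-- The graph of the operator `ψ ↦ -ψ''` on the metric graph, its domain being the functions that
are `H²` on the edges, with `ψ''` in `L²`, and whose boundary data lie in `B`. -/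
def laplaceGraph {E : Type} (L : E → ℝ) (B : Submodule ℂ (BoundaryData E)) :
    Submodule ℂ (GraphL2 L × GraphL2 L) where
  carrier := {p | ∃ u v : E → ℝ → ℂ,
    (∀ e, p.1 e =ᵐ[volume.restrict (Ioc 0 (L e))] u e) ∧
    (∀ e, IsH2With (L e) (u e) (v e) (fun t => - (p.2 e) t)) ∧
    boundaryData L u v ∈ B}
  zero_mem' := by
    refine ⟨0, 0, fun e => ?_, fun e x hx => ⟨by simp, ?_⟩, ?_⟩
    · exact Lp.coeFn_zero ℂ 2 _
    · have h : ∀ᵐ t ∂(volume.restrict (Ioc 0 (L e))),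
          (((0 : GraphL2 L × GraphL2 L).2 e : Lp ℂ 2 _) : ℝ → ℂ) t = 0 :=
        Lp.coeFn_zero ℂ 2 _
      have h' : (∫ t in (0 : ℝ)..x, - (((0 : GraphL2 L × GraphL2 L).2 e : Lp ℂ 2 _) : ℝ → ℂ) t)
          = ∫ t in (0 : ℝ)..x, (0 : ℂ) := by
        refine intervalIntegral.integral_congr_ae ?_
        rw [ae_restrict_iff' measurableSet_Ioc] at h
        filter_upwards [h] with t ht hm
        rw [uIoc_of_le hx.1] at hm
        rw [ht ⟨hm.1, hm.2.trans hx.2⟩, neg_zero]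
      rw [h']
      simp
    · have : boundaryData L (0 : E → ℝ → ℂ) 0 = 0 := by
        ext ⟨e, b⟩ <;> cases b <;> simp [boundaryData]
      rw [this]
      exact B.zero_mem
  add_mem' := by
    rintro p q ⟨u, v, h1, h2, h3⟩ ⟨u', v', h1', h2', h3'⟩
    refine ⟨u + u', v + v', fun e => ?_, fun e x hx => ⟨?_, ?_⟩, ?_⟩
    · filter_upwards [Lp.coeFn_add (p.1 e) (q.1 e), h1 e, h1' e] with t ht ha hb
      have : ((p + q).1 e : Lp ℂ 2 (volume.restrict (Ioc 0 (L e)))) = p.1 e + q.1 e := rfl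
      rw [this, ht]
      simp [ha, hb]
    · have i1 := (h2 e).intervalIntegrable (integrableOn_coe _).neg hx
      have i2 := (h2' e).intervalIntegrable (integrableOn_coe _).neg hx
      simp only [Pi.add_apply]
      rw [intervalIntegral.integral_add i1 i2, (h2 e x hx).1, (h2' e x hx).1]
      ring
    · have h : ∀ᵐ t ∂(volume.restrict (Ioc 0 (L e))),
          ((p + q).2 e : Lp ℂ 2 (volume.restrict (Ioc 0 (L e)))) t
            = (p.2 e) t + (q.2 e) t :=
        Lp.coeFn_add (p.2 e) (q.2 e)
      have hi : ∀ f : Lp ℂ 2 (volume.restrict (Ioc 0 (L e))),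
          IntervalIntegrable (fun t => - f t) volume 0 x := fun f =>
        (intervalIntegrable_iff_integrableOn_Ioc_of_le hx.1).2
          ((integrableOn_coe f).neg.mono_set (Ioc_subset_Ioc_right hx.2))
      have h' : (∫ t in (0 : ℝ)..x, - ((p + q).2 e : Lp ℂ 2 (volume.restrict (Ioc 0 (L e)))) t)
          = ∫ t in (0 : ℝ)..x, (- (p.2 e) t + - (q.2 e) t) := by
        refine intervalIntegral.integral_congr_ae ?_
        rw [ae_restrict_iff' measurableSet_Ioc] at h
        filter_upwards [h] with t ht hm
        rw [uIoc_of_le hx.1] at hm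
        rw [ht ⟨hm.1, hm.2.trans hx.2⟩]
        ring
      rw [h', intervalIntegral.integral_add (hi _) (hi _)]
      simp only [Pi.add_apply]
      rw [(h2 e x hx).2, (h2' e x hx).2]
      ring
    · have : boundaryData L (u + u') (v + v') = boundaryData L u v + boundaryData L u' v' := by
        ext ⟨e, b⟩ <;> cases b <;> simp [boundaryData]; ring
      rw [this]
      exact B.add_mem h3 h3'
  smul_mem' := by
    rintro c p ⟨u, v, h1, h2, h3⟩
    refine ⟨c • u, c • v, fun e => ?_, fun e x hx => ⟨?_, ?_⟩, ?_⟩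
    · filter_upwards [Lp.coeFn_smul c (p.1 e), h1 e] with t ht ha
      have : ((c • p).1 e : Lp ℂ 2 (volume.restrict (Ioc 0 (L e)))) = c • p.1 e := rfl
      rw [this, ht]
      simp [ha]
    · simp only [Pi.smul_apply]
      rw [intervalIntegral.integral_smul, (h2 e x hx).1, smul_add]
    · have h : ∀ᵐ t ∂(volume.restrict (Ioc 0 (L e))),
          ((c • p).2 e : Lp ℂ 2 (volume.restrict (Ioc 0 (L e)))) t = c • (p.2 e) t :=
        Lp.coeFn_smul c (p.2 e)
      have h' : (∫ t in (0 : ℝ)..x, - ((c • p).2 e : Lp ℂ 2 (volume.restrict (Ioc 0 (L e)))) t)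
          = ∫ t in (0 : ℝ)..x, c • (- (p.2 e) t) := by
        refine intervalIntegral.integral_congr_ae ?_
        rw [ae_restrict_iff' measurableSet_Ioc] at h
        filter_upwards [h] with t ht hm
        rw [uIoc_of_le hx.1] at hm
        rw [ht ⟨hm.1, hm.2.trans hx.2⟩, smul_neg]
      rw [h', intervalIntegral.integral_smul]
      simp only [Pi.smul_apply]
      rw [(h2 e x hx).2, smul_add]
    · have : boundaryData L (c • u) (c • v) = c • boundaryData L u v := by
        ext ⟨e, b⟩ <;> cases b <;> simp [boundaryData]
      rw [this]
      exact B.smul_mem c h3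

/-- A continuous function that vanishes almost everywhere on `[0, L]` vanishes there. -/
lemma eq_zero_of_ae_eq_zero {L : ℝ} (hL : 0 < L) {f : ℝ → ℂ} (hf : ContinuousOn f (Icc 0 L))
    (h : ∀ᵐ t ∂(volume.restrict (Ioc 0 L)), f t = 0) : ∀ x ∈ Icc (0 : ℝ) L, f x = 0 := by
  have h2 : f =ᵐ[volume.restrict (Icc 0 L)] (fun _ => (0 : ℂ)) := by
    rw [← restrict_Ioc_eq_restrict_Icc]
    exact h
  exact Measure.eqOn_Icc_of_ae_eq volume hL.ne h2 hf continuousOn_const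

/-- The relation above is the graph of an operator: `ψ` determines `ψ''`. -/
lemma laplaceGraph_snd_eq_zero {E : Type} (L : E → ℝ) (B : Submodule ℂ (BoundaryData E))
    (p : GraphL2 L × GraphL2 L) (hp : p ∈ laplaceGraph L B) (h0 : p.1 = 0) : p.2 = 0 := by
  obtain ⟨u, v, h1, h2, -⟩ := hp
  ext1
  funext e
  rcases le_or_gt (L e) 0 with hL | hL
  · have hm : ∀ᵐ _t ∂(volume.restrict (Ioc 0 (L e))), False := by
      rw [Ioc_eq_empty (not_lt.2 hL), Measure.restrict_empty]
      simp
    refine Lp.ext ?_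
    filter_upwards [hm] with t ht
    exact ht.elim
  have hwint : IntegrableOn (fun t => - (p.2 e) t) (Ioc 0 (L e)) := (integrableOn_coe _).neg
  have hcont : ∀ {a b : ℝ → ℂ}, IntervalIntegrable b volume 0 (L e) →
      (∀ x ∈ Icc (0 : ℝ) (L e), a x = a 0 + ∫ t in (0 : ℝ)..x, b t) →
      ContinuousOn a (Icc 0 (L e)) := by
    intro a b hb hab
    have h1 : ContinuousOn (fun x => a 0 + ∫ t in (0 : ℝ)..x, b t) (Icc 0 (L e)) := by
      refine continuousOn_const.add ?_
      have := intervalIntegral.continuousOn_primitive_interval' (μ := volume) (f := b)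
        (b₁ := 0) (b₂ := L e) (a := 0) hb (by simp)
      rwa [uIcc_of_le hL.le] at this
    exact h1.congr hab
  -- a function whose primitive from `0` vanishes on `[0, L e]` vanishes almost everywhere
  have hker : ∀ {b : ℝ → ℂ}, IntegrableOn b (Ioc 0 (L e)) →
      (∀ x ∈ Icc (0 : ℝ) (L e), ∫ t in (0 : ℝ)..x, b t = 0) →
      ∀ᵐ t ∂(volume.restrict (Ioc 0 (L e))), b t = 0 := by
    intro b hb hz
    have hi : IntervalIntegrable b volume 0 (L e) :=
      (intervalIntegrable_iff_integrableOn_Ioc_of_le hL.le).2 hb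
    have hd := hi.ae_hasDerivAt_integral
    rw [← restrict_Ioo_eq_restrict_Ioc, ae_restrict_iff' measurableSet_Ioo]
    filter_upwards [hd] with t ht hm
    have hm' : t ∈ uIcc 0 (L e) := by
      rw [uIcc_of_le hL.le]
      exact Ioo_subset_Icc_self hm
    have hder := ht hm' 0 (by simp)
    have hzero : HasDerivAt (fun x => ∫ s in (0 : ℝ)..x, b s) 0 t := by
      refine (hasDerivAt_const t (0 : ℂ)).congr_of_eventuallyEq ?_
      filter_upwards [Ioo_mem_nhds hm.1 hm.2] with s hs
      exact hz s (Ioo_subset_Icc_self hs)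
    exact hder.unique hzero
  have hLmem : L e ∈ Icc (0 : ℝ) (L e) := ⟨hL.le, le_rfl⟩
  have hvint : IntervalIntegrable (v e) volume 0 (L e) :=
    (h2 e).intervalIntegrable hwint hLmem
  have hu : ∀ x ∈ Icc (0 : ℝ) (L e), u e x = 0 := by
    refine eq_zero_of_ae_eq_zero hL (hcont hvint fun x hx => (h2 e x hx).1) ?_
    have hz : ∀ᵐ t ∂(volume.restrict (Ioc 0 (L e))), (p.1 e) t = 0 := by
      rw [h0]
      exact Lp.coeFn_zero ℂ 2 _
    filter_upwards [hz, h1 e] with t ht ht'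
    rw [← ht', ht]
  have hv : ∀ x ∈ Icc (0 : ℝ) (L e), v e x = 0 := by
    refine eq_zero_of_ae_eq_zero hL (hcont ((intervalIntegrable_iff_integrableOn_Ioc_of_le hL.le).2
      hwint) fun x hx => (h2 e x hx).2) ?_
    refine hker ((intervalIntegrable_iff_integrableOn_Ioc_of_le hL.le).1 hvint) fun x hx => ?_
    have := (h2 e x hx).1
    rw [hu x hx, hu 0 ⟨le_rfl, hL.le⟩, zero_add] at this
    exact this.symm
  have hw := hker hwint fun x hx => by
    have := (h2 e x hx).2
    rw [hv x hx, hv 0 ⟨le_rfl, hL.le⟩, zero_add] at this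
    exact this.symm
  refine Lp.ext ?_
  have hz : (((0 : GraphL2 L) e : Lp ℂ 2 (volume.restrict (Ioc 0 (L e)))) : ℝ → ℂ)
      =ᵐ[volume.restrict (Ioc 0 (L e))] 0 := Lp.coeFn_zero ℂ 2 _
  filter_upwards [hw, hz] with t ht ht'
  exact (neg_eq_zero.1 ht).trans ht'.symm

/-- The operator `ψ ↦ -ψ''` on the metric graph with edges `e ∈ E` of length `L e`, its domain being
the functions that are `H²` on the edges, with `ψ''` in `L²`, and whose boundary data lie in `B`. -/
def laplacian {E : Type} (L : E → ℝ) (B : Submodule ℂ (BoundaryData E)) :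
    GraphL2 L →ₗ.[ℂ] GraphL2 L :=
  (laplaceGraph L B).toLinearPMap

lemma laplacian_graph {E : Type} (L : E → ℝ) (B : Submodule ℂ (BoundaryData E)) :
    (laplacian L B).graph = laplaceGraph L B :=
  Submodule.toLinearPMap_graph_eq _ (laplaceGraph_snd_eq_zero L B)

/-! ### The vertex coupling of preferred orientation -/

/-- The coupling at a vertex of degree three: `p 0, p 1, p 2` are the (value, outward derivative)
pairs of the three edge ends meeting there, in cyclic order. -/
def Coupled (p : Fin 3 → ℂ × ℂ) : Prop :=
  ∀ j : Fin 3, ((p (j + 1)).1 - (p j).1) + Complex.I * ((p (j + 1)).2 + (p j).2) = 0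

/-! ### The ring chain

The period cell consists of three edges, oriented from left to right: the connecting link `0` of
length `ℓ`, the upper half-ring `1` and the lower half-ring `2`, both of length `π`. The half-rings
start at the right end of the link of their cell and end at the left end of the link of the next
cell. -/

/-- Lengths of the edges of a period cell. -/
def cellLength (ℓ : ℝ) : Fin 3 → ℝ := ![ℓ, Real.pi, Real.pi]

/-- Lengths of the edges of the infinite chain. -/
def chainLength (ℓ : ℝ) : ℤ × Fin 3 → ℝ := fun e => cellLength ℓ e.2

/-- The vertex conditions on the infinite chain: at the right end of the `n`-th link, the edge ends
in counterclockwise order are the link, the lower half-ring, the upper half-ring; at the left end of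
the `(n+1)`-st link they are the link, the upper half-ring, the lower half-ring. -/
def chainCoupling : Submodule ℂ (BoundaryData (ℤ × Fin 3)) where
  carrier := {t | ∀ n : ℤ,
    Coupled ![t ((n, 0), true), t ((n, 2), false), t ((n, 1), false)] ∧
    Coupled ![t ((n + 1, 0), false), t ((n, 1), true), t ((n, 2), true)]}
  zero_mem' := by
    intro n
    constructor <;> intro j <;> fin_cases j <;> simp
  add_mem' := by
    intro s t hs ht n
    constructor
    · intro j
      have h1 := (hs n).1 j
      have h2 := (ht n).1 j
      fin_cases j <;> simp at h1 h2 ⊢ <;> linear_combination h1 + h2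
    · intro j
      have h1 := (hs n).2 j
      have h2 := (ht n).2 j
      fin_cases j <;> simp at h1 h2 ⊢ <;> linear_combination h1 + h2
  smul_mem' := by
    intro c t ht n
    constructor
    · intro j
      have h2 := (ht n).1 j
      fin_cases j <;> simp at h2 ⊢ <;> linear_combination c * h2
    · intro j
      have h2 := (ht n).2 j
      fin_cases j <;> simp at h2 ⊢ <;> linear_combination c * h2

/-- The Hamiltonian `H_ℓ` of the chain. -/
def chainH (ℓ : ℝ) : GraphL2 (chainLength ℓ) →ₗ.[ℂ] GraphL2 (chainLength ℓ) :=
  laplacian (chainLength ℓ) chainCoupling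

/-- The vertex conditions on the period cell with quasimomentum `θ`: those of the chain, for
functions that are multiplied by `exp (i θ)` when passing to the next cell. -/
def fiberCoupling (θ : ℝ) : Submodule ℂ (BoundaryData (Fin 3)) where
  carrier := {t |
    Coupled ![t (0, true), t (2, false), t (1, false)] ∧
    Coupled ![Complex.exp (Complex.I * θ) • t (0, false), t (1, true), t (2, true)]}
  zero_mem' := by
    constructor <;> intro j <;> fin_cases j <;> simp
  add_mem' := by
    intro s t hs ht
    constructor
    · intro j
      have h1 := hs.1 j
      have h2 := ht.1 j
      fin_cases j <;> simp at h1 h2 ⊢ <;> linear_combination h1 + h2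
    · intro j
      have h1 := hs.2 j
      have h2 := ht.2 j
      fin_cases j <;> simp at h1 h2 ⊢ <;> linear_combination h1 + h2
  smul_mem' := by
    intro c t ht
    constructor
    · intro j
      have h2 := ht.1 j
      fin_cases j <;> simp at h2 ⊢ <;> linear_combination c * h2
    · intro j
      have h2 := ht.2 j
      fin_cases j <;> simp at h2 ⊢ <;> linear_combination c * h2

/-- The fiber operator `H_ℓ(θ)`. -/
def fiberH (ℓ θ : ℝ) : GraphL2 (cellLength ℓ) →ₗ.[ℂ] GraphL2 (cellLength ℓ) :=
  laplacian (cellLength ℓ) (fiberCoupling θ)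

end

end RingChain

/-! ### The secular function at negative energies: signs and monotonicity. -/

namespace RingChain

open Real (cosh sinh)

/-! Everything reduces to the Floquet problem on one period cell. On each edge a solution of `-u'' =
z u` is fixed by its two initial data, so a Bloch solution with multiplier `w` is a vector of six
numbers subject to six linear equations. Eliminating all but the values at the two ends of the link
leaves a 2×2 system, solvable exactly when `secularDet` vanishes (`eq_zero_of_secularDet_ne_zero`,
`hasBloch_of_secularDet_eq_zero`). For `|w| = 1` this involves `w` only through the cosine of the
quasimomentum, and at `z = -κ²` it becomes `secular ℓ κ c = 0`.

The spectra of the operators are then characterised by Bloch solutions.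
`IsFundamental.inResolventSet_laplacian` uses variation of parameters to turn the resolvent equation
into a discrete one for the initial data. For a fiber this is a finite linear system. For the chain
it is a difference equation on `ℓ²(ℤ)`, which can be inverted when its symbol is invertible on the
unit circle (`exists_l2_solution_difference_equation`). Conversely, a Bloch solution is an
eigenfunction of the fiber, and after cutting off it gives a Weyl sequence for the chain
(`IsFundamental.mem_spec_chainH`).

Negative spectrum. Zeros of `secular` satisfy `κ > 1`. For small `ℓ` the function increases on `[1,
2]`, because in the limit only `4(κ² - 1)(cosh πκ - c)` survives; on `[2, ∞)` the normalised
`secularQuot` decreases. So there are exactly two roots (`roots_spec`). The smaller one belongs to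
the upper energy `-κ²`: there `4(κ² - 1)(cosh π - c) ≈ 4 ℓ sinh π`, which gives the edge and the
width of the upper band (`upperRoot_asymptotics`). At the larger one `secularQuot` behaves like
`1/(ℓκ) - κ²/4`, whence `κ³ ≈ 4/ℓ`. Both roots are monotone in `c`, and this produces the bands.

Positive spectrum. At energy `k²` the secular equation reads `cos θ = X(ℓ)` with `X(ℓ) → cos kπ`. If
`sin kπ ≠ 0`, then `|X(ℓ)| < 1` for small `ℓ`; if `sin kπ = 0`, the half-rings carry Dirichlet
eigenfunctions and a Bloch solution is written down directly (`eventually_sq_mem_spec_chainH`).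
Finitely many such points yield the density statement. -/

/-- The secular function of the ring chain at the energy `-κ²`; here `c` is the cosine of the
quasimomentum. -/
noncomputable def secular (ℓ κ c : ℝ) : ℝ :=
  4 * (κ ^ 2 - 1) * (cosh (Real.pi * κ) * cosh (ℓ * κ) - c)
    - sinh (Real.pi * κ) * sinh (ℓ * κ) * ((κ ^ 2 - 1) ^ 2 + 4)

/-- The secular function divided by `4 (κ² - 1) sinh (π κ) sinh (ℓ κ)`. -/
noncomputable def secularQuot (ℓ κ c : ℝ) : ℝ :=
  (cosh (Real.pi * κ) * cosh (ℓ * κ) - c) / (sinh (Real.pi * κ) * sinh (ℓ * κ))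
    - ((κ ^ 2 - 1) / 4 + 1 / (κ ^ 2 - 1))

lemma sinh_pi_mul_pos {κ : ℝ} (hκ : 0 < κ) : 0 < sinh (Real.pi * κ) :=
  Real.sinh_pos_iff.2 (mul_pos Real.pi_pos hκ)

/-- For `κ > 1` the factor is positive, so both functions have the same sign and the same zeros;
monotonicity for large `κ` is visible only on the quotient. -/
lemma secular_eq_mul_secularQuot {ℓ κ : ℝ} (hℓ : 0 < ℓ) (hκ : 1 < κ) (c : ℝ) :
    secular ℓ κ c
      = 4 * (κ ^ 2 - 1) * (sinh (Real.pi * κ) * sinh (ℓ * κ)) * secularQuot ℓ κ c := by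
  have h1 : 0 < κ ^ 2 - 1 := by nlinarith
  have h2 := sinh_pi_mul_pos (κ := κ) (by linarith)
  have h3 : 0 < sinh (ℓ * κ) := Real.sinh_pos_iff.2 (by positivity)
  unfold secular secularQuot
  field_simp

lemma secularQuot_pos_iff {ℓ κ : ℝ} (hℓ : 0 < ℓ) (hκ : 1 < κ) (c : ℝ) :
    0 < secularQuot ℓ κ c ↔ 0 < secular ℓ κ c := by
  have h1 : 0 < κ ^ 2 - 1 := by nlinarith
  have h2 := sinh_pi_mul_pos (κ := κ) (by linarith)
  have h3 : 0 < sinh (ℓ * κ) := Real.sinh_pos_iff.2 (by positivity)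
  rw [secular_eq_mul_secularQuot hℓ hκ, mul_pos_iff_of_pos_left (by positivity)]

lemma secularQuot_eq_zero_iff {ℓ κ : ℝ} (hℓ : 0 < ℓ) (hκ : 1 < κ) (c : ℝ) :
    secularQuot ℓ κ c = 0 ↔ secular ℓ κ c = 0 := by
  have h1 : 0 < κ ^ 2 - 1 := by nlinarith
  have h2 := sinh_pi_mul_pos (κ := κ) (by linarith)
  have h3 : 0 < sinh (ℓ * κ) := Real.sinh_pos_iff.2 (by positivity)
  rw [secular_eq_mul_secularQuot hℓ hκ, mul_eq_zero_iff_left (by positivity)]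

/-- Real zeros of the secular function lie above `1`. -/
lemma one_lt_of_secular_eq_zero {ℓ κ c : ℝ} (hℓ : 0 < ℓ) (hκ : 0 < κ) (hc : c ≤ 1)
    (h : secular ℓ κ c = 0) : 1 < κ := by
  -- For `κ ≤ 1` the first term of `secular` is nonpositive and the second is strictly negative.
  by_contra! hκ1
  have h2 := sinh_pi_mul_pos hκ
  have h3 : 0 < sinh (ℓ * κ) := Real.sinh_pos_iff.2 (by positivity)
  have h4 : 0 ≤ cosh (Real.pi * κ) * cosh (ℓ * κ) - c := by
    nlinarith [Real.one_le_cosh (Real.pi * κ), Real.one_le_cosh (ℓ * κ)]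
  have h5 : 0 ≤ 1 - κ ^ 2 := by nlinarith
  have h6 : 0 < sinh (Real.pi * κ) * sinh (ℓ * κ) * ((κ ^ 2 - 1) ^ 2 + 4) := by positivity
  have h7 := mul_nonneg h5 h4
  unfold secular at h
  nlinarith

/-- The cosine `c` enters linearly, with coefficient `-4(κ² - 1)`. This orders the roots for
different quasimomenta. -/
lemma secular_lt_of_lt {ℓ κ c c' : ℝ} (hκ : 1 < κ) (hc : c < c') :
    secular ℓ κ c' < secular ℓ κ c := by
  have h1 : 0 < κ ^ 2 - 1 := by nlinarith
  unfold secular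
  nlinarith [mul_pos h1 (sub_pos.2 hc)]

lemma sinh_le_mul_cosh {x : ℝ} (hx : 0 ≤ x) : sinh x ≤ x * cosh x := by
  have hm : MonotoneOn (fun x : ℝ => x * cosh x - sinh x) (Ici 0) := by
    refine monotoneOn_of_deriv_nonneg (convex_Ici 0) (by fun_prop) (by fun_prop) ?_
    intro x hx
    rw [interior_Ici] at hx
    have : HasDerivAt (fun x : ℝ => x * cosh x - sinh x) (1 * cosh x + x * sinh x - cosh x) x :=
      ((hasDerivAt_id' x).fun_mul (Real.hasDerivAt_cosh x)).fun_sub (Real.hasDerivAt_sinh x)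
    rw [this.deriv]
    have := Real.sinh_pos_iff.2 hx
    have hx' : 0 < x := hx
    nlinarith [mul_pos hx' this]
  have := hm (self_mem_Ici) hx hx
  simp at this
  linarith

lemma hasDerivAt_secular (ℓ κ c : ℝ) :
    HasDerivAt (fun κ => secular ℓ κ c)
      (8 * κ * (cosh (Real.pi * κ) * cosh (ℓ * κ) - c)
        + 4 * (κ ^ 2 - 1) * (Real.pi * sinh (Real.pi * κ) * cosh (ℓ * κ)
          + ℓ * cosh (Real.pi * κ) * sinh (ℓ * κ))
        - (Real.pi * cosh (Real.pi * κ) * sinh (ℓ * κ) * ((κ ^ 2 - 1) ^ 2 + 4)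
          + ℓ * sinh (Real.pi * κ) * cosh (ℓ * κ) * ((κ ^ 2 - 1) ^ 2 + 4)
          + sinh (Real.pi * κ) * sinh (ℓ * κ) * (4 * κ * (κ ^ 2 - 1)))) κ := by
  have hm : ∀ a : ℝ, HasDerivAt (fun κ : ℝ => a * κ) a κ := fun a => by
    simpa using (hasDerivAt_id κ).const_mul a
  have hy : HasDerivAt (fun κ : ℝ => κ ^ 2 - 1) (2 * κ) κ := by
    simpa using (hasDerivAt_pow 2 κ).sub_const 1
  have h := ((hy.const_mul 4).fun_mul (((hm Real.pi).cosh.fun_mul (hm ℓ).cosh).sub_const c)).fun_sub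
    (((hm Real.pi).sinh.fun_mul (hm ℓ).sinh).fun_mul ((hy.fun_pow 2).add_const 4))
  unfold secular
  refine h.congr_deriv ?_
  push_cast
  ring

/-- For short links the secular function is increasing in `κ` on `[1, 2]`. -/
lemma eventually_strictMonoOn_secular :
    ∀ᶠ ℓ : ℝ in 𝓝[>] 0, ∀ c ≤ 1, StrictMonoOn (fun κ => secular ℓ κ c) (Icc 1 2) := by
  set M := cosh (Real.pi * 2) with hM
  have hM1 : 1 ≤ M := Real.one_le_cosh _
  set N := cosh 2 with hN
  have hN1 : 1 ≤ N := Real.one_le_cosh _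
  have hpi := Real.pi_gt_three
  -- On `[1, 2]` the three subtracted terms of the derivative add up to at most `ℓ K`, while
  -- `8κ(cosh πκ cosh ℓκ - c) ≥ 8`. The numbers 13 and 24 bound `(κ² - 1)² + 4` and `4κ(κ² - 1)`.
  set K := Real.pi * M * (2 * N) * 13 + M * N * 13 + M * (2 * N) * 24 with hK
  have hKpos : 0 < K := by positivity
  have hlim : ∀ᶠ ℓ : ℝ in 𝓝[>] 0, ℓ < min 1 (8 / K) :=
    nhdsWithin_le_nhds (Iio_mem_nhds (by positivity))
  filter_upwards [hlim, self_mem_nhdsWithin] with ℓ hℓ hℓ0 c hc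
  have hℓ0 : 0 < ℓ := hℓ0
  have hℓ1 : ℓ < 1 := hℓ.trans_le (min_le_left _ _)
  have hℓK : ℓ * K < 8 := by
    have := hℓ.trans_le (min_le_right _ _)
    rwa [lt_div_iff₀ hKpos] at this
  refine strictMonoOn_of_deriv_pos (convex_Icc 1 2)
    (fun κ _ => (hasDerivAt_secular ℓ κ c).continuousAt.continuousWithinAt) ?_
  intro κ hκ
  rw [interior_Icc] at hκ
  obtain ⟨h1, h2⟩ := hκ
  rw [(hasDerivAt_secular ℓ κ c).deriv]
  have hy0 : 0 < κ ^ 2 - 1 := by nlinarith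
  have hy3 : κ ^ 2 - 1 ≤ 3 := by nlinarith
  have hCπ : cosh (Real.pi * κ) ≤ M := by
    rw [hM, Real.cosh_le_cosh, abs_of_pos (by positivity), abs_of_pos (by positivity)]
    nlinarith
  have hSπ : sinh (Real.pi * κ) ≤ M := (Real.sinh_lt_cosh _).le.trans hCπ
  have hSπ0 := sinh_pi_mul_pos (κ := κ) (by linarith)
  have hCℓ : cosh (ℓ * κ) ≤ N := by
    rw [hN, Real.cosh_le_cosh, abs_of_pos (by positivity), abs_of_pos (by positivity)]
    nlinarith
  have hSℓ0 : 0 < sinh (ℓ * κ) := Real.sinh_pos_iff.2 (by positivity)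
  have hSℓ : sinh (ℓ * κ) ≤ ℓ * (2 * N) := by
    refine (sinh_le_mul_cosh (by positivity)).trans ?_
    rw [mul_assoc]
    gcongr
  have hC1 := Real.one_le_cosh (ℓ * κ)
  have hC2 : 2 ≤ cosh (Real.pi * κ) := by
    have := Real.self_lt_sinh_iff.2 (show 0 < Real.pi * κ by positivity)
    nlinarith [Real.sinh_lt_cosh (Real.pi * κ)]
  have hq : (κ ^ 2 - 1) ^ 2 + 4 ≤ 13 := by nlinarith
  have e1 : Real.pi * cosh (Real.pi * κ) * sinh (ℓ * κ) * ((κ ^ 2 - 1) ^ 2 + 4)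
      ≤ Real.pi * M * (ℓ * (2 * N)) * 13 := by gcongr
  have e2 : ℓ * sinh (Real.pi * κ) * cosh (ℓ * κ) * ((κ ^ 2 - 1) ^ 2 + 4)
      ≤ ℓ * M * N * 13 := by gcongr
  have e3 : sinh (Real.pi * κ) * sinh (ℓ * κ) * (4 * κ * (κ ^ 2 - 1))
      ≤ M * (ℓ * (2 * N)) * (4 * 2 * 3) := by gcongr
  have e4 : 0 ≤ 4 * (κ ^ 2 - 1) * (Real.pi * sinh (Real.pi * κ) * cosh (ℓ * κ)
          + ℓ * cosh (Real.pi * κ) * sinh (ℓ * κ)) := by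
    have := Real.cosh_pos (ℓ * κ)
    have := Real.cosh_pos (Real.pi * κ)
    positivity
  have e5 : 1 ≤ cosh (Real.pi * κ) * cosh (ℓ * κ) - c := by nlinarith
  have e6 : 8 * 1 ≤ 8 * κ * (cosh (Real.pi * κ) * cosh (ℓ * κ) - c) := by nlinarith
  have e7 : ℓ * K = Real.pi * M * (ℓ * (2 * N)) * 13 + ℓ * M * N * 13
      + M * (ℓ * (2 * N)) * (4 * 2 * 3) := by rw [hK]; ring
  linarith

/-- Equivalently, `sinh t / t` increases; the derivative of the difference is `ab(cosh bx - cosh ax)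
> 0`. -/
lemma sinh_div_lt {a b κ : ℝ} (ha : 0 < a) (hab : a < b) (hκ : 0 < κ) :
    b * sinh (a * κ) < a * sinh (b * κ) := by
  have hm : StrictMonoOn (fun x : ℝ => a * sinh (b * x) - b * sinh (a * x)) (Ici 0) := by
    refine strictMonoOn_of_deriv_pos (convex_Ici 0) (by fun_prop) ?_
    intro x hx
    rw [interior_Ici] at hx
    have hx : 0 < x := hx
    have hm : ∀ a : ℝ, HasDerivAt (fun κ : ℝ => a * κ) a x := fun a => by
      simpa using (hasDerivAt_id x).const_mul a
    rw [(((hm b).sinh.const_mul a).fun_sub ((hm a).sinh.const_mul b)).deriv]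
    have hb : 0 < b := ha.trans hab
    have : cosh (a * x) < cosh (b * x) := by
      rw [Real.cosh_lt_cosh, abs_of_pos (by positivity), abs_of_pos (by positivity)]
      nlinarith
    nlinarith [mul_pos ha (ha.trans hab)]
  have := hm (self_mem_Ici) hκ.le hκ
  simp at this
  linarith

/-- The hyperbolic fraction does not increase, by `sinh_div_lt`, and with `y = κ² - 1` the
subtracted `y/4 + 1/y` increases strictly for `y > 2`, hence for `κ ≥ 2`. -/
lemma strictAntiOn_secularQuot {ℓ c : ℝ} (hℓ : 0 < ℓ) (hℓπ : ℓ < Real.pi) (hc : c ≤ 1) :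
    StrictAntiOn (fun κ => secularQuot ℓ κ c) (Ici 2) := by
  have hd : ∀ κ : ℝ, 1 < κ → HasDerivAt (fun κ => secularQuot ℓ κ c)
      (((Real.pi * sinh (Real.pi * κ) * cosh (ℓ * κ) + ℓ * cosh (Real.pi * κ) * sinh (ℓ * κ))
          * (sinh (Real.pi * κ) * sinh (ℓ * κ))
        - (cosh (Real.pi * κ) * cosh (ℓ * κ) - c) * (Real.pi * cosh (Real.pi * κ) * sinh (ℓ * κ)
          + ℓ * sinh (Real.pi * κ) * cosh (ℓ * κ))) / (sinh (Real.pi * κ) * sinh (ℓ * κ)) ^ 2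
        - (2 * κ / 4 - 2 * κ / (κ ^ 2 - 1) ^ 2)) κ := by
    intro κ hκ
    have h1 : 0 < κ ^ 2 - 1 := by nlinarith
    have h2 := sinh_pi_mul_pos (κ := κ) (by linarith)
    have h3 : 0 < sinh (ℓ * κ) := Real.sinh_pos_iff.2 (by positivity)
    have hm : ∀ a : ℝ, HasDerivAt (fun κ : ℝ => a * κ) a κ := fun a => by
      simpa using (hasDerivAt_id κ).const_mul a
    have hy : HasDerivAt (fun κ : ℝ => κ ^ 2 - 1) (2 * κ) κ := by
      simpa using (hasDerivAt_pow 2 κ).sub_const 1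
    have h := ((((hm Real.pi).cosh.fun_mul (hm ℓ).cosh).sub_const c).fun_div
      ((hm Real.pi).sinh.fun_mul (hm ℓ).sinh) (mul_pos h2 h3).ne').fun_sub
      ((hy.div_const 4).fun_add (hy.fun_inv h1.ne'))
    simp only [secularQuot, one_div]
    exact h.congr_deriv (by ring)
  refine strictAntiOn_of_deriv_neg (convex_Ici 2)
    (fun κ hκ => (hd κ (by have : (2 : ℝ) ≤ κ := hκ; linarith)).continuousAt.continuousWithinAt) ?_
  intro κ hκ
  rw [interior_Ici] at hκ
  have hκ : 2 < κ := hκ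
  rw [(hd κ (by linarith)).deriv]
  have hκ0 : 0 < κ := by linarith
  have h2 := sinh_pi_mul_pos hκ0
  have h3 : 0 < sinh (ℓ * κ) := Real.sinh_pos_iff.2 (by positivity)
  have q1 := Real.cosh_sq (Real.pi * κ)
  have q2 := Real.cosh_sq (ℓ * κ)
  have hlt := sinh_div_lt hℓ hℓπ hκ0
  have hC : cosh (ℓ * κ) < cosh (Real.pi * κ) := by
    rw [Real.cosh_lt_cosh, abs_of_pos (by positivity), abs_of_pos (by positivity)]
    nlinarith
  have hC1 := Real.one_le_cosh (ℓ * κ)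
  have hpi := Real.pi_pos
  have hnum : (Real.pi * sinh (Real.pi * κ) * cosh (ℓ * κ)
        + ℓ * cosh (Real.pi * κ) * sinh (ℓ * κ)) * (sinh (Real.pi * κ) * sinh (ℓ * κ))
        - (cosh (Real.pi * κ) * cosh (ℓ * κ) - c) * (Real.pi * cosh (Real.pi * κ) * sinh (ℓ * κ)
          + ℓ * sinh (Real.pi * κ) * cosh (ℓ * κ)) ≤ 0 := by
    -- After `cosh² = 1 + sinh²` the numerator splits into two terms of visible sign: one from
    -- comparing `π` with `ℓ`, one proportional to `1 - c`.
    have e : (Real.pi * sinh (Real.pi * κ) * cosh (ℓ * κ)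
        + ℓ * cosh (Real.pi * κ) * sinh (ℓ * κ)) * (sinh (Real.pi * κ) * sinh (ℓ * κ))
        - (cosh (Real.pi * κ) * cosh (ℓ * κ) - c) * (Real.pi * cosh (Real.pi * κ) * sinh (ℓ * κ)
          + ℓ * sinh (Real.pi * κ) * cosh (ℓ * κ))
        = (cosh (Real.pi * κ) - cosh (ℓ * κ)) * (Real.pi * sinh (ℓ * κ) - ℓ * sinh (Real.pi * κ))
          - (1 - c) * (Real.pi * cosh (Real.pi * κ) * sinh (ℓ * κ)
            + ℓ * sinh (Real.pi * κ) * cosh (ℓ * κ)) := by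
      linear_combination (-Real.pi * cosh (ℓ * κ) * sinh (ℓ * κ)) * q1
        - (ℓ * cosh (Real.pi * κ) * sinh (Real.pi * κ)) * q2
    rw [e]
    have a1 : 0 ≤ (cosh (Real.pi * κ) - cosh (ℓ * κ))
        * (ℓ * sinh (Real.pi * κ) - Real.pi * sinh (ℓ * κ)) :=
      mul_nonneg (by linarith) (by linarith)
    have a2 : 0 ≤ (1 - c) * (Real.pi * cosh (Real.pi * κ) * sinh (ℓ * κ)
            + ℓ * sinh (Real.pi * κ) * cosh (ℓ * κ)) := by
      have := Real.cosh_pos (Real.pi * κ)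
      exact mul_nonneg (by linarith) (by positivity)
    linarith
  have hfrac := div_nonpos_of_nonpos_of_nonneg hnum
    (sq_nonneg (sinh (Real.pi * κ) * sinh (ℓ * κ)))
  have hy : 3 < κ ^ 2 - 1 := by nlinarith
  have hlast : 2 * κ / (κ ^ 2 - 1) ^ 2 < 2 * κ / 4 := by
    refine div_lt_div_of_pos_left (by positivity) (by norm_num) (by nlinarith)
  linarith

end RingChain

/-! ### Bounds for the quotient, and location of the two roots. -/

namespace RingChain

open Real (cosh sinh)

/-- The duplication formula with `cosh > sinh` squares a lower bound: `y` gives `y²/2`, and that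
gives `x⁴/32`. A quartic suffices to absorb the factor `m²` in `exists_far_root`. -/
lemma pow_four_div_le_sinh {x : ℝ} (hx : 0 ≤ x) : x ^ 4 / 32 ≤ sinh x := by
  have h1 : ∀ y : ℝ, 0 ≤ y → y ^ 2 / 2 ≤ sinh y := by
    intro y hy
    have e : sinh y = 2 * sinh (y / 2) * cosh (y / 2) := by
      rw [← Real.sinh_two_mul]; ring_nf
    have h2 := Real.self_le_sinh_iff.2 (show 0 ≤ y / 2 by positivity)
    have h3 := Real.sinh_lt_cosh (y / 2)
    nlinarith
  have e : sinh x = 2 * sinh (x / 2) * cosh (x / 2) := by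
    rw [← Real.sinh_two_mul]; ring_nf
  have h2 := h1 (x / 2) (by positivity)
  have h3 := Real.sinh_lt_cosh (x / 2)
  have h4 : 0 ≤ (x / 2) ^ 2 / 2 := by positivity
  calc x ^ 4 / 32 = 2 * ((x / 2) ^ 2 / 2) * ((x / 2) ^ 2 / 2) := by ring
    _ ≤ 2 * sinh (x / 2) * cosh (x / 2) := by gcongr; exact h2.trans h3.le
    _ = sinh x := e.symm

lemma two_mul_pow_four_le_sinh_pi_mul {κ : ℝ} (hκ : 0 ≤ κ) : 2 * κ ^ 4 ≤ sinh (Real.pi * κ) := by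
  have h := Real.pi_gt_three
  calc 2 * κ ^ 4 ≤ (3 * κ) ^ 4 / 32 := by nlinarith [pow_nonneg hκ 4]
    _ ≤ (Real.pi * κ) ^ 4 / 32 := by gcongr
    _ ≤ _ := pow_four_div_le_sinh (by positivity)

/-- This combines `cosh πκ > sinh πκ` with `sinh x ≤ x cosh x` and `x ≤ sinh x` at `x = ℓκ`. The
leading part `1/(ℓκ)` is the one that fixes the size of the larger root. -/
lemma le_secularQuot {ℓ κ c : ℝ} (hℓ : 0 < ℓ) (hκ : 1 < κ) (hc : c ≤ 1) :
    1 / (ℓ * κ) * (1 - 1 / sinh (Real.pi * κ)) - ((κ ^ 2 - 1) / 4 + 1 / (κ ^ 2 - 1))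
      ≤ secularQuot ℓ κ c := by
  have hκ0 : 0 < κ := by linarith
  have h2 := sinh_pi_mul_pos hκ0
  have hx : 0 < ℓ * κ := by positivity
  have h3 : 0 < sinh (ℓ * κ) := Real.sinh_pos_iff.2 hx
  unfold secularQuot
  gcongr
  have e : 1 / (ℓ * κ) * (1 - 1 / sinh (Real.pi * κ))
      = (sinh (Real.pi * κ) - 1) / (sinh (Real.pi * κ) * (ℓ * κ)) := by
    field_simp
  rw [e, div_le_div_iff₀ (by positivity) (by positivity)]
  have a1 := sinh_le_mul_cosh hx.le
  have a2 := Real.self_le_sinh_iff.2 hx.le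
  have a3 := Real.sinh_lt_cosh (Real.pi * κ)
  have a4 := Real.cosh_pos (ℓ * κ)
  have key : (sinh (Real.pi * κ) - 1) * sinh (ℓ * κ)
      ≤ (cosh (Real.pi * κ) * cosh (ℓ * κ) - c) * (ℓ * κ) := by
    have b1 : 0 ≤ sinh (Real.pi * κ) * (ℓ * κ * cosh (ℓ * κ) - sinh (ℓ * κ)) :=
      mul_nonneg h2.le (by linarith)
    have b2 : 0 ≤ (cosh (Real.pi * κ) - sinh (Real.pi * κ)) * cosh (ℓ * κ) * (ℓ * κ) :=
      mul_nonneg (mul_nonneg (by linarith) a4.le) hx.le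
    nlinarith
  nlinarith

/-- Both hyperbolic cosines are replaced by `sinh + 1`, the product is expanded, and `sinh ℓκ ≥ ℓκ`
is used. -/
lemma secularQuot_le {ℓ κ c : ℝ} (hℓ : 0 < ℓ) (hκ : 1 < κ) (hc : -1 ≤ c) :
    secularQuot ℓ κ c ≤ 1 + 1 / (ℓ * κ) + 1 / sinh (Real.pi * κ)
      + 2 * (1 / sinh (Real.pi * κ)) * (1 / (ℓ * κ)) - ((κ ^ 2 - 1) / 4 + 1 / (κ ^ 2 - 1)) := by
  have hκ0 : 0 < κ := by linarith
  have h2 := sinh_pi_mul_pos hκ0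
  have hx : 0 < ℓ * κ := by positivity
  have h3 : 0 < sinh (ℓ * κ) := Real.sinh_pos_iff.2 hx
  unfold secularQuot
  gcongr
  have a2 := Real.self_le_sinh_iff.2 hx.le
  have hc1 : ∀ x : ℝ, 0 < sinh x → cosh x ≤ sinh x + 1 := by
    intro x hx
    nlinarith [Real.cosh_sq x, Real.cosh_pos x]
  have a3 := hc1 _ h2
  have a4 := hc1 _ h3
  have a5 := Real.cosh_pos (ℓ * κ)
  calc _ ≤ ((sinh (Real.pi * κ) + 1) * (sinh (ℓ * κ) + 1) + 1)
        / (sinh (Real.pi * κ) * sinh (ℓ * κ)) := by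
        have : cosh (Real.pi * κ) * cosh (ℓ * κ)
          ≤ (sinh (Real.pi * κ) + 1) * (sinh (ℓ * κ) + 1) := by gcongr
        gcongr
        linarith
    _ = 1 + 1 / sinh (ℓ * κ) + 1 / sinh (Real.pi * κ)
      + 2 * (1 / sinh (Real.pi * κ)) * (1 / sinh (ℓ * κ)) := by field_simp; ring
    _ ≤ _ := by gcongr

lemma continuous_secular (ℓ c : ℝ) : Continuous fun κ => secular ℓ κ c := by
  unfold secular
  fun_prop

/-- The smaller root of the secular function. -/
noncomputable def upperRoot (ℓ c : ℝ) : ℝ := sInf {κ | 0 < κ ∧ secular ℓ κ c = 0}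

/-- The larger root of the secular function. -/
noncomputable def lowerRoot (ℓ c : ℝ) : ℝ := sSup {κ | 0 < κ ∧ secular ℓ κ c = 0}

/-- At `κ = 1` only the negative term survives. At `κ = 2` the quotient is at least `8 · 1/2 - (3/4
+ 1/3) > 0`, the 8 coming from `ℓ ≤ 1/16`. -/
lemma exists_near_root {ℓ c : ℝ} (hℓ : 0 < ℓ) (hℓ1 : ℓ ≤ 1 / 16) (hc : c ∈ Icc (-1 : ℝ) 1) :
    ∃ κ ∈ Ioo (1 : ℝ) 2, secular ℓ κ c = 0 := by
  have h1 : secular ℓ 1 c < 0 := by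
    have := sinh_pi_mul_pos one_pos
    have h3 : 0 < sinh (ℓ * 1) := Real.sinh_pos_iff.2 (by positivity)
    have := mul_pos this h3
    unfold secular
    norm_num at *
    linarith
  have h2 : 0 < secular ℓ 2 c := by
    rw [← secularQuot_pos_iff hℓ (by norm_num)]
    refine lt_of_lt_of_le ?_ (le_secularQuot hℓ (by norm_num) hc.2)
    have hS := two_mul_pow_four_le_sinh_pi_mul (κ := 2) (by norm_num)
    have e1 : 1 / sinh (Real.pi * 2) ≤ 1 / 2 := by
      apply one_div_le_one_div_of_le <;> linarith
    have e2 : 8 ≤ 1 / (ℓ * 2) := by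
      rw [le_div_iff₀ (by positivity)]; linarith
    nlinarith
  obtain ⟨κ, hκ, h⟩ := intermediate_value_Ioo (by norm_num) (continuous_secular ℓ c).continuousOn
    (show (0 : ℝ) ∈ Ioo (secular ℓ 1 c) (secular ℓ 2 c) from ⟨h1, h2⟩)
  exact ⟨κ, hκ, h⟩

/-- With `ℓ = 4/m³` the leading terms `1/(ℓκ)` and `κ²/4` balance exactly at `κ = m`. There the
quotient keeps the surplus `1/4`, which exceeds the errors `1/8` and `1/15`. -/
lemma exists_far_root {m c : ℝ} (hm : 4 ≤ m) (hc : c ∈ Icc (-1 : ℝ) 1) :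
    ∃ κ, m ≤ κ ∧ κ ^ 2 ≤ m ^ 2 + 14 ∧ secular (4 / m ^ 3) κ c = 0 := by
  have hm0 : 0 < m := by linarith
  have hℓ : 0 < 4 / m ^ 3 := by positivity
  have h1 : 0 < secular (4 / m ^ 3) m c := by
    rw [← secularQuot_pos_iff hℓ (by linarith)]
    refine lt_of_lt_of_le ?_ (le_secularQuot hℓ (by linarith) hc.2)
    have hS := two_mul_pow_four_le_sinh_pi_mul hm0.le
    have e1 : 1 / sinh (Real.pi * m) ≤ 1 / (2 * m ^ 4) :=
      one_div_le_one_div_of_le (by positivity) hS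
    have e2 : 1 / (4 / m ^ 3 * m) = m ^ 2 / 4 := by field_simp
    have e3 : m ^ 2 / 4 * (1 / (2 * m ^ 4)) = 1 / (8 * m ^ 2) := by field_simp; norm_num
    have e4 : 1 / (8 * m ^ 2) ≤ 1 / 8 := one_div_le_one_div_of_le (by norm_num) (by nlinarith)
    have e5 : 1 / (m ^ 2 - 1) ≤ 1 / 15 := one_div_le_one_div_of_le (by norm_num) (by nlinarith)
    have e6 : m ^ 2 / 4 * (1 / sinh (Real.pi * m)) ≤ m ^ 2 / 4 * (1 / (2 * m ^ 4)) := by gcongr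
    rw [e2]
    nlinarith
  -- At `κ = k` the positive terms sum to at most `m²/4 + 7/4`, against `(k² - 1)/4 = m²/4 + 13/4`,
  -- so 14 leaves room to spare.
  set k := √(m ^ 2 + 14) with hk
  have hk2 : k ^ 2 = m ^ 2 + 14 := Real.sq_sqrt (by positivity)
  have hmk : m < k := Real.lt_sqrt_of_sq_lt (by linarith)
  have hk0 : 0 < k := by linarith
  have h2 : secular (4 / m ^ 3) k c < 0 := by
    rw [secular_eq_mul_secularQuot hℓ (by linarith)]
    have hS0 := sinh_pi_mul_pos hk0
    have hSl : 0 < sinh (4 / m ^ 3 * k) := Real.sinh_pos_iff.2 (by positivity)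
    have hy : 0 < k ^ 2 - 1 := by rw [hk2]; nlinarith
    refine mul_neg_of_pos_of_neg (by positivity) ?_
    refine lt_of_le_of_lt (secularQuot_le hℓ (by linarith) hc.1) ?_
    have hS := two_mul_pow_four_le_sinh_pi_mul hk0.le
    have hmk4 : m ^ 4 ≤ k ^ 4 := by gcongr
    have hm4 : 1 ≤ m ^ 4 := one_le_pow₀ (by linarith)
    have e1 : 1 / sinh (Real.pi * k) ≤ 1 / (2 * m ^ 4) :=
      one_div_le_one_div_of_le (by positivity) (by linarith)
    have e1' : 1 / (2 * m ^ 4) ≤ 1 / 2 := one_div_le_one_div_of_le (by norm_num) (by linarith)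
    have e2 : 1 / (4 / m ^ 3 * k) ≤ m ^ 2 / 4 := by
      calc 1 / (4 / m ^ 3 * k) ≤ 1 / (4 / m ^ 3 * m) := by gcongr
        _ = _ := by field_simp
    have e3 : (1 / (2 * m ^ 4)) * (m ^ 2 / 4) = 1 / (8 * m ^ 2) := by field_simp; norm_num
    have e4 : 1 / (8 * m ^ 2) ≤ 1 / 8 := one_div_le_one_div_of_le (by norm_num) (by nlinarith)
    have e6 : 2 * (1 / sinh (Real.pi * k)) * (1 / (4 / m ^ 3 * k))
        ≤ 2 * (1 / (2 * m ^ 4)) * (m ^ 2 / 4) := by gcongr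
    have e7 : 0 < 1 / (k ^ 2 - 1) := by positivity
    nlinarith
  obtain ⟨κ, hκ, h⟩ := intermediate_value_Icc' hmk.le (continuous_secular (4 / m ^ 3) c).continuousOn
    (show (0 : ℝ) ∈ Icc (secular (4 / m ^ 3) k c) (secular (4 / m ^ 3) m c) from ⟨h2.le, h1.le⟩)
  refine ⟨κ, hκ.1, ?_, h⟩
  rw [← hk2]
  have := hκ.1
  exact pow_le_pow_left₀ (by linarith) hκ.2 2

/-- Zeros are excluded on `(0, 1]`, unique on `[1, 2]` by monotonicity of `secular` and unique on
`[2, ∞)` by that of `secularQuot`. The zero set is therefore a pair, and its `sInf` and `sSup` are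
the two roots. The condition `ℓ ≤ 1/16` is what makes `m = (4/ℓ)^(1/3)` at least 4. -/
lemma roots_spec {ℓ : ℝ} (hℓ : 0 < ℓ) (hℓ1 : ℓ ≤ 1 / 16)
    (hmono : ∀ c ≤ 1, StrictMonoOn (fun κ => secular ℓ κ c) (Icc 1 2))
    {c : ℝ} (hc : c ∈ Icc (-1 : ℝ) 1) :
    upperRoot ℓ c ∈ Ioo (1 : ℝ) 2 ∧ 2 < lowerRoot ℓ c ∧
      (4 / ℓ) ^ (2 / 3 : ℝ) ≤ lowerRoot ℓ c ^ 2 ∧ lowerRoot ℓ c ^ 2 ≤ (4 / ℓ) ^ (2 / 3 : ℝ) + 14 ∧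
      ∀ κ, 0 < κ → (secular ℓ κ c = 0 ↔ κ = lowerRoot ℓ c ∨ κ = upperRoot ℓ c) := by
  set m := (4 / ℓ) ^ (1 / 3 : ℝ) with hm
  have h4ℓ : 64 ≤ 4 / ℓ := by rw [le_div_iff₀ hℓ]; linarith
  have hm3 : m ^ 3 = 4 / ℓ := by
    rw [hm, ← Real.rpow_natCast, ← Real.rpow_mul (by positivity)]
    norm_num
  have hm2 : m ^ 2 = (4 / ℓ) ^ (2 / 3 : ℝ) := by
    rw [hm, ← Real.rpow_natCast, ← Real.rpow_mul (by positivity)]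
    norm_num
  have hm0 : 0 ≤ m := by positivity
  have hm4 : 4 ≤ m := by
    by_contra! h
    have : m ^ 3 < 4 ^ 3 := by gcongr
    rw [hm3] at this
    linarith
  have hℓm : ℓ = 4 / m ^ 3 := by rw [hm3]; field_simp
  obtain ⟨k, hmk, hkm, hk⟩ := exists_far_root hm4 hc
  rw [← hℓm] at hk
  obtain ⟨j, hj, hj0⟩ := exists_near_root hℓ hℓ1 hc
  have hk2 : 2 < k := by linarith
  have hanti := strictAntiOn_secularQuot (c := c) hℓ (by linarith [Real.pi_gt_three]) hc.2
  have hset : {κ | 0 < κ ∧ secular ℓ κ c = 0} = {j, k} := by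
    ext κ
    simp only [mem_ofPred_eq, mem_insert_iff, mem_singleton_iff]
    constructor
    · rintro ⟨hκ, h0⟩
      have hκ1 := one_lt_of_secular_eq_zero hℓ hκ hc.2 h0
      rcases le_total κ 2 with h2 | h2
      · left
        exact (hmono c hc.2).injOn ⟨hκ1.le, h2⟩ ⟨hj.1.le, hj.2.le⟩ (h0.trans hj0.symm)
      · right
        refine hanti.injOn h2 hk2.le ?_
        rw [(secularQuot_eq_zero_iff hℓ hκ1 c).2 h0,
          (secularQuot_eq_zero_iff hℓ (by linarith) c).2 hk]
    · rintro (rfl | rfl)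
      · exact ⟨by linarith [hj.1], hj0⟩
      · exact ⟨by linarith, hk⟩
  have hjk : j ≤ k := by linarith [hj.2]
  have hu : upperRoot ℓ c = j := by
    rw [upperRoot, hset, csInf_pair]
    exact min_eq_left hjk
  have hl : lowerRoot ℓ c = k := by
    rw [lowerRoot, hset, csSup_pair]
    exact max_eq_right hjk
  rw [hu, hl, ← hm2]
  refine ⟨hj, hk2, pow_le_pow_left₀ hm0 hmk 2, hkm, fun κ hκ => ?_⟩
  have : κ ∈ {κ | 0 < κ ∧ secular ℓ κ c = 0} ↔ κ ∈ ({j, k} : Set ℝ) := by rw [hset]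
  simp only [mem_ofPred_eq, mem_insert_iff, mem_singleton_iff, hκ, true_and] at this
  rw [this, or_comm]

/-- The values of the smaller root over all quasimomenta. -/
lemma image_upperRoot {ℓ : ℝ} (hℓ : 0 < ℓ) (hℓ1 : ℓ ≤ 1 / 16)
    (hmono : ∀ c ≤ 1, StrictMonoOn (fun κ => secular ℓ κ c) (Icc 1 2)) :
    upperRoot ℓ '' Icc (-1) 1 = Icc (upperRoot ℓ (-1)) (upperRoot ℓ 1) := by
  have hr := fun {c : ℝ} (hc : c ∈ Icc (-1 : ℝ) 1) => roots_spec hℓ hℓ1 hmono hc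
  have h0 : ∀ {c : ℝ}, c ∈ Icc (-1 : ℝ) 1 → secular ℓ (upperRoot ℓ c) c = 0 := fun {c} hc =>
    ((hr hc).2.2.2.2 _ (by linarith [(hr hc).1.1])).2 (Or.inr rfl)
  have hle : ∀ {c c' : ℝ}, c ∈ Icc (-1 : ℝ) 1 → c' ∈ Icc (-1 : ℝ) 1 → c ≤ c' →
      upperRoot ℓ c ≤ upperRoot ℓ c' := by
    intro c c' hc hc' hcc
    rcases hcc.eq_or_lt with rfl | hlt
    · exact le_rfl
    have h := secular_lt_of_lt (ℓ := ℓ) (hr hc').1.1 hlt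
    rw [h0 hc', ← h0 hc] at h
    exact ((hmono c hc.2).lt_iff_lt ⟨(hr hc).1.1.le, (hr hc).1.2.le⟩
      ⟨(hr hc').1.1.le, (hr hc').1.2.le⟩ |>.1 h).le
  have hm : (-1 : ℝ) ∈ Icc (-1 : ℝ) 1 := by norm_num
  have hp : (1 : ℝ) ∈ Icc (-1 : ℝ) 1 := by norm_num
  refine Subset.antisymm ?_ ?_
  · rintro _ ⟨c, hc, rfl⟩
    exact ⟨hle hm hc hc.1, hle hc hp hc.2⟩
  · rintro κ ⟨h1, h2⟩
    have hκ1 := (hr hm).1.1.trans_le h1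
    have hκ2 := h2.trans_lt (hr hp).1.2
    have a1 : 0 ≤ secular ℓ κ (-1) := by
      rw [← h0 hm]
      exact (hmono _ hm.2).monotoneOn ⟨(hr hm).1.1.le, (hr hm).1.2.le⟩ ⟨hκ1.le, hκ2.le⟩ h1
    have a2 : secular ℓ κ 1 ≤ 0 := by
      rw [← h0 hp]
      exact (hmono _ hp.2).monotoneOn ⟨hκ1.le, hκ2.le⟩ ⟨(hr hp).1.1.le, (hr hp).1.2.le⟩ h2
    -- The intermediate value theorem is applied in `c` with `κ` fixed, here and in
    -- `image_lowerRoot`, so continuity of the root in `c` is never needed.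
    obtain ⟨c, hc, hc0⟩ := intermediate_value_Icc' (f := fun c => secular ℓ κ c)
      (show (-1 : ℝ) ≤ 1 by norm_num) (by unfold secular; fun_prop) ⟨a2, a1⟩
    refine ⟨c, hc, ?_⟩
    rcases ((hr hc).2.2.2.2 κ (by linarith)).1 hc0 with h | h
    · have := (hr hc).2.1
      linarith
    · exact h.symm

/-- The values of the larger root over all quasimomenta. -/
lemma image_lowerRoot {ℓ : ℝ} (hℓ : 0 < ℓ) (hℓ1 : ℓ ≤ 1 / 16)
    (hmono : ∀ c ≤ 1, StrictMonoOn (fun κ => secular ℓ κ c) (Icc 1 2)) :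
    lowerRoot ℓ '' Icc (-1) 1 = Icc (lowerRoot ℓ 1) (lowerRoot ℓ (-1)) := by
  have hr := fun {c : ℝ} (hc : c ∈ Icc (-1 : ℝ) 1) => roots_spec hℓ hℓ1 hmono hc
  have h0 : ∀ {c : ℝ}, c ∈ Icc (-1 : ℝ) 1 → secular ℓ (lowerRoot ℓ c) c = 0 := fun {c} hc =>
    ((hr hc).2.2.2.2 _ (by linarith [(hr hc).2.1])).2 (Or.inl rfl)
  have hq : ∀ {c : ℝ}, c ∈ Icc (-1 : ℝ) 1 → secularQuot ℓ (lowerRoot ℓ c) c = 0 := fun {c} hc =>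
    (secularQuot_eq_zero_iff hℓ (by linarith [(hr hc).2.1]) c).2 (h0 hc)
  have hanti := fun {c : ℝ} (hc : c ∈ Icc (-1 : ℝ) 1) =>
    strictAntiOn_secularQuot (c := c) hℓ (by linarith [Real.pi_gt_three]) hc.2
  have hle : ∀ {c c' : ℝ}, c ∈ Icc (-1 : ℝ) 1 → c' ∈ Icc (-1 : ℝ) 1 → c ≤ c' →
      lowerRoot ℓ c' ≤ lowerRoot ℓ c := by
    intro c c' hc hc' hcc
    rcases hcc.eq_or_lt with rfl | hlt
    · exact le_rfl
    have h := secular_lt_of_lt (ℓ := ℓ) (κ := lowerRoot ℓ c') (by linarith [(hr hc').2.1]) hlt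
    rw [h0 hc', ← secularQuot_pos_iff hℓ (by linarith [(hr hc').2.1]), ← hq hc] at h
    exact ((hanti hc).lt_iff_gt (hr hc).2.1.le (hr hc').2.1.le |>.1 h).le
  have hm : (-1 : ℝ) ∈ Icc (-1 : ℝ) 1 := by norm_num
  have hp : (1 : ℝ) ∈ Icc (-1 : ℝ) 1 := by norm_num
  refine Subset.antisymm ?_ ?_
  · rintro _ ⟨c, hc, rfl⟩
    exact ⟨hle hc hp hc.2, hle hm hc hc.1⟩
  · rintro κ ⟨h1, h2⟩
    have hκ2 := (hr hp).2.1.trans_le h1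
    have hκ1 : 1 < κ := by linarith
    have hpos : 0 < 4 * (κ ^ 2 - 1) * (sinh (Real.pi * κ) * sinh (ℓ * κ)) := by
      have hκ0 : 0 < κ := by linarith
      have := sinh_pi_mul_pos hκ0
      have h3 : 0 < sinh (ℓ * κ) := Real.sinh_pos_iff.2 (by positivity)
      have : 0 < κ ^ 2 - 1 := by nlinarith
      positivity
    have a1 : 0 ≤ secular ℓ κ (-1) := by
      rw [secular_eq_mul_secularQuot hℓ hκ1]
      refine mul_nonneg hpos.le ?_
      rw [← hq hm]
      exact (hanti hm).antitoneOn hκ2.le (hr hm).2.1.le h2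
    have a2 : secular ℓ κ 1 ≤ 0 := by
      rw [secular_eq_mul_secularQuot hℓ hκ1]
      refine mul_nonpos_of_nonneg_of_nonpos hpos.le ?_
      rw [← hq hp]
      exact (hanti hp).antitoneOn (hr hp).2.1.le hκ2.le h1
    obtain ⟨c, hc, hc0⟩ := intermediate_value_Icc' (f := fun c => secular ℓ κ c)
      (show (-1 : ℝ) ≤ 1 by norm_num) (by unfold secular; fun_prop) ⟨a2, a1⟩
    refine ⟨c, hc, ?_⟩
    rcases ((hr hc).2.2.2.2 κ (by linarith)).1 hc0 with h | h
    · exact h.symm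
    · have := (hr hc).1.2
      linarith

end RingChain

/-! ### Asymptotics of the smaller root. -/

namespace RingChain

open Real (cosh sinh)

lemma eventually_lt_nhdsGT_zero {a : ℝ} (ha : 0 < a) : ∀ᶠ ℓ : ℝ in 𝓝[>] 0, 0 < ℓ ∧ ℓ < a :=
  Ioo_mem_nhdsGT ha

/-- In `4(κ² - 1)(cosh πκ cosh ℓκ - c) = sinh πκ sinh ℓκ ((κ² - 1)² + 4)` the bracket on the left is
at least 1, and the right side is `O(ℓ)` because `κ < 2`. -/
lemma upperRoot_sq_sub_one_isBigO {c : ℝ} (hc : c ∈ Icc (-1 : ℝ) 1) :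
    (fun ℓ : ℝ => upperRoot ℓ c ^ 2 - 1) =O[𝓝[>] 0] (fun ℓ : ℝ => ℓ) := by
  refine Asymptotics.IsBigO.of_bound (cosh (Real.pi * 2) * (2 * cosh 2) * (13 / 4)) ?_
  filter_upwards [eventually_strictMonoOn_secular,
    eventually_lt_nhdsGT_zero (by norm_num : (0 : ℝ) < 1 / 16)] with ℓ hmono hℓ
  obtain ⟨hℓ0, hℓ1⟩ := hℓ
  obtain ⟨hu, -, -, -, hiff⟩ := roots_spec hℓ0 hℓ1.le hmono hc
  have h0 := (hiff _ (by linarith [hu.1])).2 (Or.inr rfl)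
  set κ := upperRoot ℓ c
  obtain ⟨h1, h2⟩ := hu
  have hy0 : 0 < κ ^ 2 - 1 := by nlinarith
  have hy3 : κ ^ 2 - 1 ≤ 3 := by nlinarith
  rw [Real.norm_of_nonneg hy0.le, Real.norm_of_nonneg hℓ0.le]
  have hpi := Real.pi_gt_three
  have hCπ : cosh (Real.pi * κ) ≤ cosh (Real.pi * 2) := by
    rw [Real.cosh_le_cosh, abs_of_pos (by positivity), abs_of_pos (by positivity)]
    nlinarith
  have hSπ := (Real.sinh_lt_cosh _).le.trans hCπ
  have hSπ0 := sinh_pi_mul_pos (κ := κ) (by linarith)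
  have hSℓ0 : 0 < sinh (ℓ * κ) := Real.sinh_pos_iff.2 (by positivity)
  have hSℓ : sinh (ℓ * κ) ≤ ℓ * (2 * cosh 2) := by
    refine (sinh_le_mul_cosh (by positivity)).trans ?_
    rw [mul_assoc]
    gcongr
    rw [Real.cosh_le_cosh, abs_of_pos (by positivity), abs_of_pos (by positivity)]
    nlinarith
  have hC1 := Real.one_le_cosh (ℓ * κ)
  have hC2 : 2 ≤ cosh (Real.pi * κ) := by
    have := Real.self_lt_sinh_iff.2 (show 0 < Real.pi * κ by positivity)
    nlinarith [Real.sinh_lt_cosh (Real.pi * κ)]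
  have e5 : 1 ≤ cosh (Real.pi * κ) * cosh (ℓ * κ) - c := by nlinarith [hc.2]
  have e : sinh (Real.pi * κ) * sinh (ℓ * κ) * ((κ ^ 2 - 1) ^ 2 + 4)
      ≤ cosh (Real.pi * 2) * (ℓ * (2 * cosh 2)) * 13 := by
    gcongr
    nlinarith
  unfold secular at h0
  nlinarith

/-- Asymptotics of the smaller root as the link length tends to zero. -/
lemma upperRoot_asymptotics {c : ℝ} (hc : c ∈ Icc (-1 : ℝ) 1) :
    (fun ℓ : ℝ => upperRoot ℓ c ^ 2 - 1 - ℓ * (sinh Real.pi / (cosh Real.pi - c)))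
      =O[𝓝[>] 0] (fun ℓ : ℝ => ℓ ^ 2) := by
  set l : Filter ℝ := 𝓝[>] 0
  have hpos : ∀ᶠ ℓ in l, 1 < upperRoot ℓ c ∧ upperRoot ℓ c < 2 ∧ secular ℓ (upperRoot ℓ c) c = 0 := by
    filter_upwards [eventually_strictMonoOn_secular,
      eventually_lt_nhdsGT_zero (by norm_num : (0 : ℝ) < 1 / 16)] with ℓ hmono hℓ
    obtain ⟨hu, -, -, -, hiff⟩ := roots_spec hℓ.1 hℓ.2.le hmono hc
    exact ⟨hu.1, hu.2, (hiff _ (by linarith [hu.1])).2 (Or.inr rfl)⟩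
  have hid0 : Tendsto (fun ℓ : ℝ => ℓ) l (𝓝 0) := nhdsWithin_le_nhds
  have hy := upperRoot_sq_sub_one_isBigO hc
  have hκ : (fun ℓ : ℝ => upperRoot ℓ c - 1) =O[l] (fun ℓ : ℝ => ℓ) := by
    refine (Asymptotics.IsBigO.of_bound 1 ?_).trans hy
    filter_upwards [hpos] with ℓ h
    rw [Real.norm_of_nonneg (by linarith), Real.norm_of_nonneg (by nlinarith)]
    nlinarith
  have hκ1 : Tendsto (fun ℓ : ℝ => upperRoot ℓ c) l (𝓝 1) := by
    have := (hκ.trans_tendsto hid0).add_const 1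
    simpa using this
  have hx0 : Tendsto (fun ℓ : ℝ => ℓ * upperRoot ℓ c) l (𝓝 0) := by
    simpa using hid0.mul hκ1
  have hκO : (fun ℓ : ℝ => upperRoot ℓ c) =O[l] (fun _ => (1 : ℝ)) := hκ1.isBigO_one ℝ
  have hx : (fun ℓ : ℝ => ℓ * upperRoot ℓ c) =O[l] (fun ℓ : ℝ => ℓ) := by
    simpa using (Asymptotics.isBigO_refl (fun ℓ : ℝ => ℓ) l).mul hκO
  have hC : (fun ℓ : ℝ => cosh (Real.pi * upperRoot ℓ c) - cosh Real.pi) =O[l] (fun ℓ : ℝ => ℓ) := by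
    have hd : HasDerivAt (fun x : ℝ => cosh (Real.pi * x)) _ 1 :=
      ((hasDerivAt_id' (1 : ℝ)).const_mul Real.pi).cosh
    have := hd.differentiableAt.isBigO_sub.comp_tendsto hκ1
    refine Asymptotics.IsBigO.trans (g := fun ℓ => upperRoot ℓ c - 1) ?_ hκ
    simpa [Function.comp_def] using this
  have hS : (fun ℓ : ℝ => sinh (Real.pi * upperRoot ℓ c) - sinh Real.pi) =O[l] (fun ℓ : ℝ => ℓ) := by
    have hd : HasDerivAt (fun x : ℝ => sinh (Real.pi * x)) _ 1 :=
      ((hasDerivAt_id' (1 : ℝ)).const_mul Real.pi).sinh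
    have := hd.differentiableAt.isBigO_sub.comp_tendsto hκ1
    refine Asymptotics.IsBigO.trans (g := fun ℓ => upperRoot ℓ c - 1) ?_ hκ
    simpa [Function.comp_def] using this
  have hCl : (fun ℓ : ℝ => cosh (ℓ * upperRoot ℓ c) - 1) =O[l] (fun ℓ : ℝ => ℓ) := by
    have := (Real.hasDerivAt_cosh 0).differentiableAt.isBigO_sub.comp_tendsto hx0
    refine Asymptotics.IsBigO.trans (g := fun ℓ => ℓ * upperRoot ℓ c) ?_ hx
    simpa [Function.comp_def] using this
  have hSl : (fun ℓ : ℝ => sinh (ℓ * upperRoot ℓ c)) =O[l] (fun ℓ : ℝ => ℓ) := by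
    have := (Real.hasDerivAt_sinh 0).differentiableAt.isBigO_sub.comp_tendsto hx0
    refine Asymptotics.IsBigO.trans (g := fun ℓ => ℓ * upperRoot ℓ c) ?_ hx
    simpa [Function.comp_def] using this
  have hClO : (fun ℓ : ℝ => cosh (ℓ * upperRoot ℓ c)) =O[l] (fun _ => (1 : ℝ)) := by
    refine Tendsto.isBigO_one ℝ (c := cosh 0) ?_
    exact (Real.continuous_cosh.tendsto 0).comp hx0
  have hSO : (fun ℓ : ℝ => sinh (Real.pi * upperRoot ℓ c)) =O[l] (fun _ => (1 : ℝ)) := by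
    refine Tendsto.isBigO_one ℝ (c := sinh (Real.pi * 1)) ?_
    exact (Real.continuous_sinh.tendsto _).comp (hκ1.const_mul _)
  -- `sinh x - x = O(x²)`, from `x ≤ sinh x ≤ x cosh x`
  have hSl2 : (fun ℓ : ℝ => sinh (ℓ * upperRoot ℓ c) - ℓ * upperRoot ℓ c) =O[l]
      (fun ℓ : ℝ => ℓ ^ 2) := by
    refine Asymptotics.IsBigO.trans (g := fun ℓ => ℓ * upperRoot ℓ c * (cosh (ℓ * upperRoot ℓ c) - 1))
      (Asymptotics.IsBigO.of_bound 1 ?_) (by simpa [sq] using hx.mul hCl)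
    filter_upwards [hpos, self_mem_nhdsWithin] with ℓ h hℓ
    have hℓ : 0 < ℓ := hℓ
    have hp : 0 ≤ ℓ * upperRoot ℓ c := mul_nonneg hℓ.le (by linarith)
    have a1 := Real.self_le_sinh_iff.2 hp
    have a2 := sinh_le_mul_cosh hp
    have a3 := Real.one_le_cosh (ℓ * upperRoot ℓ c)
    rw [Real.norm_of_nonneg (by linarith), Real.norm_of_nonneg (mul_nonneg hp (by linarith))]
    linarith
  have hD : cosh Real.pi - c ≠ 0 := by
    have : 1 < cosh Real.pi := Real.one_lt_cosh.2 Real.pi_ne_zero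
    linarith [hc.2]
  -- This is the secular equation solved for `(κ² - 1)(cosh π - c) - ℓ sinh π`, each hyperbolic
  -- value being compared with its value at `κ = 1`, `ℓ = 0`. Every remaining summand is of second
  -- order in `ℓ`.
  have hmain : (fun ℓ : ℝ => (cosh Real.pi - c)⁻¹ *
      (-((upperRoot ℓ c ^ 2 - 1) * ((cosh (Real.pi * upperRoot ℓ c) - cosh Real.pi)
            * cosh (ℓ * upperRoot ℓ c) + cosh Real.pi * (cosh (ℓ * upperRoot ℓ c) - 1)))
        + (1 / 4 * (sinh (Real.pi * upperRoot ℓ c) *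
            ((upperRoot ℓ c ^ 2 - 1) * sinh (ℓ * upperRoot ℓ c) * (upperRoot ℓ c ^ 2 - 1)))
        + (sinh (Real.pi * upperRoot ℓ c) - sinh Real.pi) * sinh (ℓ * upperRoot ℓ c)
        + sinh Real.pi * ((sinh (ℓ * upperRoot ℓ c) - ℓ * upperRoot ℓ c)
          + ℓ * (upperRoot ℓ c - 1))))) =O[l] (fun ℓ : ℝ => ℓ ^ 2) := by
    have hyO : (fun ℓ : ℝ => upperRoot ℓ c ^ 2 - 1) =O[l] (fun _ => (1 : ℝ)) :=
      hy.trans (hid0.isBigO_one ℝ)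
    have t1 : (fun ℓ : ℝ => (cosh (Real.pi * upperRoot ℓ c) - cosh Real.pi)
            * cosh (ℓ * upperRoot ℓ c) + cosh Real.pi * (cosh (ℓ * upperRoot ℓ c) - 1))
        =O[l] (fun ℓ : ℝ => ℓ) := by
      refine Asymptotics.IsBigO.add ?_ (hCl.const_mul_left _)
      simpa using hC.mul hClO
    have t2 := (hy.mul t1).neg_left
    have t3 := (hSO.mul ((hy.mul hSl).mul hyO)).const_mul_left (1 / 4)
    have t4 := hS.mul hSl
    have t5 := ((Asymptotics.isBigO_refl (fun ℓ : ℝ => ℓ) l).mul hκ)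
    simp only [one_mul, mul_one, ← sq] at t2 t3 t4 t5
    exact (t2.add ((t3.add t4).add ((hSl2.add t5).const_mul_left _))).const_mul_left _
  refine hmain.congr' ?_ EventuallyEq.rfl
  filter_upwards [hpos] with ℓ h
  obtain ⟨-, -, h0⟩ := h
  unfold secular at h0
  generalize cosh (Real.pi * upperRoot ℓ c) = C, sinh (Real.pi * upperRoot ℓ c) = S,
    cosh (ℓ * upperRoot ℓ c) = C', sinh (ℓ * upperRoot ℓ c) = S' at h0 ⊢
  field_simp
  linear_combination (-1) * h0
end RingChain

/-! ### The vertex conditions for solutions of `-u'' = z u`, and the secular determinant. -/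

namespace RingChain

open Complex (I)

/-- The vertex coupling solved for the derivatives. -/
lemma coupled_iff (x y t : ℂ × ℂ) :
    Coupled ![x, y, t] ↔
      x.2 = I * (y.1 - t.1) ∧ y.2 = I * (t.1 - x.1) ∧ t.2 = I * (x.1 - y.1) := by
  have hI := Complex.I_sq
  constructor
  · intro h
    have h0 := h 0
    have h1 := h 1
    have h2 := h 2
    simp at h0 h1 h2
    refine ⟨?_, ?_, ?_⟩
    -- Each derivative occurs in two of the three equations, so an alternating sum isolates it.
    · linear_combination (-I / 2) * (h0 - h1 + h2) + x.2 * hI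
    · linear_combination (-I / 2) * (h0 + h1 - h2) + y.2 * hI
    · linear_combination (-I / 2) * (-h0 + h1 + h2) + t.2 * hI
  · rintro ⟨h0, h1, h2⟩ j
    fin_cases j
    · simp
      linear_combination I * (h0 + h1) + (y.1 - x.1) * hI
    · simp
      linear_combination I * (h1 + h2) + (t.1 - y.1) * hI
    · simp
      linear_combination I * (h0 + h2) + (x.1 - t.1) * hI

/-- A fundamental system of solutions of `-u'' = z u`. -/
structure IsFundamental (z : ℂ) (c s : ℝ → ℂ) : Prop where
  c_zero : c 0 = 1
  s_zero : s 0 = 0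
  hasDerivAt_c : ∀ x, HasDerivAt c (-z * s x) x
  hasDerivAt_s : ∀ x, HasDerivAt s (c x) x

/-- Boundary data of the solution of `-u'' = z u` whose value and derivative at the left end of
each edge `e` are `a e`. -/
def homData {E : Type} (z : ℂ) (c s : ℝ → ℂ) (L : E → ℝ) (a : E → ℂ × ℂ) : BoundaryData E
  | (e, false) => a e
  | (e, true) => ((a e).1 * c (L e) + (a e).2 * s (L e),
      z * s (L e) * (a e).1 - c (L e) * (a e).2)

/-- The vertex conditions on the period cell for functions which are multiplied by `w` when
passing to the next cell. -/
def BlochCoupled (w : ℂ) (t : BoundaryData (Fin 3)) : Prop :=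
  Coupled ![t (0, true), t (2, false), t (1, false)] ∧
    Coupled ![w • t (0, false), t (1, true), t (2, true)]

/-- There is a solution of `-u'' = z u` on the period cell satisfying the vertex conditions. -/
def HasBloch (z : ℂ) (c s : ℝ → ℂ) (ℓ : ℝ) (w : ℂ) : Prop :=
  ∃ a : Fin 3 → ℂ × ℂ, a ≠ 0 ∧ BlochCoupled w (homData z c s (cellLength ℓ) a)

/-- The secular determinant of the period cell. -/
def secularDet (z C S C' S' w : ℂ) : ℂ :=
  z * S * S' * w * ((z + 1) ^ 2 + 4) - 2 * (z + 1) * (2 * C * C' * w - (w ^ 2 + 1))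

lemma blochCoupled_homData_iff {z : ℂ} {c s : ℝ → ℂ} {ℓ : ℝ} {w : ℂ} {a : Fin 3 → ℂ × ℂ} :
    BlochCoupled w (homData z c s (cellLength ℓ) a) ↔
      (z * s ℓ * (a 0).1 - c ℓ * (a 0).2 = I * ((a 2).1 - (a 1).1) ∧
        (a 2).2 = I * ((a 1).1 - ((a 0).1 * c ℓ + (a 0).2 * s ℓ)) ∧
        (a 1).2 = I * (((a 0).1 * c ℓ + (a 0).2 * s ℓ) - (a 2).1)) ∧
      (w * (a 0).2 = I * (((a 1).1 * c Real.pi + (a 1).2 * s Real.pi)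
          - ((a 2).1 * c Real.pi + (a 2).2 * s Real.pi)) ∧
        z * s Real.pi * (a 1).1 - c Real.pi * (a 1).2
          = I * (((a 2).1 * c Real.pi + (a 2).2 * s Real.pi) - w * (a 0).1) ∧
        z * s Real.pi * (a 2).1 - c Real.pi * (a 2).2
          = I * (w * (a 0).1 - ((a 1).1 * c Real.pi + (a 1).2 * s Real.pi))) := by
  simp [BlochCoupled, coupled_iff, homData, cellLength]

/-- If the secular determinant does not vanish, the vertex conditions have only the trivial
solution. -/
lemma eq_zero_of_secularDet_ne_zero {z : ℂ} {c s : ℝ → ℂ} {ℓ : ℝ} {w : ℂ} {a : Fin 3 → ℂ × ℂ}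
    (hπ : c Real.pi ^ 2 + z * s Real.pi ^ 2 = 1) (hℓ : c ℓ ^ 2 + z * s ℓ ^ 2 = 1)
    (hz : z ≠ 0) (hS : s Real.pi ≠ 0) (hS' : s ℓ ≠ 0)
    (hD : secularDet z (c Real.pi) (s Real.pi) (c ℓ) (s ℓ) w ≠ 0)
    (h : BlochCoupled w (homData z c s (cellLength ℓ) a)) : a = 0 := by
  rw [blochCoupled_homData_iff] at h
  obtain ⟨⟨h1, h2, h3⟩, h4, h5, h6⟩ := h
  have hI := Complex.I_sq
  have hI0 := Complex.I_ne_zero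
  unfold secularDet at hD
  generalize c Real.pi = C at *
  generalize s Real.pi = S at *
  generalize c ℓ = C' at *
  generalize s ℓ = S' at *
  -- Notation: `p`, `q` are the values at the left and right ends of the link, `r1`, `r2` and `t1`,
  -- `t2` those at the left and right ends of the two half-rings, and `b0`, `b1`, `b2` the initial
  -- derivatives.
  obtain ⟨q, hq⟩ : ∃ q, q = (a 0).1 * C' + (a 0).2 * S' := ⟨_, rfl⟩
  obtain ⟨t1, ht1⟩ : ∃ q, q = (a 1).1 * C + (a 1).2 * S := ⟨_, rfl⟩
  obtain ⟨t2, ht2⟩ : ∃ q, q = (a 2).1 * C + (a 2).2 * S := ⟨_, rfl⟩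
  rw [← hq] at h2 h3
  rw [← ht1, ← ht2] at h4
  rw [← ht2] at h5
  rw [← ht1] at h6
  obtain ⟨p, hp⟩ : ∃ p, p = (a 0).1 := ⟨_, rfl⟩
  obtain ⟨b0, hb0⟩ : ∃ p, p = (a 0).2 := ⟨_, rfl⟩
  obtain ⟨r1, hr1⟩ : ∃ p, p = (a 1).1 := ⟨_, rfl⟩
  obtain ⟨b1, hb1⟩ : ∃ p, p = (a 1).2 := ⟨_, rfl⟩
  obtain ⟨r2, hr2⟩ : ∃ p, p = (a 2).1 := ⟨_, rfl⟩
  obtain ⟨b2, hb2⟩ : ∃ p, p = (a 2).2 := ⟨_, rfl⟩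
  simp only [← hp, ← hb0, ← hr1, ← hb1, ← hr2, ← hb2] at h1 h2 h3 h4 h5 h6 hq ht1 ht2
  -- The Wronskian identities remove the derivatives, and the ring equations separate into sums and
  -- differences over the two half-rings.
  have H1 : p - C' * q = -I * S' * (r1 - r2) := by
    linear_combination S' * h1 - C' * hq - p * hℓ
  have H2 : w * (q - C' * p) = I * S' * (t1 - t2) := by
    linear_combination S' * h4 + w * hq
  have H3 : t1 + t2 - C * (r1 + r2) = I * S * (r1 - r2) := by
    linear_combination ht1 + ht2 + S * h2 + S * h3
  have H4 : t1 - t2 - C * (r1 - r2) = I * S * (2 * q - (r1 + r2)) := by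
    linear_combination ht1 - ht2 + S * h3 - S * h2
  have H5 : r1 + r2 - C * (t1 + t2) = -I * S * (t1 - t2) := by
    linear_combination S * (h5 + h6) - (r1 + r2) * hπ - C * (ht1 + ht2)
  have H6 : r1 - r2 - C * (t1 - t2) = I * S * (t1 + t2 - 2 * w * p) := by
    linear_combination S * (h5 - h6) - (r1 - r2) * hπ - C * (ht1 - ht2)
  have K1 : z * S * (t1 + t2) = I * (r1 - r2 - C * (t1 - t2)) := by
    refine mul_left_cancel₀ hS ?_
    linear_combination H3 + C * H5 + (t1 + t2) * hπ
  have K2 : z * S * (r1 + r2) = I * (C * (r1 - r2) - (t1 - t2)) := by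
    refine mul_left_cancel₀ hS ?_
    linear_combination C * H3 + H5 + (r1 + r2) * hπ
  have L1 : (z + 1) * (t1 - t2 - C * (r1 - r2)) = 2 * I * z * S * q := by
    linear_combination z * H4 - I * K2 - (C * (r1 - r2) - (t1 - t2)) * hI
  have L2 : (z + 1) * (r1 - r2 - C * (t1 - t2)) = -2 * I * z * S * w * p := by
    linear_combination z * H6 + I * K1 + (r1 - r2 - C * (t1 - t2)) * hI
  -- Only `p` and `q` remain: `M1` and `M2` form a homogeneous 2×2 system whose determinant is, up
  -- to sign, `z S S'` times the secular determinant. Cramer's rule gives `hP` and `hQ`.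
  have M1 : (z + 1) * (w * (q - C' * p) + C * (p - C' * q)) = -2 * z * S * S' * q := by
    linear_combination (z + 1) * (H2 + C * H1) + I * S' * L1 + 2 * z * S * S' * q * hI
  have M2 : (z + 1) * (p - C' * q + C * w * (q - C' * p)) = -2 * z * S * S' * w * p := by
    linear_combination (z + 1) * (H1 + C * H2) - I * S' * L2 + 2 * z * S * S' * w * p * hI
  have hP : p = 0 := by
    have : z * S * S' * (z * S * S' * w * ((z + 1) ^ 2 + 4)
        - 2 * (z + 1) * (2 * C * C' * w - (w ^ 2 + 1))) * p = 0 := by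
      linear_combination -(z + 1) * (C * w - C') * M1
        + ((z + 1) * (w - C * C') + 2 * z * S * S') * M2
        + (z + 1) ^ 2 * w * p * ((1 - C' ^ 2) * hπ + z * S ^ 2 * hℓ)
    simpa [hz, hS, hS', hD] using this
  have hQ : q = 0 := by
    have : z * S * S' * (z * S * S' * w * ((z + 1) ^ 2 + 4)
        - 2 * (z + 1) * (2 * C * C' * w - (w ^ 2 + 1))) * q = 0 := by
      linear_combination -(z + 1) * (C - w * C') * M2
        + ((z + 1) * (1 - C * C' * w) + 2 * z * S * S' * w) * M1
        + (z + 1) ^ 2 * w * q * ((1 - C' ^ 2) * hπ + z * S ^ 2 * hℓ)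
    simpa [hz, hS, hS', hD] using this
  have hR : r1 - r2 = 0 := by
    have : I * S' * (r1 - r2) = 0 := by linear_combination H1 - hP + C' * hQ
    simpa [hI0, hS'] using this
  have hT : t1 - t2 = 0 := by
    have : I * S' * (t1 - t2) = 0 := by linear_combination -H2 + w * hQ - w * C' * hP
    simpa [hI0, hS'] using this
  have hR' : r1 + r2 = 0 := by
    have : z * S * (r1 + r2) = 0 := by linear_combination K2 + I * C * hR - I * hT
    simpa [hz, hS] using this
  have e1 : r1 = 0 := by linear_combination (hR + hR') / 2
  have e2 : r2 = 0 := by linear_combination (hR' - hR) / 2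
  have e0 : b0 = 0 := by
    have : S' * b0 = 0 := by linear_combination -hq + hQ - C' * hP
    simpa [hS'] using this
  have e3 : b1 = 0 := by rw [h3, hQ, e2]; ring
  have e4 : b2 = 0 := by rw [h2, hQ, e1]; ring
  funext j
  fin_cases j
  · exact Prod.ext (hp.symm.trans hP) (hb0.symm.trans e0)
  · exact Prod.ext (hr1.symm.trans e1) (hb1.symm.trans e3)
  · exact Prod.ext (hr2.symm.trans e2) (hb2.symm.trans e4)

lemma exists_ne_zero_of_det_eq_zero {a b c d : ℂ} (h : a * d - b * c = 0) :
    ∃ p q : ℂ, (p ≠ 0 ∨ q ≠ 0) ∧ a * p + b * q = 0 ∧ c * p + d * q = 0 := by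
  have hdet : (!![a, b; c, d] : Matrix (Fin 2) (Fin 2) ℂ).det = 0 := by
    rw [Matrix.det_fin_two_of, h]
  obtain ⟨v, hv, hv0⟩ := Matrix.exists_mulVec_eq_zero_iff.2 hdet
  refine ⟨v 0, v 1, ?_, ?_, ?_⟩
  · by_contra! hcon
    refine hv (funext fun i => ?_)
    fin_cases i
    · exact hcon.1
    · exact hcon.2
  · have := congrFun hv0 0
    simpa [Matrix.mulVec, dotProduct, Fin.sum_univ_two] using this
  · have := congrFun hv0 1
    simpa [Matrix.mulVec, dotProduct, Fin.sum_univ_two] using this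

/-- If the secular determinant vanishes, the vertex conditions have a nontrivial solution. -/
lemma hasBloch_of_secularDet_eq_zero {z : ℂ} {c s : ℝ → ℂ} {ℓ : ℝ} {w : ℂ}
    (hπ : c Real.pi ^ 2 + z * s Real.pi ^ 2 = 1) (hℓ : c ℓ ^ 2 + z * s ℓ ^ 2 = 1)
    (hz : z ≠ 0) (hS : s Real.pi ≠ 0) (hS' : s ℓ ≠ 0) (hw : w ≠ 0)
    (hD : secularDet z (c Real.pi) (s Real.pi) (c ℓ) (s ℓ) w = 0) : HasBloch z c s ℓ w := by
  unfold HasBloch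
  simp only [blochCoupled_homData_iff]
  have hI := Complex.I_sq
  unfold secularDet at hD
  generalize c Real.pi = C at *
  generalize s Real.pi = S at *
  generalize c ℓ = C' at *
  generalize s ℓ = S' at *
  -- The same 2×2 system for the end values of the link, now with vanishing determinant. The rest
  -- runs the elimination backwards: `r`, `t` are the differences and `r'`, `t'` the sums of the
  -- half-ring values at the left and right ends, `b` is the initial derivative on the link.
  obtain ⟨p, q, hpq, M1, M2⟩ := exists_ne_zero_of_det_eq_zero
    (a := (z + 1) * (C - w * C')) (b := (z + 1) * (w - C * C') + 2 * z * S * S')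
    (c := (z + 1) * (1 - C * C' * w) + 2 * z * S * S' * w) (d := (z + 1) * (C * w - C')) (by
      linear_combination -z * S * S' * hD
        + (z + 1) ^ 2 * w * ((1 - C' ^ 2) * hπ + z * S ^ 2 * hℓ))
  obtain ⟨r, hr⟩ : ∃ r, S' * r = I * (p - C' * q) :=
    ⟨I * (p - C' * q) / S', by field_simp⟩
  obtain ⟨t, ht⟩ : ∃ t, S' * t = -I * w * (q - C' * p) :=
    ⟨-I * w * (q - C' * p) / S', by field_simp⟩
  obtain ⟨r', hr'⟩ : ∃ r', z * S * r' = I * (C * r - t) :=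
    ⟨I * (C * r - t) / (z * S), by field_simp⟩
  obtain ⟨t', ht'⟩ : ∃ t', z * S * t' = I * (r - C * t) :=
    ⟨I * (r - C * t) / (z * S), by field_simp⟩
  obtain ⟨b, hb⟩ : ∃ b, S' * b = q - C' * p := ⟨(q - C' * p) / S', by field_simp⟩
  have L1 : (z + 1) * (t - C * r) = 2 * I * z * S * q := by
    refine mul_left_cancel₀ hS' ?_
    linear_combination (z + 1) * (ht - C * hr) - I * M1
  have L2 : (z + 1) * (r - C * t) = -2 * I * z * S * w * p := by
    refine mul_left_cancel₀ hS' ?_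
    linear_combination (z + 1) * (hr - C * ht) + I * M2
  have et : t = C * r + I * S * (2 * q - r') := by
    refine mul_left_cancel₀ hz ?_
    linear_combination L1 + I * hr' + (C * r - t) * hI
  have er : r = C * t + I * S * (t' - 2 * w * p) := by
    refine mul_left_cancel₀ hz ?_
    linear_combination L2 - I * ht' - (r - C * t) * hI
  have et' : t' = C * r' + I * S * r := by
    refine mul_left_cancel₀ (mul_ne_zero hz hS) ?_
    linear_combination ht' - C * hr' - I * r * hπ
  have er' : r' = C * t' - I * S * t := by
    refine mul_left_cancel₀ (mul_ne_zero hz hS) ?_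
    linear_combination hr' - C * ht' + I * t * hπ
  have eq : p * C' + b * S' = q := by linear_combination hb
  have e1 : (r' + r) / 2 * C + I * (q - (r' - r) / 2) * S = (t' + t) / 2 := by
    linear_combination -(et + et') / 2
  have e2 : (r' - r) / 2 * C + I * ((r' + r) / 2 - q) * S = (t' - t) / 2 := by
    linear_combination (et - et') / 2
  refine ⟨![(p, b), ((r' + r) / 2, I * (q - (r' - r) / 2)),
    ((r' - r) / 2, I * ((r' + r) / 2 - q))], ?_, ?_⟩
  · intro h0
    have h1 : (p, b) = 0 := congrFun h0 0
    have hp : p = 0 := congrArg Prod.fst h1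
    have hb' : b = 0 := congrArg Prod.snd h1
    rw [hp, hb'] at eq
    simp [hp, ← eq] at hpq
  · simp only [Matrix.cons_val_zero, Matrix.cons_val_one, Matrix.cons_val]
    rw [eq, e1, e2]
    refine ⟨⟨?_, rfl, rfl⟩, ?_, ?_, ?_⟩
    · refine mul_left_cancel₀ hS' ?_
      linear_combination p * hℓ - C' * hb + I * hr + (p - C' * q) * hI
    · refine mul_left_cancel₀ hS' ?_
      linear_combination w * hb - I * ht + w * (q - C' * p) * hI
    · refine mul_left_cancel₀ hS ?_
      linear_combination (r' + r) / 2 * hπ - C * e1 + (er + er') / 2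
    · refine mul_left_cancel₀ hS ?_
      linear_combination (r' - r) / 2 * hπ - C * e2 + (er' - er) / 2

/-- Solution of the vertex conditions when the ring supports a Dirichlet eigenfunction. -/
lemma hasBloch_of_dirichlet {z : ℂ} {c s : ℝ → ℂ} {ℓ : ℝ} {w : ℂ}
    (hπ : c Real.pi ^ 2 = 1) (hS : s Real.pi = 0) (hℓ : c ℓ ^ 2 + z * s ℓ ^ 2 = 1)
    (hS' : s ℓ ≠ 0) (hD : w ^ 2 + 1 = 2 * c Real.pi * c ℓ * w) :
    HasBloch z c s ℓ w := by
  unfold HasBloch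
  simp only [blochCoupled_homData_iff, hS]
  have hI := Complex.I_sq
  generalize c Real.pi = C at *
  generalize c ℓ = C' at *
  generalize s ℓ = S' at *
  obtain ⟨b, hb⟩ : ∃ b, S' * b = w - C' * C := ⟨(w - C' * C) / S', by field_simp⟩
  obtain ⟨r, hr⟩ : ∃ r, S' * r = -I * (C - C' * w) := ⟨-I * (C - C' * w) / S', by field_simp⟩
  have eq : C * C' + b * S' = w := by linear_combination hb
  -- The link takes the values `C` and `w` at its ends; for these the conditions at the two ends are
  -- compatible exactly because of `hD`. The upper half-ring starts with value 0.
  refine ⟨![(C, b), (0, I * (w - r)), (r, -I * w)], ?_, ?_⟩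
  · intro h0
    have h1 : (C, b) = 0 := congrFun h0 0
    have hp : C = 0 := congrArg Prod.fst h1
    simp [hp] at hπ
  · simp only [Matrix.cons_val_zero, Matrix.cons_val_one, Matrix.cons_val]
    rw [eq]
    refine ⟨⟨?_, by ring, rfl⟩, ?_, ?_, ?_⟩
    · refine mul_left_cancel₀ hS' ?_
      linear_combination C * hℓ - C' * hb - I * hr + (C - C' * w) * hI
    · refine mul_left_cancel₀ hS' ?_
      linear_combination w * hb + I * C * hr + hD + hπ - C * (C - C' * w) * hI
    · ring
    · ring

/-- Constants are generalized eigenfunctions at the energy zero. -/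
lemma hasBloch_zero {c s : ℝ → ℂ} {ℓ : ℝ} (hπ : c Real.pi = 1) (hℓ : c ℓ = 1) :
    HasBloch 0 c s ℓ 1 := by
  unfold HasBloch
  simp only [blochCoupled_homData_iff]
  refine ⟨fun _ => (1, 0), fun h => ?_, by simp [hπ, hℓ]⟩
  exact one_ne_zero (congrArg Prod.fst (congrFun h 0))

end RingChain

/-! ### Solutions on a single edge: uniqueness and variation of parameters. -/

namespace RingChain

namespace IsFundamental

variable {z : ℂ} {c s : ℝ → ℂ}

lemma continuous_c (h : IsFundamental z c s) : Continuous c :=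
  continuous_iff_continuousAt.2 fun x => (h.hasDerivAt_c x).continuousAt

lemma continuous_s (h : IsFundamental z c s) : Continuous s :=
  continuous_iff_continuousAt.2 fun x => (h.hasDerivAt_s x).continuousAt

/-- With `c' = -z s` and `s' = c` this is the Wronskian `c s' - c' s`, which is constant. -/
lemma wronskian (h : IsFundamental z c s) (x : ℝ) : c x ^ 2 + z * s x ^ 2 = 1 := by
  have hd : ∀ x, HasDerivAt (fun x => c x ^ 2 + z * s x ^ 2) 0 x := fun x => by
    refine (((h.hasDerivAt_c x).fun_pow 2).fun_add
      (((h.hasDerivAt_s x).fun_pow 2).const_mul z)).congr_deriv ?_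
    push_cast
    ring
  have := is_const_of_deriv_eq_zero (fun x => (hd x).differentiableAt) (fun x => (hd x).deriv) x 0
  simpa [h.c_zero, h.s_zero] using this

end IsFundamental

lemma IsH2With.continuousOn {L : ℝ} {u v w : ℝ → ℂ} (h : IsH2With L u v w)
    (hw : IntegrableOn w (Ioc 0 L)) (hL : 0 < L) :
    ContinuousOn u (Icc 0 L) ∧ ContinuousOn v (Icc 0 L) := by
  have hp : ∀ {f : ℝ → ℂ} (a : ℂ), IntervalIntegrable f volume 0 L →
      ContinuousOn (fun x => a + ∫ t in (0 : ℝ)..x, f t) (Icc 0 L) := by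
    intro f a hf
    have := intervalIntegral.continuousOn_primitive_interval' (μ := volume) hf
      (show (0 : ℝ) ∈ uIcc 0 L by simp)
    rw [uIcc_of_le hL.le] at this
    exact continuousOn_const.add this
  exact ⟨(hp _ (h.intervalIntegrable hw ⟨hL.le, le_rfl⟩)).congr fun x hx => (h x hx).1,
    (hp _ ((intervalIntegrable_iff_integrableOn_Ioc_of_le hL.le).2 hw)).congr
      fun x hx => (h x hx).2⟩

/-- A solution of `-u'' = z u` is determined by its initial data. -/
lemma IsFundamental.eq_of_isH2With {z : ℂ} {c s : ℝ → ℂ} (h : IsFundamental z c s) {L : ℝ}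
    (hL : 0 < L) {u v w : ℝ → ℂ} (hu : IsH2With L u v w) (hw : IntegrableOn w (Ioc 0 L))
    (hwu : w =ᵐ[volume.restrict (Ioc 0 L)] fun t => -(z * u t)) :
    ∀ x ∈ Icc 0 L, u x = u 0 * c x + v 0 * s x ∧ v x = c x * v 0 - z * s x * u 0 := by
  obtain ⟨hcu, hcv⟩ := hu.continuousOn hw hL
  -- Only continuity on `[0, L]` is known. Continuing the functions constantly past the ends makes
  -- the integrands continuous everywhere, so their primitives are differentiable everywhere.
  set u' : ℝ → ℂ := IccExtend hL.le ((Icc 0 L).domRestrict u) with hu'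
  set v' : ℝ → ℂ := IccExtend hL.le ((Icc 0 L).domRestrict v) with hv'
  have hu'c : Continuous u' := (continuousOn_iff_continuous_domRestrict.1 hcu).Icc_extend'
  have hv'c : Continuous v' := (continuousOn_iff_continuous_domRestrict.1 hcv).Icc_extend'
  have hu'u : ∀ x ∈ Icc 0 L, u' x = u x := fun x hx => IccExtend_of_mem _ _ hx
  have hv'v : ∀ x ∈ Icc 0 L, v' x = v x := fun x hx => IccExtend_of_mem _ _ hx
  have hUu : ∀ x ∈ Icc 0 L, u x = u 0 + ∫ t in (0 : ℝ)..x, v' t := by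
    intro x hx
    rw [(hu x hx).1]
    congr 1
    refine intervalIntegral.integral_congr fun t ht => ?_
    rw [uIcc_of_le hx.1] at ht
    exact (hv'v t ⟨ht.1, ht.2.trans hx.2⟩).symm
  have hVv : ∀ x ∈ Icc 0 L, v x = v 0 + ∫ t in (0 : ℝ)..x, -(z * u' t) := by
    intro x hx
    rw [(hu x hx).2]
    congr 1
    refine intervalIntegral.integral_congr_ae ?_
    filter_upwards [(ae_restrict_iff' measurableSet_Ioc).1 hwu] with t ht hm
    rw [uIoc_of_le hx.1] at hm
    have hm' : t ∈ Ioc 0 L := ⟨hm.1, hm.2.trans hx.2⟩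
    rw [ht hm', hu'u t (Ioc_subset_Icc_self hm')]
  have hdU : ∀ x, HasDerivAt (fun x => u 0 + ∫ t in (0 : ℝ)..x, v' t) (v' x) x := fun x =>
    (hv'c.integral_hasStrictDerivAt 0 x).hasDerivAt.const_add _
  have hdV : ∀ x, HasDerivAt (fun x => v 0 + ∫ t in (0 : ℝ)..x, -(z * u' t)) (-(z * u' x)) x :=
    fun x => ((by fun_prop : Continuous fun t => -(z * u' t)).integral_hasStrictDerivAt 0
      x).hasDerivAt.const_add _
  set U := fun x => u 0 + ∫ t in (0 : ℝ)..x, v' t with hU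
  set V := fun x => v 0 + ∫ t in (0 : ℝ)..x, -(z * u' t) with hV
  -- The inverse of the fundamental matrix applied to `(U, V)` has derivative zero on the edge, so
  -- it equals the initial data.
  have hdα : ∀ x, HasDerivAt (fun x => c x * U x - s x * V x)
      (-z * s x * U x + c x * v' x - (c x * V x + s x * -(z * u' x))) x := fun x =>
    ((h.hasDerivAt_c x).fun_mul (hdU x)).fun_sub ((h.hasDerivAt_s x).fun_mul (hdV x))
  have hdβ : ∀ x, HasDerivAt (fun x => z * s x * U x + c x * V x)
      (z * c x * U x + z * s x * v' x + (-z * s x * V x + c x * -(z * u' x))) x := fun x =>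
    (((h.hasDerivAt_s x).const_mul z).fun_mul (hdU x)).fun_add
      ((h.hasDerivAt_c x).fun_mul (hdV x))
  intro x hx
  have hα := constant_of_has_deriv_right_zero (a := 0) (b := L)
    (fun y _ => (hdα y).continuousAt.continuousWithinAt) (fun y hy => by
      refine ((hdα y).congr_deriv ?_).hasDerivWithinAt
      have hy' := Ico_subset_Icc_self hy
      rw [hu'u y hy', hv'v y hy', hUu y hy', hVv y hy']
      ring) x hx
  have hβ := constant_of_has_deriv_right_zero (a := 0) (b := L)
    (fun y _ => (hdβ y).continuousAt.continuousWithinAt) (fun y hy => by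
      refine ((hdβ y).congr_deriv ?_).hasDerivWithinAt
      have hy' := Ico_subset_Icc_self hy
      rw [hu'u y hy', hv'v y hy', hUu y hy', hVv y hy']
      ring) x hx
  have hU0 : U 0 = u 0 := by simp [hU]
  have hV0 : V 0 = v 0 := by simp [hV]
  simp only [h.c_zero, h.s_zero, hU0, hV0] at hα hβ
  have e1 : u x = U x := hUu x hx
  have e2 : v x = V x := hVv x hx
  rw [e1, e2]
  have hwr := h.wronskian x
  constructor
  · linear_combination -U x * hwr + c x * hα + s x * hβ
  · linear_combination -V x * hwr - z * s x * hα + c x * hβ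

/-- Cauchy–Schwarz on an interval of finite length. -/
lemma exists_integral_norm_le (L : ℝ) : ∃ K : ℝ, 0 ≤ K ∧
    ∀ f : Lp ℂ 2 (volume.restrict (Ioc 0 L)), ∫ t in Ioc 0 L, ‖f t‖ ≤ K * ‖f‖ := by
  refine ⟨_, ENNReal.toReal_nonneg
    (a := (volume.restrict (Ioc 0 L)) univ ^ (1 / (1 : ENNReal).toReal - 1 / (2 : ENNReal).toReal)),
    fun f => ?_⟩
  have h := eLpNorm_le_eLpNorm_mul_rpow_measure_univ (p := 1) (q := 2)
    (μ := volume.restrict (Ioc 0 L)) (by norm_num) (Lp.aestronglyMeasurable f)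
  have h2 := ENNReal.toReal_mono (by
    refine ENNReal.mul_ne_top (Lp.eLpNorm_ne_top f) ?_
    refine ENNReal.rpow_ne_top_of_nonneg (by norm_num) ?_
    simp) h
  rw [ENNReal.toReal_mul, mul_comm, ← Lp.norm_def] at h2
  refine le_trans (le_of_eq ?_) h2
  rw [eLpNorm_one_eq_lintegral_enorm, integral_norm_eq_lintegral_enorm (Lp.aestronglyMeasurable f)]

/-- The equation `-u'' - z u = f` on an edge with given initial data, by variation of
parameters. -/
lemma IsFundamental.exists_solution {z : ℂ} {c s : ℝ → ℂ} (h : IsFundamental z c s) {L : ℝ}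
    (hL : 0 < L) : ∃ K : ℝ, 0 ≤ K ∧ ∀ f : Lp ℂ 2 (volume.restrict (Ioc 0 L)),
      ∃ r : ℂ × ℂ, ‖r‖ ≤ K * ‖f‖ ∧ ∀ a : ℂ × ℂ, ∃ u v : ℝ → ℂ, Continuous u ∧
        IsH2With L u v (fun t => -(f t + z * u t)) ∧ u 0 = a.1 ∧ v 0 = a.2 ∧
        u L = a.1 * c L + a.2 * s L + r.1 ∧ -v L = z * s L * a.1 - c L * a.2 + r.2 ∧
        ∀ x ∈ Icc 0 L, ‖u x‖ ≤ K * (‖a‖ + ‖f‖) := by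
  obtain ⟨N, hN0, hN⟩ := exists_integral_norm_le L
  obtain ⟨M1, hM1⟩ := isCompact_Icc.exists_bound_of_continuousOn
    (h.continuous_c.continuousOn (s := Icc 0 L))
  obtain ⟨M2, hM2⟩ := isCompact_Icc.exists_bound_of_continuousOn
    (h.continuous_s.continuousOn (s := Icc 0 L))
  set M := max (max M1 M2) 0 with hM
  have hM0 : 0 ≤ M := le_max_right _ _
  have hc : ∀ x ∈ Icc 0 L, ‖c x‖ ≤ M := fun x hx =>
    (hM1 x hx).trans ((le_max_left _ _).trans (le_max_left _ _))
  have hs : ∀ x ∈ Icc 0 L, ‖s x‖ ≤ M := fun x hx =>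
    (hM2 x hx).trans ((le_max_right _ _).trans (le_max_left _ _))
  set K := 2 * M + (M * (M * N * L) * (1 + 2 * ‖z‖) + N) with hK
  have hK0 : 0 ≤ K := by positivity
  refine ⟨K, hK0, fun f => ?_⟩
  set g : ℝ → ℂ := (Ioc 0 L).indicator f with hg
  have hgi : Integrable g := (integrableOn_coe f).integrable_indicator measurableSet_Ioc
  -- Writing `v = V - W` turns the equation into `u' = V - W`, `V' = -z u`. Its inhomogeneity `W` is
  -- continuous although `f` is only square integrable, so variation of parameters, with integrals
  -- `P` and `Q`, is classical.
  set W : ℝ → ℂ := fun x => ∫ t in (0 : ℝ)..x, g t with hW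
  have hWc : Continuous W := intervalIntegral.continuous_primitive
    (fun a b => hgi.intervalIntegrable) 0
  have hWb : ∀ x ∈ Icc 0 L, ‖W x‖ ≤ N * ‖f‖ := by
    intro x hx
    refine le_trans ?_ (hN f)
    have h1 : ‖W x‖ ≤ ∫ t, ‖g t‖ := by
      rw [hW]
      simp only
      rw [intervalIntegral.integral_of_le hx.1]
      exact (norm_integral_le_integral_norm _).trans
        (setIntegral_le_integral hgi.norm (Eventually.of_forall fun t => norm_nonneg _))
    refine h1.trans (le_of_eq ?_)
    rw [← integral_indicator measurableSet_Ioc]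
    congr 1
    ext t
    rw [hg, norm_indicator_eq_indicator_norm]
  have hcc := h.continuous_c
  have hsc := h.continuous_s
  have hcW : Continuous fun t => c t * W t := hcc.mul hWc
  have hsW : Continuous fun t => s t * W t := hsc.mul hWc
  set P : ℝ → ℂ := fun x => ∫ t in (0 : ℝ)..x, c t * W t with hP
  set Q : ℝ → ℂ := fun x => ∫ t in (0 : ℝ)..x, s t * W t with hQ
  have hPd : ∀ x, HasDerivAt P (c x * W x) x := fun x =>
    (hcW.integral_hasStrictDerivAt 0 x).hasDerivAt
  have hQd : ∀ x, HasDerivAt Q (s x * W x) x := fun x =>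
    (hsW.integral_hasStrictDerivAt 0 x).hasDerivAt
  have hint : ∀ k : ℝ → ℂ, (∀ x ∈ Icc 0 L, ‖k x‖ ≤ M) → ∀ x ∈ Icc 0 L,
      ‖∫ t in (0 : ℝ)..x, k t * W t‖ ≤ M * N * L * ‖f‖ := by
    intro k hk x hx
    have h1 := intervalIntegral.norm_integral_le_of_norm_le_const (a := 0) (b := x)
      (f := fun t => k t * W t) (C := M * (N * ‖f‖)) (fun t ht => by
        rw [uIoc_of_le hx.1] at ht
        have ht' : t ∈ Icc 0 L := ⟨ht.1.le, ht.2.trans hx.2⟩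
        rw [norm_mul]
        exact mul_le_mul (hk t ht') (hWb t ht') (norm_nonneg _) hM0)
    rw [sub_zero, abs_of_nonneg hx.1] at h1
    calc _ ≤ M * (N * ‖f‖) * x := h1
      _ ≤ M * (N * ‖f‖) * L := by gcongr; exact hx.2
      _ = _ := by ring
  have hPb : ∀ x ∈ Icc 0 L, ‖P x‖ ≤ M * N * L * ‖f‖ := hint c hc
  have hQb : ∀ x ∈ Icc 0 L, ‖Q x‖ ≤ M * N * L * ‖f‖ := hint s hs
  have hLm : L ∈ Icc 0 L := ⟨hL.le, le_rfl⟩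
  have hf0 := norm_nonneg f
  have hz0 := norm_nonneg z
  have hT0 : 0 ≤ M * (M * N * L * ‖f‖) := by positivity
  refine ⟨(-(c L * P L) - z * (s L * Q L), -(z * (s L * P L)) + z * (c L * Q L) + W L), ?_,
    fun a => ?_⟩
  · have b1 : ‖c L * P L‖ ≤ M * (M * N * L * ‖f‖) := by
      rw [norm_mul]; exact mul_le_mul (hc L hLm) (hPb L hLm) (norm_nonneg _) hM0
    have b2 : ‖s L * Q L‖ ≤ M * (M * N * L * ‖f‖) := by
      rw [norm_mul]; exact mul_le_mul (hs L hLm) (hQb L hLm) (norm_nonneg _) hM0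
    have b3 : ‖s L * P L‖ ≤ M * (M * N * L * ‖f‖) := by
      rw [norm_mul]; exact mul_le_mul (hs L hLm) (hPb L hLm) (norm_nonneg _) hM0
    have b4 : ‖c L * Q L‖ ≤ M * (M * N * L * ‖f‖) := by
      rw [norm_mul]; exact mul_le_mul (hc L hLm) (hQb L hLm) (norm_nonneg _) hM0
    have hzT : 0 ≤ ‖z‖ * (M * (M * N * L * ‖f‖)) := by positivity
    have hMf : 0 ≤ M * ‖f‖ := by positivity
    have hNf : 0 ≤ N * ‖f‖ := by positivity
    rw [Prod.norm_def]
    refine max_le ?_ ?_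
    · calc _ ≤ ‖-(c L * P L)‖ + ‖z * (s L * Q L)‖ := norm_sub_le _ _
        _ = ‖c L * P L‖ + ‖z‖ * ‖s L * Q L‖ := by rw [norm_neg, norm_mul z]
        _ ≤ M * (M * N * L * ‖f‖) + ‖z‖ * (M * (M * N * L * ‖f‖)) := by gcongr
        _ ≤ _ := by rw [hK]; nlinarith
    · calc _ ≤ ‖-(z * (s L * P L))‖ + ‖z * (c L * Q L)‖ + ‖W L‖ := norm_add₃_le
        _ = ‖z‖ * ‖s L * P L‖ + ‖z‖ * ‖c L * Q L‖ + ‖W L‖ := by rw [norm_neg, norm_mul z, norm_mul z]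
        _ ≤ ‖z‖ * (M * (M * N * L * ‖f‖)) + ‖z‖ * (M * (M * N * L * ‖f‖)) + N * ‖f‖ := by
          gcongr; exact hWb L hLm
        _ ≤ _ := by rw [hK]; nlinarith
  have hP0 : P 0 = 0 := by simp [hP]
  have hQ0 : Q 0 = 0 := by simp [hQ]
  have hW0 : W 0 = 0 := by simp [hW]
  set u : ℝ → ℂ := fun x => c x * (a.1 - P x) + s x * (a.2 - z * Q x) with hu
  set V : ℝ → ℂ := fun x => -z * s x * (a.1 - P x) + c x * (a.2 - z * Q x) with hV
  have hud : ∀ x, HasDerivAt u (V x - W x) x := by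
    intro x
    refine (((h.hasDerivAt_c x).fun_mul ((hPd x).const_sub a.1)).fun_add
      ((h.hasDerivAt_s x).fun_mul (((hQd x).const_mul z).const_sub a.2))).congr_deriv ?_
    rw [hV]
    linear_combination -W x * h.wronskian x
  have hVd : ∀ x, HasDerivAt V (-(z * u x)) x := by
    intro x
    refine ((((h.hasDerivAt_s x).const_mul (-z)).fun_mul ((hPd x).const_sub a.1)).fun_add
      ((h.hasDerivAt_c x).fun_mul (((hQd x).const_mul z).const_sub a.2))).congr_deriv ?_
    rw [hu]
    ring
  have huc : Continuous u := continuous_iff_continuousAt.2 fun x => (hud x).continuousAt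
  have hVc : Continuous V := continuous_iff_continuousAt.2 fun x => (hVd x).continuousAt
  refine ⟨u, fun x => V x - W x, huc, fun x hx => ⟨?_, ?_⟩, ?_, ?_, ?_, ?_, ?_⟩
  · have := intervalIntegral.integral_eq_sub_of_hasDerivAt (a := 0) (b := x)
      (fun t _ => hud t) ((hVc.sub hWc).intervalIntegrable _ _)
    rw [this]
    ring
  · have h1 := intervalIntegral.integral_eq_sub_of_hasDerivAt (a := 0) (b := x)
      (fun t _ => hVd t) ((by fun_prop : Continuous fun t => -(z * u t)).intervalIntegrable _ _)
    have h2 : W x = ∫ t in (0 : ℝ)..x, f t := by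
      rw [hW]
      refine intervalIntegral.integral_congr_ae (Eventually.of_forall fun t ht => ?_)
      rw [uIoc_of_le hx.1] at ht
      exact indicator_of_mem (show t ∈ Ioc 0 L from ⟨ht.1, ht.2.trans hx.2⟩) _
    have hfi : IntervalIntegrable f volume 0 x :=
      (intervalIntegrable_iff_integrableOn_Ioc_of_le hx.1).2
        ((integrableOn_coe f).mono_set (Ioc_subset_Ioc_right hx.2))
    have h3 : (∫ t in (0 : ℝ)..x, -(f t + z * u t))
        = (∫ t in (0 : ℝ)..x, -(z * u t)) - ∫ t in (0 : ℝ)..x, f t := by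
      rw [← intervalIntegral.integral_sub
        ((by fun_prop : Continuous fun t => -(z * u t)).intervalIntegrable _ _) hfi]
      congr 1
      ext t
      ring
    rw [h3, h1, ← h2]
    simp only [hW0]
    ring
  · simp [hu, h.c_zero, h.s_zero, hP0]
  · simp [hV, h.c_zero, h.s_zero, hQ0, hW0]
  · simp only [hu]; ring
  · simp only [hV]; ring
  · intro x hx
    have ha1 : ‖a.1‖ ≤ ‖a‖ := norm_fst_le a
    have ha2 : ‖a.2‖ ≤ ‖a‖ := norm_snd_le a
    have ha0 := norm_nonneg a
    have hzT : 0 ≤ ‖z‖ * (M * (M * N * L * ‖f‖)) := by positivity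
    have hMf : 0 ≤ M * ‖f‖ := by positivity
    have hNf : 0 ≤ N * ‖f‖ := by positivity
    have hNa : 0 ≤ (M * (M * N * L) * (1 + 2 * ‖z‖) + N) * ‖a‖ := by positivity
    calc ‖u x‖ ≤ ‖c x‖ * ‖a.1 - P x‖ + ‖s x‖ * ‖a.2 - z * Q x‖ := by
          rw [← norm_mul, ← norm_mul]; exact norm_add_le _ _
      _ ≤ ‖c x‖ * (‖a.1‖ + ‖P x‖) + ‖s x‖ * (‖a.2‖ + ‖z‖ * ‖Q x‖) := by
          rw [← norm_mul z]
          gcongr <;> exact norm_sub_le _ _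
      _ ≤ M * (‖a‖ + M * N * L * ‖f‖) + M * (‖a‖ + ‖z‖ * (M * N * L * ‖f‖)) := by
          have := hc x hx
          have := hs x hx
          have := hPb x hx
          have := hQb x hx
          gcongr
      _ ≤ _ := by rw [hK]; nlinarith

end RingChain

namespace RingChain

/-! ### A criterion for the resolvent set -/

/-- By uniqueness any choice of solutions is automatically linear, and the norm bound makes it the
resolvent. -/
lemma inResolventSet_of_bounded_solution {H : Type*} [NormedAddCommGroup H] [NormedSpace ℂ H]
    {T : H →ₗ.[ℂ] H} {z : ℂ} {C : ℝ}
    (hs : ∀ y : H, ∃ x : T.domain, T x - z • (x : H) = y ∧ ‖(x : H)‖ ≤ C * ‖y‖)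
    (hu : ∀ x : T.domain, T x - z • (x : H) = 0 → x = 0) : InResolventSet T z := by
  choose S hS hSb using hs
  have hinj : ∀ x x' : T.domain, T x - z • (x : H) = T x' - z • (x' : H) → x = x' := by
    intro x x' h
    refine sub_eq_zero.1 (hu _ ?_)
    rw [LinearPMap.map_sub, Submodule.coe_sub, smul_sub]
    rw [← sub_eq_zero] at h
    rw [← h]
    abel
  let R : H →ₗ[ℂ] H :=
    { toFun := fun y => S y
      map_add' := fun y y' => by
        rw [← Submodule.coe_add]
        congr 1
        refine hinj _ _ ?_
        rw [hS, LinearPMap.map_add, Submodule.coe_add, smul_add, add_sub_add_comm, hS, hS]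
      map_smul' := fun k y => by
        rw [RingHom.id_apply, ← Submodule.coe_smul]
        congr 1
        refine hinj _ _ ?_
        rw [hS, LinearPMap.map_smul, Submodule.coe_smul, smul_comm, ← smul_sub, hS] }
  refine ⟨R.mkContinuous C hSb, fun y => ⟨S y, rfl, hS y⟩, fun x => ?_⟩
  change ((S _ : T.domain) : H) = x
  congr 1
  exact hinj _ _ (hS _)

/-! ### Square integrable functions on the edges -/

lemma memLp_of_continuous (L : ℝ) {g : ℝ → ℂ} (hg : Continuous g) :
    MemLp g 2 (volume.restrict (Ioc 0 L)) := by
  obtain ⟨C, hC⟩ := (isCompact_Icc (a := (0 : ℝ)) (b := L)).exists_bound_of_continuousOn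
    hg.continuousOn
  refine MemLp.of_bound hg.aestronglyMeasurable C ?_
  filter_upwards [ae_restrict_mem measurableSet_Ioc] with t ht
  exact hC t (Ioc_subset_Icc_self ht)

/-- A continuous function as an element of `L²(0, L)`. -/
noncomputable def edgeLp (L : ℝ) {g : ℝ → ℂ} (hg : Continuous g) :
    Lp ℂ 2 (volume.restrict (Ioc 0 L)) :=
  (memLp_of_continuous L hg).toLp g

lemma coeFn_edgeLp (L : ℝ) {g : ℝ → ℂ} (hg : Continuous g) :
    edgeLp L hg =ᵐ[volume.restrict (Ioc 0 L)] g :=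
  MemLp.coeFn_toLp _

lemma exists_norm_edgeLp_le (L : ℝ) : ∃ K : ℝ, 0 ≤ K ∧ ∀ {g : ℝ → ℂ} (hg : Continuous g) {C : ℝ},
    0 ≤ C → (∀ x ∈ Icc 0 L, ‖g x‖ ≤ C) → ‖edgeLp L hg‖ ≤ K * C := by
  refine ⟨_, NNReal.coe_nonneg
    (measureUnivNNReal (volume.restrict (Ioc 0 L)) ^ (2 : ENNReal).toReal⁻¹), ?_⟩
  intro g hg C hC h
  refine Lp.norm_le_of_ae_bound hC ?_
  filter_upwards [coeFn_edgeLp L hg, ae_restrict_mem measurableSet_Ioc] with t ht hm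
  rw [ht]
  exact h t (Ioc_subset_Icc_self hm)

/-- An injective linear map on the two-dimensional space of initial data is bounded below.
Injectivity: if `s` vanished on the edge, so would `c = s'`, against the Wronskian. The bound makes
the initial data of an `L²` solution square summable over the edges. -/
lemma IsFundamental.exists_le_norm {z : ℂ} {c s : ℝ → ℂ} (h : IsFundamental z c s) {L : ℝ}
    (hL : 0 < L) : ∃ K : ℝ, 0 ≤ K ∧ ∀ (a : ℂ × ℂ) (f : Lp ℂ 2 (volume.restrict (Ioc 0 L))),
      f =ᵐ[volume.restrict (Ioc 0 L)] (fun x => a.1 * c x + a.2 * s x) → ‖a‖ ≤ K * ‖f‖ := by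
  let Φ : ℂ × ℂ →ₗ[ℂ] Lp ℂ 2 (volume.restrict (Ioc 0 L)) :=
    (LinearMap.fst ℂ ℂ ℂ).smulRight (edgeLp L h.continuous_c)
      + (LinearMap.snd ℂ ℂ ℂ).smulRight (edgeLp L h.continuous_s)
  have hΦ : ∀ a, Φ a =ᵐ[volume.restrict (Ioc 0 L)] (fun x => a.1 * c x + a.2 * s x) := by
    intro a
    have e : Φ a = a.1 • edgeLp L h.continuous_c + a.2 • edgeLp L h.continuous_s := rfl
    rw [e]
    filter_upwards [Lp.coeFn_add (a.1 • edgeLp L h.continuous_c) (a.2 • edgeLp L h.continuous_s),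
      Lp.coeFn_smul a.1 (edgeLp L h.continuous_c), Lp.coeFn_smul a.2 (edgeLp L h.continuous_s),
      coeFn_edgeLp L h.continuous_c, coeFn_edgeLp L h.continuous_s] with t h1 h2 h3 h4 h5
    rw [h1, Pi.add_apply, h2, h3, Pi.smul_apply, Pi.smul_apply, h4, h5, smul_eq_mul, smul_eq_mul]
  have hinj : Function.Injective Φ := by
    rw [← LinearMap.ker_eq_bot, LinearMap.ker_eq_bot']
    intro a ha
    have hae : ∀ᵐ t ∂(volume.restrict (Ioc 0 L)), a.1 * c t + a.2 * s t = 0 := by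
      have h0 := Lp.coeFn_zero ℂ 2 (volume.restrict (Ioc 0 L))
      rw [← ha] at h0
      filter_upwards [h0, hΦ a] with t h1 h2
      rw [← h2, h1, Pi.zero_apply]
    have hc := h.continuous_c
    have hs := h.continuous_s
    have hz := eq_zero_of_ae_eq_zero hL (by fun_prop) hae
    have h1 : a.1 = 0 := by simpa [h.c_zero, h.s_zero] using hz 0 ⟨le_rfl, hL.le⟩
    refine Prod.ext h1 ?_
    by_contra h2
    change a.2 ≠ 0 at h2
    have hs0 : ∀ x ∈ Icc 0 L, s x = 0 := fun x hx => by
      simpa [h1, h2] using hz x hx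
    have hd : HasDerivAt s 0 (L / 2) := by
      refine (hasDerivAt_const (L / 2) (0 : ℂ)).congr_of_eventuallyEq ?_
      filter_upwards [Icc_mem_nhds (a := 0) (b := L) (by linarith) (by linarith)] with x hx
      exact hs0 x hx
    have hc0 := (h.hasDerivAt_s (L / 2)).unique hd
    have := h.wronskian (L / 2)
    rw [hc0, hs0 (L / 2) ⟨by linarith, by linarith⟩] at this
    norm_num at this
  obtain ⟨K, -, hK⟩ := (LinearMap.injective_iff_antilipschitz Φ).1 hinj
  refine ⟨K, K.2, fun a f hf => ?_⟩
  have e : f = Φ a := Lp.ext (hf.trans (hΦ a).symm)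
  rw [e]
  simpa using hK.le_mul_dist a 0

/-- The equation `-ψ'' - z ψ = f` on an edge: the boundary data of the solutions and their bounds
in `L²`. -/
lemma IsFundamental.exists_edge_solution {z : ℂ} {c s : ℝ → ℂ} (h : IsFundamental z c s) {L : ℝ}
    (hL : 0 < L) : ∃ K : ℝ, 0 ≤ K ∧ ∀ f : Lp ℂ 2 (volume.restrict (Ioc 0 L)),
      ∃ r : ℂ × ℂ, ‖r‖ ≤ K * ‖f‖ ∧ ∀ a : ℂ × ℂ, ∃ (ψ : Lp ℂ 2 (volume.restrict (Ioc 0 L)))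
        (u v : ℝ → ℂ), ψ =ᵐ[volume.restrict (Ioc 0 L)] u ∧
        IsH2With L u v (fun t => -(f + z • ψ : Lp ℂ 2 (volume.restrict (Ioc 0 L))) t) ∧
        u 0 = a.1 ∧ v 0 = a.2 ∧
        u L = a.1 * c L + a.2 * s L + r.1 ∧ -v L = z * s L * a.1 - c L * a.2 + r.2 ∧
        ‖ψ‖ ≤ K * (‖a‖ + ‖f‖) := by
  obtain ⟨K, hK, hsol⟩ := h.exists_solution hL
  obtain ⟨K', hK', hb⟩ := exists_norm_edgeLp_le L
  refine ⟨max K (K' * K), le_max_of_le_left hK, fun f => ?_⟩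
  obtain ⟨r, hr, hsol⟩ := hsol f
  refine ⟨r, hr.trans (by gcongr; exact le_max_left _ _), fun a => ?_⟩
  obtain ⟨u, v, hu, hH, h1, h2, h3, h4, h5⟩ := hsol a
  refine ⟨edgeLp L hu, u, v, coeFn_edgeLp L hu, fun x hx => ⟨(hH x hx).1, ?_⟩, h1, h2, h3, h4, ?_⟩
  · rw [(hH x hx).2]
    congr 1
    refine intervalIntegral.integral_congr_ae ?_
    have hae : ∀ᵐ t ∂(volume.restrict (Ioc 0 L)),
        (f + z • edgeLp L hu : Lp ℂ 2 (volume.restrict (Ioc 0 L))) t = f t + z * u t := by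
      filter_upwards [Lp.coeFn_add f (z • edgeLp L hu), Lp.coeFn_smul z (edgeLp L hu),
        coeFn_edgeLp L hu] with t h1 h2 h3
      rw [h1, Pi.add_apply, h2, Pi.smul_apply, h3, smul_eq_mul]
    filter_upwards [(ae_restrict_iff' measurableSet_Ioc).1 hae] with t ht hm
    rw [uIoc_of_le hx.1] at hm
    rw [ht ⟨hm.1, hm.2.trans hx.2⟩]
  · refine (hb hu (C := K * (‖a‖ + ‖f‖)) (by positivity) h5).trans ?_
    rw [← mul_assoc]
    gcongr
    exact le_max_right _ _

/-! ### The resolvent set of a Laplacian -/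

lemma memℓp_two_iff {E : Type*} {G : E → Type*} [∀ e, NormedAddCommGroup (G e)]
    (f : ∀ e, G e) : Memℓp f 2 ↔ Summable fun e => ‖f e‖ ^ 2 := by
  rw [memℓp_gen_iff (by norm_num)]
  simp

lemma norm_sq_eq_tsum {E : Type*} {G : E → Type*} [∀ e, NormedAddCommGroup (G e)]
    (f : lp G 2) : ‖f‖ ^ 2 = ∑' e, ‖f e‖ ^ 2 := by
  have := lp.norm_rpow_eq_tsum (p := 2) (by norm_num) f
  simpa using this

lemma summable_norm_sq {E : Type*} {G : E → Type*} [∀ e, NormedAddCommGroup (G e)]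
    (f : lp G 2) : Summable fun e => ‖f e‖ ^ 2 :=
  (memℓp_two_iff _).1 (lp.memℓp f)

/-- Boundary data vanishing at the left ends of the edges. -/
def endData {E : Type} (r : E → ℂ × ℂ) : BoundaryData E
  | (_, false) => 0
  | (e, true) => r e

lemma exists_mem_domain {E : Type} {L : E → ℝ} {B : Submodule ℂ (BoundaryData E)}
    {p : GraphL2 L × GraphL2 L} (hp : p ∈ laplaceGraph L B) :
    ∃ x : (laplacian L B).domain, (x : GraphL2 L) = p.1 ∧ laplacian L B x = p.2 := by
  rw [← laplacian_graph] at hp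
  exact (LinearPMap.mem_graph_iff _).1 hp

lemma mem_laplaceGraph_of_domain {E : Type} {L : E → ℝ} {B : Submodule ℂ (BoundaryData E)}
    (x : (laplacian L B).domain) : ((x : GraphL2 L), laplacian L B x) ∈ laplaceGraph L B := by
  rw [← laplacian_graph]
  exact LinearPMap.mem_graph _ x

/-- The spectral problem of a Laplacian reduces to a discrete problem for the initial data on the
edges. -/
theorem IsFundamental.inResolventSet_laplacian {z : ℂ} {c s : ℝ → ℂ} (h : IsFundamental z c s)
    {E : Type} {L : E → ℝ} (hL : ∀ e, 0 < L e) (hfin : (range L).Finite)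
    {B : Submodule ℂ (BoundaryData E)}
    (hsolve : ∃ C : ℝ, 0 ≤ C ∧ ∀ r : E → ℂ × ℂ, (Summable fun e => ‖r e‖ ^ 2) →
      ∃ a : E → ℂ × ℂ, (Summable fun e => ‖a e‖ ^ 2) ∧
        ∑' e, ‖a e‖ ^ 2 ≤ C * ∑' e, ‖r e‖ ^ 2 ∧ homData z c s L a + endData r ∈ B)
    (huniq : ∀ a : E → ℂ × ℂ, (Summable fun e => ‖a e‖ ^ 2) → homData z c s L a ∈ B → a = 0) :
    InResolventSet (laplacian L B) z := by
  obtain ⟨C, hC, hsolve⟩ := hsolve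
  -- The constants depend on the edge only through its length, and only finitely many lengths occur,
  -- so they are uniform.
  have hunif : ∀ P : ℝ → ℝ → Prop, (∀ l, 0 < l → ∃ K, 0 ≤ K ∧ P l K) →
      ∃ F : ℝ → ℝ, ∃ K, 0 ≤ K ∧ ∀ e, P (L e) (F (L e)) ∧ F (L e) ≤ K := by
    intro P hP
    choose! F hF0 hF using hP
    obtain ⟨K, hK⟩ := (hfin.image F).bddAbove
    refine ⟨F, max K 0, le_max_right _ _, fun e => ⟨hF _ (hL e), ?_⟩⟩
    exact (hK (mem_image_of_mem F (mem_range_self e))).trans (le_max_left _ _)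
  obtain ⟨F, K, hK, hF⟩ := hunif _ fun l hl => h.exists_edge_solution hl
  obtain ⟨F', K', hK', hF'⟩ := hunif _ fun l hl => h.exists_le_norm hl
  -- On each edge `‖ψ‖² ≤ 2K²(‖a‖² + ‖f‖²)`; summing with `Σ‖a‖² ≤ C Σ‖r‖² ≤ C K² Σ‖f‖²` gives this
  -- constant.
  refine inResolventSet_of_bounded_solution (C := √(2 * K ^ 2 * (C * K ^ 2 + 1))) ?_ ?_
  · intro f
    have hsolE := fun e => (hF e).1 (f e)
    choose r hr hsolE using hsolE
    have hr' : ∀ e, ‖r e‖ ^ 2 ≤ K ^ 2 * ‖f e‖ ^ 2 := fun e => by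
      rw [← mul_pow]
      exact pow_le_pow_left₀ (norm_nonneg _)
        ((hr e).trans (mul_le_mul_of_nonneg_right (hF e).2 (norm_nonneg _))) 2
    have hrs : Summable fun e => ‖r e‖ ^ 2 :=
      Summable.of_nonneg_of_le (fun e => by positivity) hr' ((summable_norm_sq f).mul_left _)
    obtain ⟨a, has, hab, haB⟩ := hsolve r hrs
    have hsolA := fun e => hsolE e (a e)
    choose ψ u v hψ hH h0 h0' h1 h1' hb using hsolA
    have hb' : ∀ e, ‖ψ e‖ ^ 2 ≤ 2 * K ^ 2 * (‖a e‖ ^ 2 + ‖f e‖ ^ 2) := fun e => by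
      have : ‖ψ e‖ ≤ K * (‖a e‖ + ‖f e‖) :=
        (hb e).trans (mul_le_mul_of_nonneg_right (hF e).2 (by positivity))
      have h2 := pow_le_pow_left₀ (norm_nonneg _) this 2
      nlinarith [mul_nonneg (sq_nonneg K) (sq_nonneg (‖a e‖ - ‖f e‖))]
    have hsum : Summable fun e => 2 * K ^ 2 * (‖a e‖ ^ 2 + ‖f e‖ ^ 2) :=
      (has.add (summable_norm_sq f)).mul_left _
    have hψs : Summable fun e => ‖ψ e‖ ^ 2 :=
      Summable.of_nonneg_of_le (fun e => by positivity) hb' hsum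
    let Ψ : GraphL2 L := ⟨ψ, (memℓp_two_iff _).2 hψs⟩
    have hp : (Ψ, f + z • Ψ) ∈ laplaceGraph L B := by
      refine ⟨u, v, hψ, hH, ?_⟩
      convert haB using 1
      ext ⟨e, b⟩ <;> cases b <;> simp [boundaryData, homData, endData, h0, h0', h1, h1']
    obtain ⟨x, hx1, hx2⟩ := exists_mem_domain hp
    refine ⟨x, ?_, ?_⟩
    · rw [hx1, hx2]
      simp
    · rw [hx1]
      refine le_of_sq_le_sq ?_ (by positivity)
      rw [mul_pow, Real.sq_sqrt (by positivity), norm_sq_eq_tsum f, norm_sq_eq_tsum Ψ]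
      have i1 : ∑' e, ‖ψ e‖ ^ 2 ≤ 2 * K ^ 2 * (∑' e, ‖a e‖ ^ 2 + ∑' e, ‖f e‖ ^ 2) := by
        rw [← has.tsum_add (summable_norm_sq f), ← tsum_mul_left]
        exact hψs.tsum_le_tsum hb' hsum
      have i2 : ∑' e, ‖r e‖ ^ 2 ≤ K ^ 2 * ∑' e, ‖f e‖ ^ 2 := by
        rw [← tsum_mul_left]
        exact hrs.tsum_le_tsum hr' ((summable_norm_sq f).mul_left _)
      calc ∑' e, ‖ψ e‖ ^ 2 ≤ 2 * K ^ 2 * (∑' e, ‖a e‖ ^ 2 + ∑' e, ‖f e‖ ^ 2) := i1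
        _ ≤ 2 * K ^ 2 * (C * (K ^ 2 * ∑' e, ‖f e‖ ^ 2) + ∑' e, ‖f e‖ ^ 2) := by
          gcongr
          exact hab.trans (by gcongr)
        _ = _ := by ring
  · intro x hx
    have hTx : laplacian L B x = z • (x : GraphL2 L) := sub_eq_zero.1 hx
    obtain ⟨u, v, hu, hH, hB⟩ := mem_laplaceGraph_of_domain x
    have hw : ∀ e, IntegrableOn (fun t => -(((x : GraphL2 L), laplacian L B x).2 e) t)
        (Ioc 0 (L e)) := fun e => (integrableOn_coe _).neg
    have hwu : ∀ e, (fun t => -(((x : GraphL2 L), laplacian L B x).2 e) t)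
        =ᵐ[volume.restrict (Ioc 0 (L e))] fun t => -(z * u e t) := by
      intro e
      have e1 : ((x : GraphL2 L), laplacian L B x).2 e = z • (x : GraphL2 L) e := by
        rw [hTx]; rfl
      rw [e1]
      filter_upwards [Lp.coeFn_smul z ((x : GraphL2 L) e), hu e] with t h1 h2
      rw [h1, Pi.smul_apply, h2, smul_eq_mul]
    have hsol := fun e => h.eq_of_isH2With (hL e) (hH e) (hw e) (hwu e)
    set a : E → ℂ × ℂ := fun e => (u e 0, v e 0) with ha
    have hxa : ∀ e, (x : GraphL2 L) e =ᵐ[volume.restrict (Ioc 0 (L e))]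
        fun t => (a e).1 * c t + (a e).2 * s t := by
      intro e
      filter_upwards [hu e, ae_restrict_mem measurableSet_Ioc] with t h1 h2
      rw [h1, (hsol e t (Ioc_subset_Icc_self h2)).1]
    have has : Summable fun e => ‖a e‖ ^ 2 := by
      refine Summable.of_nonneg_of_le (fun e => by positivity) (fun e => ?_)
        ((summable_norm_sq (x : GraphL2 L)).mul_left (K' ^ 2))
      rw [← mul_pow]
      exact pow_le_pow_left₀ (norm_nonneg _) (((hF' e).1 _ _ (hxa e)).trans
        (mul_le_mul_of_nonneg_right (hF' e).2 (norm_nonneg _))) 2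
    have haB : homData z c s L a ∈ B := by
      convert hB using 1
      ext ⟨e, b⟩
      · cases b
        · rfl
        · simp [homData, boundaryData, (hsol e (L e) ⟨(hL e).le, le_rfl⟩).1, ha]
      · cases b
        · rfl
        · simp [homData, boundaryData, (hsol e (L e) ⟨(hL e).le, le_rfl⟩).2, ha]
    have ha0 := huniq a has haB
    refine Subtype.ext ?_
    refine lp.ext (funext fun e => ?_)
    refine Lp.ext ?_
    have hz : (((0 : GraphL2 L) e : Lp ℂ 2 (volume.restrict (Ioc 0 (L e)))) : ℝ → ℂ)
      =ᵐ[volume.restrict (Ioc 0 (L e))] 0 := Lp.coeFn_zero ℂ 2 _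
    filter_upwards [hxa e, hz] with t h1 h2
    change ((x : GraphL2 L) e) t = ((0 : GraphL2 L) e : Lp ℂ 2 (volume.restrict (Ioc 0 (L e)))) t
    rw [h1, h2, ha0]
    simp

end RingChain

namespace RingChain

/-! ### Convolution operators on `ℓ²(ℤ)` -/

/-- The space `ℓ²(ℤ)`. -/
abbrev SeqL2 : Type := lp (fun _ : ℤ => ℂ) 2

/-- Translation of sequences by `k`. -/
noncomputable def translate (k : ℤ) : SeqL2 →L[ℂ] SeqL2 :=
  LinearMap.mkContinuous
    { toFun := fun f => ⟨fun n => f (n + k), (memℓp_two_iff _).2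
        ((Equiv.addRight k).summable_iff.2 (summable_norm_sq f))⟩
      map_add' := fun _ _ => rfl
      map_smul' := fun _ _ => rfl } 1 (fun f => by
    rw [one_mul]
    refine le_of_sq_le_sq ?_ (norm_nonneg _)
    rw [norm_sq_eq_tsum, norm_sq_eq_tsum]
    exact ((Equiv.addRight k).tsum_eq fun n => ‖f n‖ ^ 2).le)

@[simp] lemma translate_apply (k : ℤ) (f : SeqL2) (n : ℤ) : translate k f n = f (n + k) := rfl

lemma norm_translate_le (k : ℤ) : ‖translate k‖ ≤ 1 :=
  LinearMap.mkContinuous_norm_le _ zero_le_one _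

lemma translate_mul_translate_neg (k : ℤ) : translate k * translate (-k) = 1 := by
  ext f n
  simp

instance : Nontrivial SeqL2 := by
  refine ⟨⟨lp.single 2 0 1, 0, fun h => ?_⟩⟩
  have := congrArg (fun f : SeqL2 => f 0) h
  simp at this

/-- The shift as an invertible operator. -/
noncomputable def shiftUnit : (SeqL2 →L[ℂ] SeqL2)ˣ where
  val := translate 1
  inv := translate (-1)
  val_inv := translate_mul_translate_neg 1
  inv_val := translate_mul_translate_neg (-1)

/-- The shift and its inverse are both contractions, so both `k` and `k⁻¹` lie in the closed unit
disc. -/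
lemma norm_eq_one_of_mem_spectrum_translate {k : ℂ} (hk : k ∈ spectrum ℂ (translate 1)) :
    ‖k‖ = 1 := by
  have h1 : ‖k‖ ≤ 1 := (spectrum.norm_le_norm_of_mem hk).trans (norm_translate_le 1)
  have hk' : k ∈ spectrum ℂ ((shiftUnit : (SeqL2 →L[ℂ] SeqL2)ˣ) : SeqL2 →L[ℂ] SeqL2) := hk
  have hk0 : k ≠ 0 := fun h => by
    rw [h] at hk'
    exact spectrum.zero_notMem ℂ shiftUnit.isUnit hk'
  have h2 : k⁻¹ ∈ spectrum ℂ (((shiftUnit : (SeqL2 →L[ℂ] SeqL2)ˣ)⁻¹ : (SeqL2 →L[ℂ] SeqL2)ˣ) :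
      SeqL2 →L[ℂ] SeqL2) := by
    have := (spectrum.inv_mem_iff (r := Units.mk0 k hk0) (a := shiftUnit)).1 hk'
    simpa using this
  have h3 : ‖k⁻¹‖ ≤ 1 := (spectrum.norm_le_norm_of_mem h2).trans (norm_translate_le (-1))
  rw [norm_inv] at h3
  have h4 : 0 < ‖k‖ := norm_pos_iff.2 hk0
  exact le_antisymm h1 ((inv_le_one₀ h4).1 h3)

/-- Spectral mapping for polynomials; it is enough that the spectrum of the shift is contained in
the unit circle. -/
lemma isUnit_aeval_translate {p : Polynomial ℂ} (hp : ∀ w : ℂ, ‖w‖ = 1 → p.eval w ≠ 0) :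
    IsUnit (Polynomial.aeval (translate 1) p) := by
  rw [← spectrum.zero_notMem_iff ℂ,
    spectrum.map_polynomial_aeval_of_nonempty _ _ (spectrum.nonempty (translate 1))]
  rintro ⟨k, hk, h0⟩
  exact hp k (norm_eq_one_of_mem_spectrum_translate hk) h0

/-- The symbol of the difference equation `A cₙ + B cₙ₊₁ = gₙ`. -/
noncomputable def symbolMatrix {ι : Type} (A B : Matrix ι ι ℂ) : Matrix ι ι (Polynomial ℂ) :=
  fun i j => Polynomial.C (A i j) + Polynomial.X * Polynomial.C (B i j)

lemma eval_det_symbolMatrix {ι : Type} [Fintype ι] [DecidableEq ι] (A B : Matrix ι ι ℂ) (w : ℂ) :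
    (symbolMatrix A B).det.eval w = (A + w • B).det := by
  rw [← Polynomial.coe_evalRingHom, RingHom.map_det]
  congr 1
  ext i j
  simp [symbolMatrix]
  ring

lemma aeval_symbolMatrix_apply {ι : Type} (A B : Matrix ι ι ℂ) (i j : ι) (f : SeqL2) (n : ℤ) :
    Polynomial.aeval (translate 1) (symbolMatrix A B i j) f n = A i j * f n + B i j * f (n + 1) := by
  simp [symbolMatrix, Algebra.algebraMap_eq_smul_one]
  rfl

lemma coeFn_sum {α : Type} (s : Finset α) (f : α → SeqL2) (n : ℤ) :
    (∑ i ∈ s, f i) n = ∑ i ∈ s, f i n := by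
  rw [lp.coeFn_sum, Finset.sum_apply]

/-- The difference equation `A cₙ + B cₙ₊₁ = gₙ` is uniquely solvable in `ℓ²` if its symbol is
invertible on the unit circle. -/
theorem exists_l2_solution_difference_equation {ι : Type} [Fintype ι] [DecidableEq ι]
    (A B : Matrix ι ι ℂ)
    (h : ∀ w : ℂ, ‖w‖ = 1 → (A + w • B).det ≠ 0) :
    (∃ C : ℝ, 0 ≤ C ∧ ∀ g : ℤ → ι → ℂ, (Summable fun n => ‖g n‖ ^ 2) →
      ∃ c : ℤ → ι → ℂ, (Summable fun n => ‖c n‖ ^ 2) ∧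
        ∑' n, ‖c n‖ ^ 2 ≤ C * ∑' n, ‖g n‖ ^ 2 ∧
        ∀ n, A.mulVec (c n) + B.mulVec (c (n + 1)) = g n) ∧
    ∀ c : ℤ → ι → ℂ, (Summable fun n => ‖c n‖ ^ 2) →
      (∀ n, A.mulVec (c n) + B.mulVec (c (n + 1)) = 0) → c = 0 := by
  set M := symbolMatrix A B with hM
  let φ : Polynomial ℂ →ₐ[ℂ] (SeqL2 →L[ℂ] SeqL2) := Polynomial.aeval (translate 1)
  obtain ⟨u, hu⟩ : IsUnit (φ M.det) := isUnit_aeval_translate fun w hw => by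
    rw [hM, eval_det_symbolMatrix]
    exact h w hw
  have hcol : ∀ {g : ℤ → ι → ℂ}, (Summable fun n => ‖g n‖ ^ 2) → ∀ j,
      Summable fun n => ‖g n j‖ ^ 2 := fun hg j =>
    Summable.of_nonneg_of_le (fun n => by positivity)
      (fun n => pow_le_pow_left₀ (norm_nonneg _) (norm_le_pi_norm _ j) 2) hg
  constructor
  -- The system is a matrix of polynomials in the shift. These commute, so the adjugate times the
  -- inverse of the determinant inverts it as for scalar matrices.
  · let K : ι → ι → (SeqL2 →L[ℂ] SeqL2) := fun i j =>
      φ (M.adjugate i j) * ((u⁻¹ : (SeqL2 →L[ℂ] SeqL2)ˣ) : SeqL2 →L[ℂ] SeqL2)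
    refine ⟨∑ i, (∑ j, ‖K i j‖) ^ 2, by positivity, fun g hg => ?_⟩
    let γ : ι → SeqL2 := fun j => ⟨fun n => g n j, (memℓp_two_iff _).2 (hcol hg j)⟩
    let ψ : ι → SeqL2 := fun i => ∑ j, K i j (γ j)
    set G := ∑' n, ‖g n‖ ^ 2 with hG
    have hG0 : 0 ≤ G := tsum_nonneg fun n => by positivity
    have hγ : ∀ j, ‖γ j‖ ≤ √G := fun j => by
      refine Real.le_sqrt_of_sq_le ?_
      rw [norm_sq_eq_tsum]
      exact (hcol hg j).tsum_le_tsum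
        (fun n => pow_le_pow_left₀ (norm_nonneg _) (norm_le_pi_norm _ j) 2) hg
    have hψ : ∀ i, ‖ψ i‖ ^ 2 ≤ (∑ j, ‖K i j‖) ^ 2 * G := fun i => by
      have : ‖ψ i‖ ≤ (∑ j, ‖K i j‖) * √G := by
        rw [Finset.sum_mul]
        refine norm_sum_le_of_le _ fun j _ => ?_
        exact (K i j).le_opNorm_of_le (hγ j)
      calc ‖ψ i‖ ^ 2 ≤ ((∑ j, ‖K i j‖) * √G) ^ 2 := by gcongr
        _ = _ := by rw [mul_pow, Real.sq_sqrt hG0]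
    have hbound : ∀ n, ‖(fun i => ψ i n)‖ ^ 2 ≤ ∑ i, ‖ψ i n‖ ^ 2 := fun n => by
      have : ‖(fun i => ψ i n)‖ ≤ √(∑ i, ‖ψ i n‖ ^ 2) := by
        refine (pi_norm_le_iff_of_nonneg (by positivity)).2 fun i => ?_
        refine Real.le_sqrt_of_sq_le ?_
        exact Finset.single_le_sum (f := fun i => ‖ψ i n‖ ^ 2) (fun i _ => by positivity)
          (Finset.mem_univ i)
      calc _ ≤ √(∑ i, ‖ψ i n‖ ^ 2) ^ 2 := by gcongr
        _ = _ := Real.sq_sqrt (by positivity)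
    have hs : ∀ i ∈ (Finset.univ : Finset ι), Summable fun n => ‖ψ i n‖ ^ 2 :=
      fun i _ => summable_norm_sq (ψ i)
    have hsum := summable_sum hs
    have hcs : Summable fun n => ‖(fun i => ψ i n)‖ ^ 2 :=
      Summable.of_nonneg_of_le (fun n => by positivity) hbound hsum
    refine ⟨fun n i => ψ i n, hcs, ?_, fun n => ?_⟩
    · calc ∑' n, ‖(fun i => ψ i n)‖ ^ 2 ≤ ∑' n, ∑ i, ‖ψ i n‖ ^ 2 := hcs.tsum_le_tsum hbound hsum
        _ = ∑ i, ‖ψ i‖ ^ 2 := by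
          rw [Summable.tsum_finsetSum hs]
          exact Finset.sum_congr rfl fun i _ => (norm_sq_eq_tsum (ψ i)).symm
        _ ≤ ∑ i, (∑ j, ‖K i j‖) ^ 2 * G := Finset.sum_le_sum fun i _ => hψ i
        _ = _ := by rw [Finset.sum_mul]
    · funext k
      have e1 : (A.mulVec (fun i => ψ i n) + B.mulVec (fun i => ψ i (n + 1))) k
          = (∑ i, φ (M k i) (ψ i)) n := by
        rw [coeFn_sum]
        simp only [φ, hM, aeval_symbolMatrix_apply, Pi.add_apply, Matrix.mulVec, dotProduct,
          Finset.sum_add_distrib]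
      have e2 : ∑ i, φ (M k i) (ψ i) = γ k := by
        have e3 : ∀ i, φ (M k i) (ψ i) = ∑ j, φ (M k i * M.adjugate i j)
            (((u⁻¹ : (SeqL2 →L[ℂ] SeqL2)ˣ) : SeqL2 →L[ℂ] SeqL2) (γ j)) := fun i => by
          simp only [ψ, K, map_sum, map_mul]
          rfl
        simp only [e3]
        rw [Finset.sum_comm]
        have e4 : ∀ j, ∑ i, φ (M k i * M.adjugate i j)
            (((u⁻¹ : (SeqL2 →L[ℂ] SeqL2)ˣ) : SeqL2 →L[ℂ] SeqL2) (γ j))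
            = if k = j then γ j else 0 := fun j => by
          rw [← sum_apply, ← map_sum, ← Matrix.mul_apply, Matrix.mul_adjugate,
            Matrix.smul_apply, Matrix.one_apply]
          split_ifs with hkj
          · rw [smul_eq_mul, mul_one, ← hu]
            change ((u : SeqL2 →L[ℂ] SeqL2) * ((u⁻¹ : (SeqL2 →L[ℂ] SeqL2)ˣ) :
              SeqL2 →L[ℂ] SeqL2)) (γ j) = γ j
            rw [u.mul_inv]
            rfl
          · simp
        simp only [e4]
        simp
      rw [e1, e2]
  · intro c hc h0
    let ψ : ι → SeqL2 := fun j => ⟨fun n => c n j, (memℓp_two_iff _).2 (hcol hc j)⟩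
    have h1 : ∀ k, ∑ i, φ (M k i) (ψ i) = 0 := fun k => by
      refine lp.ext (funext fun n => ?_)
      rw [coeFn_sum]
      have := congrFun (h0 n) k
      simp only [φ, hM, aeval_symbolMatrix_apply, Pi.add_apply, Matrix.mulVec, dotProduct,
        Finset.sum_add_distrib] at this ⊢
      exact this
    have h2 : ∀ j, ψ j = 0 := fun j => by
      -- Uniqueness: multiplying the homogeneous system by the adjugate leaves the invertible
      -- operator `φ M.det` applied to each component.
      have e1 : φ M.det (ψ j) = ∑ i, φ ((M.adjugate * M) j i) (ψ i) := by
        simp only [Matrix.adjugate_mul, Matrix.smul_apply, Matrix.one_apply]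
        rw [Finset.sum_eq_single j]
        · simp
        · intro i _ hij
          simp [hij.symm]
        · simp
      have e2 : ∑ i, φ ((M.adjugate * M) j i) (ψ i) = 0 := by
        have : ∀ i, φ ((M.adjugate * M) j i) (ψ i)
            = ∑ k, φ (M.adjugate j k) (φ (M k i) (ψ i)) := fun i => by
          rw [Matrix.mul_apply, map_sum, sum_apply]
          simp only [map_mul]
          rfl
        simp only [this]
        rw [Finset.sum_comm]
        refine Finset.sum_eq_zero fun k _ => ?_
        rw [← map_sum, h1 k, map_zero]
      rw [e2, ← hu] at e1
      have e3 : (((u⁻¹ : (SeqL2 →L[ℂ] SeqL2)ˣ) : SeqL2 →L[ℂ] SeqL2) * (u : SeqL2 →L[ℂ] SeqL2))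
          (ψ j) = 0 := by
        change ((u⁻¹ : (SeqL2 →L[ℂ] SeqL2)ˣ) : SeqL2 →L[ℂ] SeqL2) ((u : SeqL2 →L[ℂ] SeqL2) (ψ j)) = 0
        rw [e1, map_zero]
      rwa [u.inv_mul] at e3
    funext n j
    have := congrArg (fun f : SeqL2 => f n) (h2 j)
    simpa using this

end RingChain

namespace RingChain

open Complex (I)

/-! ### The vertex conditions as linear equations -/

/-- The left hand side of the `j`-th coupling equation. -/
noncomputable def couplingLhs (j : Fin 3) : (Fin 3 → ℂ × ℂ) →ₗ[ℂ] ℂ where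
  toFun p := ((p (j + 1)).1 - (p j).1) + I * ((p (j + 1)).2 + (p j).2)
  map_add' p q := by simp; ring
  map_smul' k p := by simp; ring

lemma coupled_iff_couplingLhs (p : Fin 3 → ℂ × ℂ) : Coupled p ↔ ∀ j, couplingLhs j p = 0 :=
  Iff.rfl

/-- The part of the vertex conditions of a cell involving the link and the rings of that cell. -/
noncomputable def cellPart : BoundaryData (Fin 3) →ₗ[ℂ] (Fin 3 × Bool → ℂ) where
  toFun t := fun i => if i.2 then couplingLhs i.1 ![0, t (1, true), t (2, true)]
    else couplingLhs i.1 ![t (0, true), t (2, false), t (1, false)]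
  map_add' t t' := by
    funext ⟨j, b⟩
    cases b
    · simp [← map_add]
    · simp [← map_add]
  map_smul' k t := by
    funext ⟨j, b⟩
    cases b
    · simp [-smul_eq_mul, ← map_smul]
    · simp [-smul_eq_mul, ← map_smul]

/-- The part of the vertex conditions of a cell involving the link of the next cell. -/
noncomputable def nextPart : BoundaryData (Fin 3) →ₗ[ℂ] (Fin 3 × Bool → ℂ) where
  toFun t := fun i => if i.2 then couplingLhs i.1 ![t (0, false), 0, 0] else 0
  map_add' t t' := by
    funext ⟨j, b⟩
    cases b
    · simp
    · simp [← map_add]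
  map_smul' k t := by
    funext ⟨j, b⟩
    cases b
    · simp
    · simp [-smul_eq_mul, ← map_smul]

/-- Consecutive cells interact only through the left end of the next link, so the vertex conditions
form a first order difference equation in the cell index. -/
lemma cellPart_add_nextPart_eq_zero_iff (t t' : BoundaryData (Fin 3)) :
    cellPart t + nextPart t' = 0 ↔ Coupled ![t (0, true), t (2, false), t (1, false)] ∧
      Coupled ![t' (0, false), t (1, true), t (2, true)] := by
  rw [funext_iff, Prod.forall, coupled_iff_couplingLhs, coupled_iff_couplingLhs, ← forall_and]
  refine forall_congr' fun j => ?_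
  rw [Bool.forall_bool]
  simp [cellPart, nextPart, ← map_add]

lemma blochCoupled_iff (w : ℂ) (t : BoundaryData (Fin 3)) :
    BlochCoupled w t ↔ cellPart t + w • nextPart t = 0 := by
  rw [← map_smul, cellPart_add_nextPart_eq_zero_iff]
  rfl

lemma mem_fiberCoupling_iff {θ : ℝ} {t : BoundaryData (Fin 3)} :
    t ∈ fiberCoupling θ ↔ BlochCoupled (Complex.exp (I * θ)) t :=
  Iff.rfl

lemma mem_chainCoupling_iff {t : BoundaryData (ℤ × Fin 3)} :
    t ∈ chainCoupling ↔ ∀ n : ℤ, cellPart (fun p => t ((n, p.1), p.2))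
      + nextPart (fun p => t ((n + 1, p.1), p.2)) = 0 := by
  simp only [cellPart_add_nextPart_eq_zero_iff]
  rfl

/-- Initial data of the three edges from six coordinates. -/
def toPairs : (Fin 3 × Bool → ℂ) →ₗ[ℂ] (Fin 3 → ℂ × ℂ) where
  toFun x := fun j => (x (j, false), x (j, true))
  map_add' _ _ := rfl
  map_smul' _ _ := rfl

lemma toPairs_injective : Function.Injective toPairs := by
  intro x y h
  funext ⟨j, b⟩
  cases b
  · exact congrArg Prod.fst (congrFun h j)
  · exact congrArg Prod.snd (congrFun h j)

lemma exists_toPairs (a : Fin 3 → ℂ × ℂ) :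
    ∃ x, toPairs x = a ∧ ‖x‖ ≤ ‖a‖ := by
  refine ⟨fun i => if i.2 then (a i.1).2 else (a i.1).1, ?_, ?_⟩
  · funext j
    simp [toPairs]
  · refine (pi_norm_le_iff_of_nonneg (norm_nonneg _)).2 fun ⟨j, b⟩ => ?_
    cases b
    · exact (norm_fst_le _).trans (norm_le_pi_norm a j)
    · exact (norm_snd_le _).trans (norm_le_pi_norm a j)

lemma norm_toPairs_apply_le (x : Fin 3 × Bool → ℂ) (j : Fin 3) : ‖toPairs x j‖ ≤ ‖x‖ :=
  max_le (norm_le_pi_norm x (j, false)) (norm_le_pi_norm x (j, true))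

/-- `homData` as a linear map. -/
def homDataₗ {E : Type} (z : ℂ) (c s : ℝ → ℂ) (L : E → ℝ) :
    (E → ℂ × ℂ) →ₗ[ℂ] BoundaryData E where
  toFun := homData z c s L
  map_add' a b := by
    ext ⟨e, k⟩ <;> cases k <;> simp [homData] <;> ring
  map_smul' k a := by
    ext ⟨e, k⟩ <;> cases k <;> simp [homData] <;> ring

/-- `endData` as a linear map. -/
def endDataₗ {E : Type} : (E → ℂ × ℂ) →ₗ[ℂ] BoundaryData E where
  toFun := endData
  map_add' a b := by
    ext ⟨e, k⟩ <;> cases k <;> simp [endData]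
  map_smul' k a := by
    ext ⟨e, k⟩ <;> cases k <;> simp [endData]

/-- `nextPart` reads left ends only, where variation of parameters adds nothing; the inhomogeneity
of a cell thus enters only its own equation. -/
lemma nextPart_endData (r : Fin 3 → ℂ × ℂ) : nextPart (endData r) = 0 := by
  funext ⟨j, b⟩
  have h0 : (![0, 0, 0] : Fin 3 → ℂ × ℂ) = 0 := by
    funext i; fin_cases i <;> rfl
  cases b
  · rfl
  · simp [nextPart, endData, h0]

/-- Matrix of the vertex conditions on the coefficients of a cell. -/
noncomputable def cellMatrix (z : ℂ) (c s : ℝ → ℂ) (ℓ : ℝ) : Matrix (Fin 3 × Bool) (Fin 3 × Bool) ℂ :=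
  LinearMap.toMatrix' (cellPart ∘ₗ homDataₗ z c s (cellLength ℓ) ∘ₗ toPairs)

/-- Matrix of the vertex conditions on the coefficients of the next cell. -/
noncomputable def nextMatrix (z : ℂ) (c s : ℝ → ℂ) (ℓ : ℝ) : Matrix (Fin 3 × Bool) (Fin 3 × Bool) ℂ :=
  LinearMap.toMatrix' (nextPart ∘ₗ homDataₗ z c s (cellLength ℓ) ∘ₗ toPairs)

lemma cellMatrix_mulVec (z : ℂ) (c s : ℝ → ℂ) (ℓ : ℝ) (x : Fin 3 × Bool → ℂ) :
    (cellMatrix z c s ℓ).mulVec x = cellPart (homData z c s (cellLength ℓ) (toPairs x)) := by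
  rw [cellMatrix, LinearMap.toMatrix'_mulVec]
  rfl

lemma nextMatrix_mulVec (z : ℂ) (c s : ℝ → ℂ) (ℓ : ℝ) (x : Fin 3 × Bool → ℂ) :
    (nextMatrix z c s ℓ).mulVec x = nextPart (homData z c s (cellLength ℓ) (toPairs x)) := by
  rw [nextMatrix, LinearMap.toMatrix'_mulVec]
  rfl

lemma det_ne_zero_of_not_hasBloch {z : ℂ} {c s : ℝ → ℂ} {ℓ : ℝ} {w : ℂ}
    (h : ¬ HasBloch z c s ℓ w) : (cellMatrix z c s ℓ + w • nextMatrix z c s ℓ).det ≠ 0 := by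
  intro h0
  obtain ⟨x, hx, hx0⟩ := Matrix.exists_mulVec_eq_zero_iff.2 h0
  refine h ⟨toPairs x, fun hx' => hx (toPairs_injective (hx'.trans (map_zero toPairs).symm)), ?_⟩
  rw [blochCoupled_iff]
  rwa [Matrix.add_mulVec, Matrix.smul_mulVec, cellMatrix_mulVec, nextMatrix_mulVec] at hx0

lemma cellLength_pos {ℓ : ℝ} (hℓ : 0 < ℓ) (j : Fin 3) : 0 < cellLength ℓ j := by
  have := Real.pi_pos
  fin_cases j <;> simpa [cellLength]

lemma norm_sq_le_sum (r : Fin 3 → ℂ × ℂ) : ‖r‖ ^ 2 ≤ ∑ j, ‖r j‖ ^ 2 := by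
  have : ‖r‖ ≤ √(∑ j, ‖r j‖ ^ 2) := by
    refine (pi_norm_le_iff_of_nonneg (by positivity)).2 fun i => Real.le_sqrt_of_sq_le ?_
    exact Finset.single_le_sum (f := fun i => ‖r i‖ ^ 2) (fun i _ => by positivity)
      (Finset.mem_univ i)
  calc _ ≤ √(∑ j, ‖r j‖ ^ 2) ^ 2 := by gcongr
    _ = _ := Real.sq_sqrt (by positivity)

lemma sum_norm_toPairs_le (x : Fin 3 × Bool → ℂ) : ∑ j, ‖toPairs x j‖ ^ 2 ≤ 3 * ‖x‖ ^ 2 := by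
  calc ∑ j, ‖toPairs x j‖ ^ 2 ≤ ∑ _j : Fin 3, ‖x‖ ^ 2 := Finset.sum_le_sum fun j _ =>
        pow_le_pow_left₀ (norm_nonneg _) (norm_toPairs_apply_le x j) 2
    _ = _ := by simp

lemma exists_norm_cellPart_endData_le : ∃ K : ℝ, 0 ≤ K ∧ ∀ r : Fin 3 → ℂ × ℂ,
    ‖cellPart (endData r)‖ ≤ K * ‖r‖ :=
  ⟨‖LinearMap.toContinuousLinearMap (cellPart ∘ₗ endDataₗ (E := Fin 3))‖, norm_nonneg _, fun r =>
    (LinearMap.toContinuousLinearMap (cellPart ∘ₗ endDataₗ (E := Fin 3))).le_opNorm r⟩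

lemma summable_tsum_cells (r : ℤ × Fin 3 → ℂ × ℂ) (hr : Summable fun e => ‖r e‖ ^ 2) :
    (Summable fun n => ∑ j, ‖r (n, j)‖ ^ 2) ∧
      ∑' e, ‖r e‖ ^ 2 = ∑' n, ∑ j, ‖r (n, j)‖ ^ 2 := by
  have h1 := hr.prod
  have h2 := hr.tsum_prod
  simp only [tsum_fintype] at h1 h2
  exact ⟨h1, h2⟩

/-! ### Points of the resolvent sets -/

/-- Energies without a solution of the Floquet problem belong to the resolvent set of the fiber
operator. -/
theorem IsFundamental.inResolventSet_fiberH {z : ℂ} {c s : ℝ → ℂ} (h : IsFundamental z c s)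
    {ℓ : ℝ} (hℓ : 0 < ℓ) {θ : ℝ} (hB : ¬ HasBloch z c s ℓ (Complex.exp (I * θ))) :
    InResolventSet (fiberH ℓ θ) z := by
  have hdet := det_ne_zero_of_not_hasBloch hB
  set w := Complex.exp (I * θ) with hw
  set M := cellMatrix z c s ℓ + w • nextMatrix z c s ℓ with hM
  obtain ⟨K, hK, hKb⟩ := exists_norm_cellPart_endData_le
  set K' := ‖LinearMap.toContinuousLinearMap (Matrix.toLin' M⁻¹)‖ with hK'
  refine h.inResolventSet_laplacian (cellLength_pos hℓ) (finite_range _) ?_ ?_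
  · refine ⟨3 * (K' * K) ^ 2, by positivity, fun r _ => ?_⟩
    set x := M⁻¹.mulVec (-cellPart (endData r)) with hx
    have hMx : M.mulVec x = -cellPart (endData r) := by
      rw [hx, Matrix.mulVec_mulVec, Matrix.mul_nonsing_inv _ (isUnit_iff_ne_zero.2 hdet),
        Matrix.one_mulVec]
    have hxb : ‖x‖ ≤ K' * K * ‖r‖ := by
      have h1 := (LinearMap.toContinuousLinearMap (Matrix.toLin' M⁻¹)).le_opNorm
        (-cellPart (endData r))
      rw [norm_neg] at h1
      calc ‖x‖ ≤ K' * ‖cellPart (endData r)‖ := h1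
        _ ≤ K' * (K * ‖r‖) := by gcongr; exact hKb r
        _ = _ := by ring
    refine ⟨toPairs x, Summable.of_finite, ?_, ?_⟩
    · rw [tsum_fintype, tsum_fintype]
      calc ∑ j, ‖toPairs x j‖ ^ 2 ≤ 3 * ‖x‖ ^ 2 := sum_norm_toPairs_le x
        _ ≤ 3 * (K' * K * ‖r‖) ^ 2 := by gcongr
        _ = 3 * (K' * K) ^ 2 * ‖r‖ ^ 2 := by ring
        _ ≤ _ := by gcongr; exact norm_sq_le_sum r
    · rw [mem_fiberCoupling_iff, blochCoupled_iff, map_add, map_add, nextPart_endData, add_zero,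
        ← cellMatrix_mulVec, ← nextMatrix_mulVec, add_right_comm, ← hw, ← Matrix.smul_mulVec,
        ← Matrix.add_mulVec, ← hM, hMx, neg_add_cancel]
  · intro a _ ha
    by_contra hne
    exact hB ⟨a, hne, mem_fiberCoupling_iff.1 ha⟩

/-- Energies without bounded generalized eigenfunctions of Floquet type belong to the resolvent set
of the chain. -/
theorem IsFundamental.inResolventSet_chainH {z : ℂ} {c s : ℝ → ℂ} (h : IsFundamental z c s)
    {ℓ : ℝ} (hℓ : 0 < ℓ) (hB : ∀ w : ℂ, ‖w‖ = 1 → ¬ HasBloch z c s ℓ w) :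
    InResolventSet (chainH ℓ) z := by
  obtain ⟨⟨C, hC, hsolve⟩, huniq⟩ := exists_l2_solution_difference_equation
    (cellMatrix z c s ℓ) (nextMatrix z c s ℓ) fun w hw => det_ne_zero_of_not_hasBloch (hB w hw)
  obtain ⟨K, hK, hKb⟩ := exists_norm_cellPart_endData_le
  have hfin : (range (chainLength ℓ)).Finite := by
    refine (finite_range (cellLength ℓ)).subset ?_
    rintro _ ⟨e, rfl⟩
    exact ⟨e.2, rfl⟩
  have hcell := @summable_tsum_cells
  have hL : ∀ e, 0 < chainLength ℓ e := fun e => cellLength_pos hℓ e.2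
  unfold chainH
  refine h.inResolventSet_laplacian hL hfin ?_ ?_
  · refine ⟨3 * (C * K ^ 2), by positivity, fun r hr => ?_⟩
    obtain ⟨hrs, hrt⟩ := hcell r hr
    have hgb : ∀ n, ‖-cellPart (endData fun j => r (n, j))‖ ^ 2
        ≤ K ^ 2 * ∑ j, ‖r (n, j)‖ ^ 2 := fun n => by
      rw [norm_neg]
      calc _ ≤ (K * ‖fun j => r (n, j)‖) ^ 2 := by gcongr; exact hKb _
        _ = K ^ 2 * ‖fun j => r (n, j)‖ ^ 2 := by ring
        _ ≤ _ := by gcongr; exact norm_sq_le_sum _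
    have hgs : Summable fun n : ℤ => ‖-cellPart (endData fun j => r (n, j))‖ ^ 2 :=
      Summable.of_nonneg_of_le (fun n => by positivity) hgb (hrs.mul_left _)
    obtain ⟨x, hxs, hxb, hx⟩ := hsolve _ hgs
    set a : ℤ × Fin 3 → ℂ × ℂ := fun e => toPairs (x e.1) e.2 with ha
    have hxs' : Summable fun n => ∑ j, ‖a (n, j)‖ ^ 2 :=
      Summable.of_nonneg_of_le (fun n => by positivity) (fun n => sum_norm_toPairs_le (x n))
        (hxs.mul_left 3)
    have has : Summable fun e => ‖a e‖ ^ 2 := by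
      rw [summable_prod_of_nonneg fun e => by positivity]
      refine ⟨fun n => Summable.of_finite, ?_⟩
      simpa only [tsum_fintype] using hxs'
    refine ⟨a, has, ?_, ?_⟩
    · rw [(hcell a has).2, hrt]
      calc ∑' n, ∑ j, ‖a (n, j)‖ ^ 2 ≤ ∑' n, 3 * ‖x n‖ ^ 2 :=
            hxs'.tsum_le_tsum (fun n => sum_norm_toPairs_le (x n)) (hxs.mul_left 3)
        _ = 3 * ∑' n, ‖x n‖ ^ 2 := tsum_mul_left
        _ ≤ 3 * (C * ∑' n, ‖-cellPart (endData fun j => r (n, j))‖ ^ 2) := by gcongr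
        _ ≤ 3 * (C * ∑' n, K ^ 2 * ∑ j, ‖r (n, j)‖ ^ 2) := by
          refine mul_le_mul_of_nonneg_left (mul_le_mul_of_nonneg_left ?_ hC) (by norm_num)
          exact hgs.tsum_le_tsum hgb (hrs.mul_left _)
        _ = _ := by rw [tsum_mul_left]; ring
    · rw [mem_chainCoupling_iff]
      intro n
      have hn := hx n
      rw [cellMatrix_mulVec, nextMatrix_mulVec] at hn
      have e1 : ∀ m : ℤ, (fun p : Fin 3 × Bool => (homData z c s (chainLength ℓ) a + endData r)
          ((m, p.1), p.2)) = homData z c s (cellLength ℓ) (toPairs (x m))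
            + endData fun j => r (m, j) := fun m => by
        funext ⟨j, b⟩
        cases b <;> rfl
      rw [e1, e1, map_add, map_add, nextPart_endData, add_zero, add_right_comm, hn, neg_add_cancel]
  · intro a has ha
    rw [mem_chainCoupling_iff] at ha
    have hx := fun n : ℤ => exists_toPairs fun j => a (n, j)
    choose x hxa hxb using hx
    have hxs : Summable fun n => ‖x n‖ ^ 2 := by
      refine Summable.of_nonneg_of_le (fun n => by positivity) (fun n => ?_) (hcell a has).1
      exact (pow_le_pow_left₀ (norm_nonneg _) (hxb n) 2).trans (norm_sq_le_sum _)
    have hx0 := huniq x hxs fun n => by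
      rw [cellMatrix_mulVec, nextMatrix_mulVec, hxa, hxa]
      have e1 : ∀ m : ℤ, (fun p : Fin 3 × Bool => homData z c s (chainLength ℓ) a ((m, p.1), p.2))
          = homData z c s (cellLength ℓ) (fun j => a (m, j)) := fun m => by
        funext ⟨j, b⟩
        cases b <;> rfl
      have := ha n
      rwa [e1, e1] at this
    funext ⟨n, j⟩
    have := congrFun (hxa n) j
    rw [hx0] at this
    rw [← this, Pi.zero_apply, map_zero]
    rfl

end RingChain

namespace RingChain

open Complex (I)

/-! ### Points of the spectra -/

/-- A bounded resolvent `R` would force `‖ψ‖ ≤ ‖R‖ ‖(T - z)ψ‖` for every `ψ` in the domain. -/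
lemma mem_spec_laplacian {E : Type} {L : E → ℝ} {B : Submodule ℂ (BoundaryData E)} {z : ℂ}
    (h : ∀ C : ℝ, 0 ≤ C → ∃ p ∈ laplaceGraph L B, C * ‖p.2 - z • p.1‖ < ‖p.1‖) :
    z ∈ spec (laplacian L B) := by
  rintro ⟨R, -, hR⟩
  obtain ⟨p, hp, hlt⟩ := h ‖R‖ (norm_nonneg _)
  obtain ⟨x, hx1, hx2⟩ := exists_mem_domain hp
  have h1 := hR x
  rw [hx2, hx1] at h1
  have h2 := R.le_opNorm (p.2 - z • p.1)
  rw [h1] at h2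
  exact hlt.not_ge h2

lemma mem_laplaceGraph_of_hasDerivAt {E : Type} {L : E → ℝ} {B : Submodule ℂ (BoundaryData E)}
    {U V W : E → ℝ → ℂ} (hUV : ∀ e x, HasDerivAt (U e) (V e x) x)
    (hVW : ∀ e x, HasDerivAt (V e) (-W e x) x) (hU : ∀ e, Continuous (U e))
    (hW : ∀ e, Continuous (W e)) {p : GraphL2 L × GraphL2 L}
    (hp1 : ∀ e, p.1 e = edgeLp (L e) (hU e)) (hp2 : ∀ e, p.2 e = edgeLp (L e) (hW e))
    (hB : boundaryData L U V ∈ B) : p ∈ laplaceGraph L B := by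
  refine ⟨U, V, fun e => ?_, fun e x hx => ⟨?_, ?_⟩, hB⟩
  · rw [hp1]
    exact coeFn_edgeLp _ _
  · have hV : Continuous (V e) := continuous_iff_continuousAt.2 fun x => (hVW e x).continuousAt
    rw [intervalIntegral.integral_eq_sub_of_hasDerivAt (fun t _ => hUV e t)
      (hV.intervalIntegrable _ _)]
    ring
  · have h1 : (∫ t in (0 : ℝ)..x, -(p.2 e) t) = ∫ t in (0 : ℝ)..x, -W e t := by
      refine intervalIntegral.integral_congr_ae ?_
      rw [hp2]
      filter_upwards [(ae_restrict_iff' measurableSet_Ioc).1 (coeFn_edgeLp (L e) (hW e))]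
        with t ht hm
      rw [uIoc_of_le hx.1] at hm
      rw [ht ⟨hm.1, hm.2.trans hx.2⟩]
    rw [h1, intervalIntegral.integral_eq_sub_of_hasDerivAt (fun t _ => hVW e t)
      ((hW e).neg.intervalIntegrable _ _)]
    ring

lemma edgeLp_eq_smul {L : ℝ} {k : ℂ} {f g : ℝ → ℂ} (hf : Continuous f) (hg : Continuous g)
    (h : ∀ x, f x = k * g x) : edgeLp L hf = k • edgeLp L hg := by
  refine Lp.ext ?_
  filter_upwards [coeFn_edgeLp L hf, coeFn_edgeLp L hg, Lp.coeFn_smul k (edgeLp L hg)]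
    with t h1 h2 h3
  rw [h1, h3, Pi.smul_apply, h2, h t, smul_eq_mul]

lemma edgeLp_sub_smul {L : ℝ} {z : ℂ} {f g k : ℝ → ℂ} (hf : Continuous f) (hg : Continuous g)
    (hk : Continuous k) (h : ∀ x, g x - z * f x = k x) :
    edgeLp L hg - z • edgeLp L hf = edgeLp L hk := by
  refine Lp.ext ?_
  filter_upwards [coeFn_edgeLp L hf, coeFn_edgeLp L hg, coeFn_edgeLp L hk,
    Lp.coeFn_smul z (edgeLp L hf), Lp.coeFn_sub (edgeLp L hg) (z • edgeLp L hf)]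
    with t h1 h2 h3 h4 h5
  rw [h5, Pi.sub_apply, h4, Pi.smul_apply, h1, h2, h3, smul_eq_mul, h t]

lemma edgeLp_eq_zero {L : ℝ} {f : ℝ → ℂ} (hf : Continuous f) (h : ∀ x, f x = 0) :
    edgeLp L hf = 0 := by
  have := edgeLp_eq_smul (L := L) (k := 0) hf hf fun x => by rw [h x, mul_zero]
  rwa [zero_smul] at this

namespace IsFundamental

variable {z : ℂ} {c s : ℝ → ℂ}

/-- The solution of `-u'' = z u` with initial data `a`. -/
lemma hasDerivAt_solution (h : IsFundamental z c s) (a : ℂ × ℂ) (x : ℝ) :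
    HasDerivAt (fun x => a.1 * c x + a.2 * s x) (a.2 * c x - z * s x * a.1) x := by
  refine (((h.hasDerivAt_c x).const_mul a.1).fun_add ((h.hasDerivAt_s x).const_mul a.2)).congr_deriv
    ?_
  ring

lemma hasDerivAt_deriv_solution (h : IsFundamental z c s) (a : ℂ × ℂ) (x : ℝ) :
    HasDerivAt (fun x => a.2 * c x - z * s x * a.1) (-(z * (a.1 * c x + a.2 * s x))) x := by
  refine (((h.hasDerivAt_c x).const_mul a.2).fun_sub
    (((h.hasDerivAt_s x).const_mul z).mul_const a.1)).congr_deriv ?_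
  ring

lemma continuous_solution (h : IsFundamental z c s) (a : ℂ × ℂ) :
    Continuous fun x => a.1 * c x + a.2 * s x :=
  continuous_iff_continuousAt.2 fun x => (h.hasDerivAt_solution a x).continuousAt

lemma edgeLp_solution_ne_zero (h : IsFundamental z c s) {L : ℝ} (hL : 0 < L) {a : ℂ × ℂ}
    (ha : a ≠ 0) : 0 < ‖edgeLp L (h.continuous_solution a)‖ := by
  obtain ⟨K, hK, hle⟩ := h.exists_le_norm hL
  have := hle a _ (coeFn_edgeLp L (h.continuous_solution a))
  by_contra! h0
  have h1 : ‖edgeLp L (h.continuous_solution a)‖ = 0 := le_antisymm h0 (norm_nonneg _)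
  rw [h1, mul_zero] at this
  exact ha (norm_le_zero_iff.1 this)

/-- Solutions of the Floquet problem are eigenfunctions of the fiber operator. -/
theorem mem_spec_fiberH (h : IsFundamental z c s) {ℓ : ℝ} (hℓ : 0 < ℓ) {θ : ℝ}
    (hB : HasBloch z c s ℓ (Complex.exp (I * θ))) : z ∈ spec (fiberH ℓ θ) := by
  obtain ⟨a, ha, hB⟩ := hB
  refine mem_spec_laplacian fun C _ => ?_
  have hc := h.continuous_c
  have hs := h.continuous_s
  have hUc := fun j => h.continuous_solution (a j)
  have hWc : ∀ j, Continuous fun x => z * ((a j).1 * c x + (a j).2 * s x) := fun j =>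
    continuous_const.mul (hUc j)
  let Ψ : GraphL2 (cellLength ℓ) := ⟨fun j => edgeLp (cellLength ℓ j) (hUc j),
    (memℓp_two_iff _).2 Summable.of_finite⟩
  have hΨ : ∀ j, Ψ j = edgeLp (cellLength ℓ j) (hUc j) := fun _ => rfl
  refine ⟨(Ψ, z • Ψ), mem_laplaceGraph_of_hasDerivAt (fun j x => h.hasDerivAt_solution (a j) x)
    (fun j x => h.hasDerivAt_deriv_solution (a j) x) hUc hWc hΨ (fun j => ?_) ?_, ?_⟩
  · exact (edgeLp_eq_smul (hWc j) (hUc j) fun x => rfl).symm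
  · rw [mem_fiberCoupling_iff]
    convert hB using 1
    ext ⟨j, b⟩
    · cases b
      · simp [boundaryData, homData, h.c_zero, h.s_zero]
      · rfl
    · cases b
      · simp [boundaryData, homData, h.c_zero, h.s_zero]
      · simp [boundaryData, homData]
        ring
  · simp only [sub_self, norm_zero, mul_zero]
    obtain ⟨j, hj⟩ : ∃ j, a j ≠ 0 := by
      by_contra! h0
      exact ha (funext h0)
    rw [norm_pos_iff]
    intro h0
    have h1 := h.edgeLp_solution_ne_zero (cellLength_pos hℓ j) hj
    rw [← hΨ, h0] at h1
    simp at h1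

end IsFundamental

lemma Coupled.smul {x y t : ℂ × ℂ} (h : Coupled ![x, y, t]) (k : ℂ) :
    Coupled ![k • x, k • y, k • t] := by
  rw [coupled_iff_couplingLhs] at h ⊢
  intro j
  have := map_smul (couplingLhs j) k ![x, y, t]
  rw [h j, smul_zero] at this
  simpa using this

/-- A cut-off function on the link, rising smoothly from `0` to `1`. -/
noncomputable def cutoff (ℓ x : ℝ) : ℂ := ((3 * x ^ 2 / ℓ ^ 2 - 2 * x ^ 3 / ℓ ^ 3 : ℝ) : ℂ)

/-- Derivative of the cut-off function. -/
noncomputable def cutoff' (ℓ x : ℝ) : ℂ := ((6 * x / ℓ ^ 2 - 6 * x ^ 2 / ℓ ^ 3 : ℝ) : ℂ)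

/-- Second derivative of the cut-off function. -/
noncomputable def cutoff'' (ℓ x : ℝ) : ℂ := ((6 / ℓ ^ 2 - 12 * x / ℓ ^ 3 : ℝ) : ℂ)

lemma hasDerivAt_cutoff (ℓ x : ℝ) : HasDerivAt (cutoff ℓ) (cutoff' ℓ x) x := by
  refine HasDerivAt.ofReal_comp (f := fun x => 3 * x ^ 2 / ℓ ^ 2 - 2 * x ^ 3 / ℓ ^ 3) ?_
  refine ((((hasDerivAt_pow 2 x).const_mul 3).div_const _).fun_sub
    (((hasDerivAt_pow 3 x).const_mul 2).div_const _)).congr_deriv ?_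
  push_cast
  ring

lemma hasDerivAt_cutoff' (ℓ x : ℝ) : HasDerivAt (cutoff' ℓ) (cutoff'' ℓ x) x := by
  refine HasDerivAt.ofReal_comp (f := fun x => 6 * x / ℓ ^ 2 - 6 * x ^ 2 / ℓ ^ 3) ?_
  refine ((((hasDerivAt_id' x).const_mul 6).div_const _).fun_sub
    (((hasDerivAt_pow 2 x).const_mul 6).div_const _)).congr_deriv ?_
  push_cast
  ring

lemma continuous_cutoff'' (ℓ : ℝ) : Continuous (cutoff'' ℓ) := by
  unfold cutoff''
  fun_prop

lemma cutoff_zero (ℓ : ℝ) : cutoff ℓ 0 = 0 := by simp [cutoff]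

lemma cutoff'_zero (ℓ : ℝ) : cutoff' ℓ 0 = 0 := by simp [cutoff']

lemma cutoff_self {ℓ : ℝ} (hℓ : 0 < ℓ) : cutoff ℓ ℓ = 1 := by
  have : 3 * ℓ ^ 2 / ℓ ^ 2 - 2 * ℓ ^ 3 / ℓ ^ 3 = 1 := by field_simp; norm_num
  rw [cutoff, this, Complex.ofReal_one]

lemma cutoff'_self {ℓ : ℝ} (hℓ : 0 < ℓ) : cutoff' ℓ ℓ = 0 := by
  have : 6 * ℓ / ℓ ^ 2 - 6 * ℓ ^ 2 / ℓ ^ 3 = 0 := by field_simp; norm_num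
  rw [cutoff', this, Complex.ofReal_zero]

/-- Energies with a bounded generalized eigenfunction of Floquet type belong to the spectrum of the
chain: cutting the function off on two links gives a Weyl sequence. -/
theorem IsFundamental.mem_spec_chainH {z : ℂ} {c s : ℝ → ℂ} (h : IsFundamental z c s) {ℓ : ℝ}
    (hℓ : 0 < ℓ) {w : ℂ} (hw : ‖w‖ = 1) (hB : HasBloch z c s ℓ w) : z ∈ spec (chainH ℓ) := by
  obtain ⟨a, ha, hB⟩ := hB
  obtain ⟨j₀, hj₀⟩ : ∃ j, a j ≠ 0 := by
    by_contra! h0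
    exact ha (funext h0)
  have hw0 : w ≠ 0 := fun h0 => by simp [h0] at hw
  have hwn : ∀ n : ℤ, ‖w ^ n‖ = 1 := fun n => by rw [norm_zpow, hw, one_zpow]
  unfold chainH
  refine mem_spec_laplacian fun C hC => ?_
  have hc := h.continuous_c
  have hs := h.continuous_s
  have hh : Continuous (cutoff ℓ) :=
    continuous_iff_continuousAt.2 fun x => (hasDerivAt_cutoff ℓ x).continuousAt
  have hh' : Continuous (cutoff' ℓ) :=
    continuous_iff_continuousAt.2 fun x => (hasDerivAt_cutoff' ℓ x).continuousAt
  have hh'' := continuous_cutoff'' ℓ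
  set u : Fin 3 → ℝ → ℂ := fun j x => (a j).1 * c x + (a j).2 * s x with hu
  set v : Fin 3 → ℝ → ℂ := fun j x => (a j).2 * c x - z * s x * (a j).1 with hv
  have hud : ∀ j x, HasDerivAt (u j) (v j x) x := fun j x => h.hasDerivAt_solution (a j) x
  have hvd : ∀ j x, HasDerivAt (v j) (-(z * u j x)) x := fun j x =>
    h.hasDerivAt_deriv_solution (a j) x
  have huc : ∀ j, Continuous (u j) := fun j => by simp only [hu]; fun_prop
  have hvc : ∀ j, Continuous (v j) := fun j => by simp only [hv]; fun_prop
  have hGc : Continuous fun x => cutoff'' ℓ x * u 0 x + 2 * cutoff' ℓ x * v 0 x := by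
    have := huc 0
    have := hvc 0
    fun_prop
  set γ := ‖edgeLp ℓ hGc‖ with hγ
  set δ := ‖edgeLp (cellLength ℓ j₀) (huc j₀)‖ with hδ
  have hδ0 : 0 < δ := h.edgeLp_solution_ne_zero (cellLength_pos hℓ j₀) hj₀
  -- The error lives on two links with norm at most `γ` each, whereas each of `N` cells contributes
  -- `δ²` to the squared norm.
  obtain ⟨N, hN⟩ := exists_nat_gt (2 * (C * γ) ^ 2 / δ ^ 2)
  rw [div_lt_iff₀ (by positivity)] at hN
  -- the cut-off is constant near the vertices
  set χ : ℤ → ℂ := fun n => if n ∈ Finset.Icc (0 : ℤ) N then 1 else 0 with hχ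
  -- The cut-off passes from `χ (n - 1)` to `χ n` along the `n`-th link and is constant on the
  -- half-rings. Its derivative vanishes at both ends of a link, so each vertex sees a scalar
  -- multiple of the Bloch data and the coupling persists.
  set A : ℤ × Fin 3 → ℂ := fun e => if e.2 = 0 then χ (e.1 - 1) else χ e.1 with hA
  set D : ℤ × Fin 3 → ℂ := fun e => if e.2 = 0 then χ e.1 - χ (e.1 - 1) else 0 with hD
  set U : ℤ × Fin 3 → ℝ → ℂ := fun e x =>
    w ^ e.1 * ((A e + D e * cutoff ℓ x) * u e.2 x) with hU
  set V : ℤ × Fin 3 → ℝ → ℂ := fun e x =>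
    w ^ e.1 * (D e * cutoff' ℓ x * u e.2 x + (A e + D e * cutoff ℓ x) * v e.2 x) with hV
  set W : ℤ × Fin 3 → ℝ → ℂ := fun e x =>
    w ^ e.1 * (-(D e * (cutoff'' ℓ x * u e.2 x + 2 * cutoff' ℓ x * v e.2 x))
      + z * ((A e + D e * cutoff ℓ x) * u e.2 x)) with hW
  have hUd : ∀ e x, HasDerivAt (U e) (V e x) x := by
    intro e x
    refine (((((hasDerivAt_cutoff ℓ x).const_mul (D e)).const_add (A e)).fun_mul
      (hud e.2 x)).const_mul (w ^ e.1)).congr_deriv ?_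
    simp only [hV]
  have hVd : ∀ e x, HasDerivAt (V e) (-W e x) x := by
    intro e x
    refine (((((hasDerivAt_cutoff' ℓ x).const_mul (D e)).fun_mul (hud e.2 x)).fun_add
      ((((hasDerivAt_cutoff ℓ x).const_mul (D e)).const_add (A e)).fun_mul
      (hvd e.2 x))).const_mul (w ^ e.1)).congr_deriv ?_
    simp only [hW]
    ring
  have hUc : ∀ e, Continuous (U e) := fun e => by
    have := huc e.2
    simp only [hU]
    fun_prop
  have hWc : ∀ e, Continuous (W e) := fun e => by
    have := huc e.2
    have := hvc e.2
    simp only [hW]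
    fun_prop
  -- the support of the cut-off
  set S : Finset (ℤ × Fin 3) := Finset.Icc (-1 : ℤ) (N + 1) ×ˢ Finset.univ with hS
  have hχ0 : ∀ n : ℤ, n ∉ Finset.Icc (-1 : ℤ) (N + 1) → χ n = 0 ∧ χ (n - 1) = 0 := by
    intro n hn
    simp only [Finset.mem_Icc, not_and, not_le] at hn
    constructor
    · refine if_neg fun h => ?_
      rw [Finset.mem_Icc] at h
      have := hn (by omega)
      omega
    · refine if_neg fun h => ?_
      rw [Finset.mem_Icc] at h
      have := hn (by omega)
      omega
  have hAD : ∀ e ∉ S, A e = 0 ∧ D e = 0 := by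
    intro e he
    have h1 := hχ0 e.1 fun h1 => he (Finset.mem_product.2 ⟨h1, Finset.mem_univ _⟩)
    simp [hA, hD, h1.1, h1.2]
  have hUm : Memℓp (fun e => edgeLp (chainLength ℓ e) (hUc e)) 2 := by
    refine (memℓp_two_iff _).2 (summable_of_ne_finset_zero (s := S) fun e he => ?_)
    rw [edgeLp_eq_zero (hUc e) fun x => by simp [hU, (hAD e he).1, (hAD e he).2]]
    simp
  have hWm : Memℓp (fun e => edgeLp (chainLength ℓ e) (hWc e)) 2 := by
    refine (memℓp_two_iff _).2 (summable_of_ne_finset_zero (s := S) fun e he => ?_)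
    rw [edgeLp_eq_zero (hWc e) fun x => by simp [hW, (hAD e he).1, (hAD e he).2]]
    simp
  set Ψ : GraphL2 (chainLength ℓ) := ⟨_, hUm⟩ with hΨ
  set Φ : GraphL2 (chainLength ℓ) := ⟨_, hWm⟩ with hΦ
  refine ⟨(Ψ, Φ), mem_laplaceGraph_of_hasDerivAt hUd hVd hUc hWc (fun _ => rfl) (fun _ => rfl) ?_,
    ?_⟩
  · rw [mem_chainCoupling_iff]
    intro n
    rw [cellPart_add_nextPart_eq_zero_iff]
    have k1 := hB.1.smul (w ^ n * χ n)
    have k2 := hB.2.smul (w ^ n * χ n)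
    have hu0 : ∀ j, u j 0 = (a j).1 := fun j => by simp [hu, h.c_zero, h.s_zero]
    have hv0 : ∀ j, v j 0 = (a j).2 := fun j => by simp [hv, h.c_zero, h.s_zero]
    have b1 : ∀ j : Fin 3, boundaryData (chainLength ℓ) U V ((n, j), true)
        = (w ^ n * χ n) • homData z c s (cellLength ℓ) a (j, true) := by
      intro j
      by_cases hj : j = 0
      · subst hj
        have e1 : chainLength ℓ (n, 0) = ℓ := rfl
        have e2 : cellLength ℓ 0 = ℓ := rfl
        ext
        · simp [boundaryData, homData, hU, hA, hD, e1, e2, cutoff_self hℓ, hu]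
          ring
        · simp [boundaryData, homData, hV, hA, hD, e1, e2, cutoff_self hℓ, cutoff'_self hℓ, hv]
          ring
      · ext
        · simp [boundaryData, homData, hU, hA, hD, hj, hu, chainLength]
          ring
        · simp [boundaryData, homData, hV, hA, hD, hj, hv, chainLength]
          ring
    have b2 : ∀ j : Fin 3, j ≠ 0 → boundaryData (chainLength ℓ) U V ((n, j), false)
        = (w ^ n * χ n) • homData z c s (cellLength ℓ) a (j, false) := by
      intro j hj
      ext
      · simp [boundaryData, homData, hU, hA, hD, hj, hu0]
        ring
      · simp [boundaryData, homData, hV, hA, hD, hj, hv0]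
        ring
    have b3 : boundaryData (chainLength ℓ) U V ((n + 1, 0), false)
        = (w ^ n * χ n) • (w • homData z c s (cellLength ℓ) a (0, false)) := by
      ext
      · simp [boundaryData, homData, hU, hA, hD, cutoff_zero, hu0, zpow_add_one₀ hw0]
        ring
      · simp [boundaryData, homData, hV, hA, hD, cutoff_zero, cutoff'_zero, hv0,
          zpow_add_one₀ hw0]
        ring
    simp only
    rw [b1 0, b1 1, b1 2, b2 1 (by decide), b2 2 (by decide), b3]
    exact ⟨k1, k2⟩
  -- The equation fails only where `χ` jumps: on link `0`, where it rises, and on link `N + 1`,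
  -- where it falls.
  · have hf : ∀ e, ‖(Φ - z • Ψ) e‖ ≤ if e ∈ ({(0, 0), ((N : ℤ) + 1, 0)} : Finset (ℤ × Fin 3))
        then γ else 0 := by
      intro e
      have e0 : (Φ - z • Ψ) e = edgeLp (chainLength ℓ e) (hWc e)
          - z • edgeLp (chainLength ℓ e) (hUc e) := rfl
      obtain ⟨n, j⟩ := e
      by_cases hj : j = 0
      · subst hj
        have e1 : edgeLp (chainLength ℓ (n, 0)) (hWc (n, 0))
            - z • edgeLp (chainLength ℓ (n, 0)) (hUc (n, 0))
            = (-w ^ n * (χ n - χ (n - 1))) • edgeLp ℓ hGc := by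
          rw [edgeLp_sub_smul (hUc (n, 0)) (hWc (n, 0)) (continuous_const.mul hGc)
            (k := fun x => (-w ^ n * (χ n - χ (n - 1)))
              * (cutoff'' ℓ x * u 0 x + 2 * cutoff' ℓ x * v 0 x)) fun x => by
            simp only [hW, hU, hD, if_true]
            ring]
          exact edgeLp_eq_smul _ hGc fun x => rfl
        have e2 : ‖(Φ - z • Ψ) (n, 0)‖ = ‖-w ^ n * (χ n - χ (n - 1))‖ * γ :=
          (congrArg norm (e0.trans e1)).trans (norm_smul _ (edgeLp ℓ hGc))
        rw [e2, norm_mul, norm_neg, hwn, one_mul]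
        by_cases hn0 : n = 0
        · subst hn0
          have : χ 0 - χ (0 - 1) = 1 := by simp [hχ]
          rw [this]
          simp
        by_cases hnN : n = N + 1
        · subst hnN
          have : χ ((N : ℤ) + 1) - χ ((N : ℤ) + 1 - 1) = -1 := by simp [hχ]
          rw [this]
          simp
        have : χ n - χ (n - 1) = 0 := by
          have hiff : n ∈ Finset.Icc (0 : ℤ) N ↔ n - 1 ∈ Finset.Icc (0 : ℤ) N := by
            rw [Finset.mem_Icc, Finset.mem_Icc]
            omega
          simp only [hχ, hiff, sub_self]
        rw [this]
        simp [hn0, hnN]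
      · rw [e0, edgeLp_sub_smul (hUc (n, j)) (hWc (n, j)) continuous_zero fun x => by
          simp only [hW, hU, hD, if_neg hj, Pi.zero_apply]
          ring, edgeLp_eq_zero continuous_zero fun x => rfl]
        simp [hj]
    have hfsq : ‖Φ - z • Ψ‖ ^ 2 ≤ 2 * γ ^ 2 := by
      rw [norm_sq_eq_tsum, tsum_eq_sum (s := ({(0, 0), ((N : ℤ) + 1, 0)} : Finset (ℤ × Fin 3)))
        fun e he => by
          have := hf e
          rw [if_neg he] at this
          rw [le_antisymm this (norm_nonneg _)]
          norm_num]
      rw [Finset.sum_pair (by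
        intro h0
        have := congrArg Prod.fst h0
        simp only at this
        omega)]
      have h1 := hf (0, 0)
      have h2 := hf ((N : ℤ) + 1, 0)
      rw [if_pos (by simp)] at h1 h2
      have h1' := pow_le_pow_left₀ (norm_nonneg _) h1 2
      have h2' := pow_le_pow_left₀ (norm_nonneg _) h2 2
      linarith
    -- Cell `0` is left out because its link carries the rise; in the cells `1, …, N` the cut-off is
    -- 1 on all three edges.
    have hΨsq : N * δ ^ 2 ≤ ‖Ψ‖ ^ 2 := by
      rw [norm_sq_eq_tsum]
      have h1 := (summable_norm_sq Ψ).sum_le_tsum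
        ((Finset.Icc (1 : ℤ) N).map ⟨fun n => (n, j₀), fun n m h => congrArg Prod.fst h⟩)
        fun e _ => by positivity
      refine le_trans (le_of_eq ?_) h1
      rw [Finset.sum_map]
      have h2 : ∀ n ∈ Finset.Icc (1 : ℤ) N, ‖Ψ (n, j₀)‖ ^ 2 = δ ^ 2 := by
        intro n hn
        rw [Finset.mem_Icc] at hn
        have c1 : χ n = 1 := if_pos (Finset.mem_Icc.2 ⟨by omega, hn.2⟩)
        have c2 : χ (n - 1) = 1 := if_pos (Finset.mem_Icc.2 ⟨by omega, by omega⟩)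
        have e1 : Ψ (n, j₀) = w ^ n • edgeLp (cellLength ℓ j₀) (huc j₀) :=
          edgeLp_eq_smul (hUc (n, j₀)) (huc j₀) fun x => by
            simp [hU, hA, hD, c1, c2]
        have e2 : ‖Ψ (n, j₀)‖ = ‖w ^ n‖ * δ :=
          (congrArg norm e1).trans (norm_smul _ (edgeLp (cellLength ℓ j₀) (huc j₀)))
        rw [e2, hwn, one_mul]
      refine Eq.trans ?_ (Finset.sum_congr rfl h2).symm
      simp
    refine lt_of_pow_lt_pow_left₀ 2 (norm_nonneg _) ?_
    calc (C * ‖Φ - z • Ψ‖) ^ 2 = C ^ 2 * ‖Φ - z • Ψ‖ ^ 2 := by ring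
      _ ≤ C ^ 2 * (2 * γ ^ 2) := by gcongr
      _ = 2 * (C * γ) ^ 2 := by ring
      _ < N * δ ^ 2 := hN
      _ ≤ _ := hΨsq

end RingChain

namespace RingChain

open Complex (I)

/-! ### Fundamental systems -/

lemma isFundamental_cosh {κ : ℝ} (hκ : 0 < κ) :
    IsFundamental ((-κ ^ 2 : ℝ) : ℂ) (fun x => (Real.cosh (κ * x) : ℂ))
      (fun x => ((Real.sinh (κ * x) / κ : ℝ) : ℂ)) where
  c_zero := by simp
  s_zero := by simp
  hasDerivAt_c x := by
    have h := (((hasDerivAt_id' x).const_mul κ).cosh).ofReal_comp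
    refine h.congr_deriv ?_
    rw [← Complex.ofReal_neg, ← Complex.ofReal_mul]
    congr 1
    field_simp
  hasDerivAt_s x := by
    have h := ((((hasDerivAt_id' x).const_mul κ).sinh).div_const κ).ofReal_comp
    refine h.congr_deriv ?_
    congr 1
    field_simp

lemma isFundamental_cos {k : ℝ} (hk : 0 < k) :
    IsFundamental ((k ^ 2 : ℝ) : ℂ) (fun x => (Real.cos (k * x) : ℂ))
      (fun x => ((Real.sin (k * x) / k : ℝ) : ℂ)) where
  c_zero := by simp
  s_zero := by simp
  hasDerivAt_c x := by
    have h := (((hasDerivAt_id' x).const_mul k).cos).ofReal_comp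
    refine h.congr_deriv ?_
    rw [← Complex.ofReal_neg, ← Complex.ofReal_mul]
    congr 1
    field_simp
  hasDerivAt_s x := by
    have h := ((((hasDerivAt_id' x).const_mul k).sin).div_const k).ofReal_comp
    refine h.congr_deriv ?_
    congr 1
    field_simp

lemma isFundamental_zero : IsFundamental 0 (fun _ => 1) (fun x => (x : ℂ)) where
  c_zero := rfl
  s_zero := by simp
  hasDerivAt_c x := (hasDerivAt_const x (1 : ℂ)).congr_deriv (by ring)
  hasDerivAt_s x := by simpa using (hasDerivAt_id' x).ofReal_comp

lemma exp_sq_add_one (θ : ℝ) : Complex.exp (I * θ) ^ 2 + 1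
    = 2 * (Real.cos θ : ℂ) * Complex.exp (I * θ) := by
  rw [Complex.ofReal_cos, Complex.cos, mul_comm (θ : ℂ) I, neg_mul, mul_comm (θ : ℂ) I,
    Complex.exp_neg]
  have := Complex.exp_ne_zero (I * θ)
  field_simp

lemma norm_exp_I_mul (θ : ℝ) : ‖Complex.exp (I * θ)‖ = 1 := by
  rw [mul_comm, Complex.norm_exp_ofReal_mul_I]

lemma exists_exp_I_mul {w : ℂ} (hw : ‖w‖ = 1) : ∃ θ : ℝ, w = Complex.exp (I * θ) := by
  refine ⟨Complex.arg w, ?_⟩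
  have := Complex.norm_mul_exp_arg_mul_I w
  rw [hw, Complex.ofReal_one, one_mul] at this
  rw [mul_comm, this]

/-! ### The negative spectrum -/

lemma IsFundamental.hasBloch_iff {z : ℂ} {c s : ℝ → ℂ} (h : IsFundamental z c s) {ℓ : ℝ} {w : ℂ}
    (hz : z ≠ 0) (hS : s Real.pi ≠ 0) (hS' : s ℓ ≠ 0) (hw : w ≠ 0) :
    HasBloch z c s ℓ w ↔ secularDet z (c Real.pi) (s Real.pi) (c ℓ) (s ℓ) w = 0 := by
  have h1 := h.wronskian Real.pi
  have h2 := h.wronskian ℓ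
  constructor
  · rintro ⟨a, ha, hB⟩
    by_contra hne
    exact ha (eq_zero_of_secularDet_ne_zero h1 h2 hz hS hS' hne hB)
  · exact hasBloch_of_secularDet_eq_zero h1 h2 hz hS hS' hw

/-- By `w² + 1 = 2 w cos θ` the determinant is `w` times a real function of `cos θ`. -/
lemma secularDet_neg_sq {ℓ κ : ℝ} (hκ : 0 < κ) (θ : ℝ) :
    secularDet ((-κ ^ 2 : ℝ) : ℂ) (Real.cosh (κ * Real.pi) : ℂ)
      ((Real.sinh (κ * Real.pi) / κ : ℝ) : ℂ) (Real.cosh (κ * ℓ) : ℂ)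
      ((Real.sinh (κ * ℓ) / κ : ℝ) : ℂ) (Complex.exp (I * θ))
      = Complex.exp (I * θ) * (secular ℓ κ (Real.cos θ) : ℂ) := by
  have hκ' : (κ : ℂ) ≠ 0 := by exact_mod_cast hκ.ne'
  unfold secularDet secular
  rw [exp_sq_add_one, mul_comm κ, mul_comm κ]
  push_cast
  field_simp
  ring

lemma hasBloch_neg_iff {ℓ κ : ℝ} (hℓ : 0 < ℓ) (hκ : 0 < κ) (θ : ℝ) :
    HasBloch ((-κ ^ 2 : ℝ) : ℂ) (fun x => (Real.cosh (κ * x) : ℂ))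
      (fun x => ((Real.sinh (κ * x) / κ : ℝ) : ℂ)) ℓ (Complex.exp (I * θ))
      ↔ secular ℓ κ (Real.cos θ) = 0 := by
  have hw := Complex.exp_ne_zero (I * θ)
  have hz : ((-κ ^ 2 : ℝ) : ℂ) ≠ 0 := by
    rw [Complex.ofReal_ne_zero]
    exact (neg_lt_zero.2 (pow_pos hκ 2)).ne
  have hS : ∀ x : ℝ, 0 < x → ((Real.sinh (κ * x) / κ : ℝ) : ℂ) ≠ 0 := fun x hx => by
    rw [Complex.ofReal_ne_zero]
    exact div_ne_zero (Real.sinh_pos_iff.2 (mul_pos hκ hx)).ne' hκ.ne'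
  have h1 := hS Real.pi Real.pi_pos
  have h2 := hS ℓ hℓ
  have hiff := (isFundamental_cosh hκ).hasBloch_iff (ℓ := ℓ) hz h1 h2 hw
  rw [hiff]
  rw [secularDet_neg_sq hκ, mul_eq_zero_iff_left hw, Complex.ofReal_eq_zero]

lemma neg_sq_mem_spec_fiberH_iff {ℓ κ : ℝ} (hℓ : 0 < ℓ) (hκ : 0 < κ) (θ : ℝ) :
    ((-κ ^ 2 : ℝ) : ℂ) ∈ spec (fiberH ℓ θ) ↔ secular ℓ κ (Real.cos θ) = 0 := by
  rw [← hasBloch_neg_iff hℓ hκ]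
  refine ⟨fun hs => ?_, (isFundamental_cosh hκ).mem_spec_fiberH hℓ⟩
  by_contra hB
  exact hs ((isFundamental_cosh hκ).inResolventSet_fiberH hℓ hB)

lemma neg_sq_mem_spec_chainH_iff {ℓ κ : ℝ} (hℓ : 0 < ℓ) (hκ : 0 < κ) :
    ((-κ ^ 2 : ℝ) : ℂ) ∈ spec (chainH ℓ) ↔ ∃ c ∈ Icc (-1 : ℝ) 1, secular ℓ κ c = 0 := by
  constructor
  · intro hs
    by_contra! hc
    refine hs ((isFundamental_cosh hκ).inResolventSet_chainH hℓ fun w hw hB => ?_)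
    obtain ⟨θ, rfl⟩ := exists_exp_I_mul hw
    exact hc _ (Real.cos_mem_Icc θ) ((hasBloch_neg_iff hℓ hκ θ).1 hB)
  · rintro ⟨c, hc, h0⟩
    refine (isFundamental_cosh hκ).mem_spec_chainH hℓ (norm_exp_I_mul (Real.arccos c))
      ((hasBloch_neg_iff hℓ hκ _).2 ?_)
    rwa [Real.cos_arccos hc.1 hc.2]

lemma exists_neg_sq {x : ℝ} (hx : x < 0) : ∃ κ, 0 < κ ∧ x = -κ ^ 2 :=
  ⟨√(-x), Real.sqrt_pos.2 (by linarith), by rw [Real.sq_sqrt (by linarith)]; ring⟩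

lemma image_neg_sq_Icc {a b : ℝ} (ha : 0 ≤ a) (hab : a ≤ b) :
    (fun κ : ℝ => -κ ^ 2) '' Icc a b = Icc (-b ^ 2) (-a ^ 2) := by
  ext x
  constructor
  · rintro ⟨κ, ⟨h1, h2⟩, rfl⟩
    have h3 := pow_le_pow_left₀ ha h1 2
    have h4 := pow_le_pow_left₀ (ha.trans h1) h2 2
    exact ⟨by linarith, by linarith⟩
  · rintro ⟨h1, h2⟩
    refine ⟨√(-x), ⟨Real.le_sqrt_of_sq_le (by linarith), ?_⟩, ?_⟩
    · exact (Real.sqrt_le_left (ha.trans hab)).2 (by linarith)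
    · simp only
      rw [Real.sq_sqrt (by nlinarith [sq_nonneg a])]
      ring

lemma image_cos_Icc : Real.cos '' Icc (-Real.pi) Real.pi = Icc (-1) 1 := by
  refine Subset.antisymm ?_ fun c hc => ?_
  · rintro _ ⟨θ, -, rfl⟩
    exact Real.cos_mem_Icc θ
  · exact ⟨Real.arccos c, ⟨by linarith [Real.arccos_nonneg c, Real.pi_pos], Real.arccos_le_pi c⟩,
      Real.cos_arccos hc.1 hc.2⟩

/-- The lower negative dispersion function. -/
noncomputable def lowerEnergy (ℓ θ : ℝ) : ℝ := -lowerRoot ℓ (Real.cos θ) ^ 2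

/-- The upper negative dispersion function. -/
noncomputable def upperEnergy (ℓ θ : ℝ) : ℝ := -upperRoot ℓ (Real.cos θ) ^ 2

/-- Each dispersion function is `κ ↦ -κ²` after a root after the cosine, and the cosine covers `[-1,
1]`; the bands are therefore images of the root intervals. They are disjoint because `κ = 2`
separates the roots. -/
lemma negSpec_of_short_link {ℓ : ℝ} (hℓ : 0 < ℓ) (hℓ1 : ℓ ≤ 1 / 16)
    (hmono : ∀ c ≤ 1, StrictMonoOn (fun κ => secular ℓ κ c) (Icc 1 2)) :
    (∀ θ ∈ Icc (-Real.pi) Real.pi,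
      negSpec (fiberH ℓ θ) = {lowerEnergy ℓ θ, upperEnergy ℓ θ}) ∧
    lowerEnergy ℓ '' Icc (-Real.pi) Real.pi = Icc (lowerEnergy ℓ Real.pi) (lowerEnergy ℓ 0) ∧
    upperEnergy ℓ '' Icc (-Real.pi) Real.pi = Icc (upperEnergy ℓ 0) (upperEnergy ℓ Real.pi) ∧
    lowerEnergy ℓ 0 < upperEnergy ℓ 0 ∧
    negSpec (chainH ℓ) = Icc (lowerEnergy ℓ Real.pi) (lowerEnergy ℓ 0)
      ∪ Icc (upperEnergy ℓ 0) (upperEnergy ℓ Real.pi) := by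
  have hr := fun {c : ℝ} (hc : c ∈ Icc (-1 : ℝ) 1) => roots_spec hℓ hℓ1 hmono hc
  have hm : (-1 : ℝ) ∈ Icc (-1 : ℝ) 1 := by norm_num
  have hp : (1 : ℝ) ∈ Icc (-1 : ℝ) 1 := by norm_num
  have hl0 : ∀ {c : ℝ}, c ∈ Icc (-1 : ℝ) 1 → 0 < lowerRoot ℓ c := fun hc => by
    linarith [(hr hc).2.1]
  have hu0 : ∀ {c : ℝ}, c ∈ Icc (-1 : ℝ) 1 → 0 < upperRoot ℓ c := fun hc => by
    linarith [(hr hc).1.1]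
  have hlow : lowerEnergy ℓ '' Icc (-Real.pi) Real.pi
      = Icc (lowerEnergy ℓ Real.pi) (lowerEnergy ℓ 0) := by
    have e : lowerEnergy ℓ = (fun κ : ℝ => -κ ^ 2) ∘ lowerRoot ℓ ∘ Real.cos := rfl
    have hi := image_lowerRoot hℓ hℓ1 hmono
    have hle := hi.le (mem_image_of_mem _ hp)
    replace hle := hle.1.trans hle.2
    rw [e, image_comp, image_comp, image_cos_Icc, hi, image_neg_sq_Icc (hl0 hp).le hle]
    simp
  have hup : upperEnergy ℓ '' Icc (-Real.pi) Real.pi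
      = Icc (upperEnergy ℓ 0) (upperEnergy ℓ Real.pi) := by
    have e : upperEnergy ℓ = (fun κ : ℝ => -κ ^ 2) ∘ upperRoot ℓ ∘ Real.cos := rfl
    have hi := image_upperRoot hℓ hℓ1 hmono
    have hle := hi.le (mem_image_of_mem _ hp)
    replace hle := hle.1.trans hle.2
    rw [e, image_comp, image_comp, image_cos_Icc, hi, image_neg_sq_Icc (hu0 hm).le hle]
    simp
  have hsq : ∀ {a b : ℝ}, 0 < a → 0 < b → (-a ^ 2 = -b ^ 2 ↔ a = b) := fun {a b} ha hb => by
    rw [neg_inj, pow_left_inj₀ ha.le hb.le two_ne_zero]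
  refine ⟨fun θ _ => ?_, hlow, hup, ?_, ?_⟩
  · ext x
    have hc := Real.cos_mem_Icc θ
    constructor
    · rintro ⟨hx, hs⟩
      obtain ⟨κ, hκ, rfl⟩ := exists_neg_sq hx
      rw [neg_sq_mem_spec_fiberH_iff hℓ hκ, (hr hc).2.2.2.2 κ hκ] at hs
      rcases hs with rfl | rfl
      · exact Or.inl rfl
      · exact Or.inr rfl
    · rintro (rfl | rfl)
      · have h0 := hl0 hc
        refine ⟨neg_lt_zero.2 (by positivity), ?_⟩
        exact (neg_sq_mem_spec_fiberH_iff hℓ h0 θ).2 (((hr hc).2.2.2.2 _ h0).2 (Or.inl rfl))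
      · have h0 := hu0 hc
        refine ⟨neg_lt_zero.2 (by positivity), ?_⟩
        exact (neg_sq_mem_spec_fiberH_iff hℓ h0 θ).2 (((hr hc).2.2.2.2 _ h0).2 (Or.inr rfl))
  · have h1 := (hr hp).1
    have h2 := (hr hp).2.1
    simp only [lowerEnergy, upperEnergy, Real.cos_zero]
    nlinarith [h1.1, h1.2]
  · rw [← hlow, ← hup]
    ext x
    constructor
    · rintro ⟨hx, hs⟩
      obtain ⟨κ, hκ, rfl⟩ := exists_neg_sq hx
      obtain ⟨c, hc, h0⟩ := (neg_sq_mem_spec_chainH_iff hℓ hκ).1 hs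
      obtain ⟨θ, hθ, rfl⟩ := image_cos_Icc.ge hc
      rw [(hr hc).2.2.2.2 κ hκ] at h0
      rcases h0 with rfl | rfl
      · exact Or.inl ⟨θ, hθ, rfl⟩
      · exact Or.inr ⟨θ, hθ, rfl⟩
    · rintro (⟨θ, -, rfl⟩ | ⟨θ, -, rfl⟩)
      · have hc := Real.cos_mem_Icc θ
        have h0 := hl0 hc
        refine ⟨neg_lt_zero.2 (by positivity), ?_⟩
        exact (neg_sq_mem_spec_chainH_iff hℓ h0).2
          ⟨_, hc, ((hr hc).2.2.2.2 _ h0).2 (Or.inl rfl)⟩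
      · have hc := Real.cos_mem_Icc θ
        have h0 := hu0 hc
        refine ⟨neg_lt_zero.2 (by positivity), ?_⟩
        exact (neg_sq_mem_spec_chainH_iff hℓ h0).2
          ⟨_, hc, ((hr hc).2.2.2.2 _ h0).2 (Or.inr rfl)⟩

/-! ### The positive spectrum -/

lemma zero_mem_spec_chainH {ℓ : ℝ} (hℓ : 0 < ℓ) : (0 : ℂ) ∈ spec (chainH ℓ) :=
  isFundamental_zero.mem_spec_chainH hℓ norm_one (hasBloch_zero rfl rfl)

/-- Bloch solutions require `cos θ = X(ℓ)`, where `X(ℓ) → cos kπ`. This is solvable for small `ℓ`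
when `|cos kπ| < 1`. When `sin kπ = 0` it reads `cos θ = cos kπ cos kℓ`, always solvable, but the
elimination would divide by `sin kπ` and is replaced by `hasBloch_of_dirichlet`. -/
lemma eventually_sq_mem_spec_chainH {k : ℝ} (hk : 0 < k) :
    ∀ᶠ ℓ : ℝ in 𝓝[>] 0, ((k ^ 2 : ℝ) : ℂ) ∈ spec (chainH ℓ) := by
  have h := isFundamental_cos hk
  have hk' : (k : ℂ) ≠ 0 := by exact_mod_cast hk.ne'
  have hsmall := eventually_lt_nhdsGT_zero (show 0 < Real.pi / k by have := Real.pi_pos; positivity)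
  have hS' : ∀ {ℓ : ℝ}, 0 < ℓ → ℓ < Real.pi / k → ((Real.sin (k * ℓ) / k : ℝ) : ℂ) ≠ 0 := by
    intro ℓ h0 h1
    rw [lt_div_iff₀ hk, mul_comm] at h1
    rw [Complex.ofReal_ne_zero]
    have := Real.sin_pos_of_pos_of_lt_pi (show 0 < k * ℓ by positivity) h1
    positivity
  rcases eq_or_ne (Real.sin (k * Real.pi)) 0 with hs | hs
  · filter_upwards [hsmall] with ℓ ⟨h0, h1⟩
    set X := Real.cos (k * Real.pi) * Real.cos (k * ℓ) with hX
    have hX1 : |X| ≤ 1 := by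
      rw [hX, abs_mul]
      exact mul_le_one₀ (Real.abs_cos_le_one _) (abs_nonneg _) (Real.abs_cos_le_one _)
    rw [abs_le] at hX1
    have hS : ((Real.sin (k * Real.pi) / k : ℝ) : ℂ) = 0 := by simp [hs]
    refine h.mem_spec_chainH h0 (norm_exp_I_mul (Real.arccos X)) (hasBloch_of_dirichlet ?_ hS
      (h.wronskian ℓ) (hS' h0 h1) ?_)
    · have := h.wronskian Real.pi
      rw [hS] at this
      simpa using this
    · rw [exp_sq_add_one, Real.cos_arccos hX1.1 hX1.2, hX]
      push_cast
      ring
  · set X : ℝ → ℝ := fun ℓ => Real.cos (k * Real.pi) * Real.cos (k * ℓ)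
      - Real.sin (k * Real.pi) * Real.sin (k * ℓ) * (((k ^ 2 + 1) ^ 2 + 4) / (4 * (k ^ 2 + 1)))
      with hX
    have hXc : Continuous X := by
      simp only [hX]
      fun_prop
    have hX0 : |X 0| < 1 := by
      have : X 0 = Real.cos (k * Real.pi) := by simp [hX]
      rw [this]
      refine lt_of_pow_lt_pow_left₀ 2 zero_le_one ?_
      have := Real.sin_sq_add_cos_sq (k * Real.pi)
      have := pow_pos (abs_pos.2 hs) 2
      rw [sq_abs] at *
      linarith
    have hXe : ∀ᶠ ℓ : ℝ in 𝓝[>] 0, |X ℓ| < 1 :=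
      nhdsWithin_le_nhds ((hXc.abs.tendsto 0).eventually_lt_const hX0)
    filter_upwards [hsmall, hXe] with ℓ ⟨h0, h1⟩ hX1
    replace hX1 := abs_le.1 hX1.le
    refine h.mem_spec_chainH h0 (norm_exp_I_mul (Real.arccos (X ℓ)))
      (hasBloch_of_secularDet_eq_zero (h.wronskian _) (h.wronskian _) ?_ ?_ (hS' h0 h1)
        (Complex.exp_ne_zero _) ?_)
    · rw [Complex.ofReal_ne_zero]
      positivity
    · rw [Complex.ofReal_ne_zero]
      exact div_ne_zero hs hk.ne'
    · unfold secularDet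
      rw [exp_sq_add_one, Real.cos_arccos hX1.1 hX1.2, hX]
      have hk1 : (k : ℂ) ^ 2 + 1 ≠ 0 := by
        have : (k ^ 2 + 1 : ℝ) ≠ 0 := by positivity
        exact_mod_cast this
      push_cast
      field_simp
      ring

lemma eventually_mem_spec_chainH {x : ℝ} (hx : 0 ≤ x) :
    ∀ᶠ ℓ : ℝ in 𝓝[>] 0, (x : ℂ) ∈ spec (chainH ℓ) := by
  rcases hx.eq_or_lt with rfl | hx
  · filter_upwards [self_mem_nhdsWithin] with ℓ hℓ
    simpa using zero_mem_spec_chainH hℓ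
  · have := eventually_sq_mem_spec_chainH (Real.sqrt_pos.2 hx)
    rwa [Real.sq_sqrt hx.le] at this

lemma eventually_dense_posSpec (K : ℝ) {ε : ℝ} (hε : 0 < ε) :
    ∀ᶠ ℓ : ℝ in 𝓝[>] 0, ∀ x ∈ Icc 0 K, ∃ y ∈ posSpec (chainH ℓ), |y - x| < ε := by
  have hall : ∀ᶠ ℓ : ℝ in 𝓝[>] 0, ∀ n ∈ Finset.range (⌊K / (ε / 2)⌋₊ + 1),
      (((n + 1 : ℝ) * (ε / 2) : ℝ) : ℂ) ∈ spec (chainH ℓ) :=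
    (Filter.eventually_all_finset _).2 fun n _ => eventually_mem_spec_chainH (by positivity)
  filter_upwards [hall] with ℓ hℓ x hx
  have hx0 : 0 ≤ x / (ε / 2) := div_nonneg hx.1 (by positivity)
  set n := ⌊x / (ε / 2)⌋₊ with hn
  have h1 : (n : ℝ) * (ε / 2) ≤ x := (le_div_iff₀ (by positivity)).1 (Nat.floor_le hx0)
  have h2 : x < (n + 1) * (ε / 2) := (div_lt_iff₀ (by positivity)).1 (Nat.lt_floor_add_one _)
  -- The next grid point above `x` is taken: it is positive even for `x = 0`, and lies within `ε /
  -- 2` of `x`.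
  refine ⟨(n + 1) * (ε / 2), ⟨by positivity, hℓ n ?_⟩, ?_⟩
  · rw [Finset.mem_range, Nat.lt_succ_iff]
    refine Nat.floor_le_floor ?_
    gcongr
    exact hx.2
  · rw [abs_of_pos (by linarith)]
    linarith

/-! ### Asymptotics of the negative bands -/

lemma cosh_pi_sub_one_pos : 0 < Real.cosh Real.pi - 1 :=
  sub_pos.2 (Real.one_lt_cosh.2 Real.pi_ne_zero)

lemma upperEnergy_zero_asymptotics :
    (fun ℓ : ℝ => upperEnergy ℓ 0
        - (-1 - ℓ * (Real.cosh (Real.pi / 2) / Real.sinh (Real.pi / 2))))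
      =O[𝓝[>] 0] (fun ℓ : ℝ => ℓ ^ 2) := by
  have h := (upperRoot_asymptotics (c := 1) (by norm_num)).neg_left
  refine h.congr_left fun ℓ => ?_
  -- The half-angle formula for coth identifies the coefficient at `c = 1`.
  have e : Real.cosh (Real.pi / 2) / Real.sinh (Real.pi / 2)
      = Real.sinh Real.pi / (Real.cosh Real.pi - 1) := by
    have hs : 0 < Real.sinh (Real.pi / 2) := Real.sinh_pos_iff.2 (by have := Real.pi_pos; positivity)
    rw [div_eq_div_iff hs.ne' cosh_pi_sub_one_pos.ne']
    have e1 : Real.sinh Real.pi = 2 * Real.sinh (Real.pi / 2) * Real.cosh (Real.pi / 2) := by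
      rw [← Real.sinh_two_mul]; ring_nf
    have e2 : Real.cosh Real.pi = Real.cosh (Real.pi / 2) ^ 2 + Real.sinh (Real.pi / 2) ^ 2 := by
      rw [← Real.cosh_two_mul]; ring_nf
    rw [e1, e2]
    linear_combination Real.cosh (Real.pi / 2) * Real.cosh_sq (Real.pi / 2)
  rw [e, upperEnergy, Real.cos_zero]
  ring

lemma upperEnergy_width_asymptotics :
    (fun ℓ : ℝ => (upperEnergy ℓ Real.pi - upperEnergy ℓ 0) - 2 * ℓ / Real.sinh Real.pi)
      =O[𝓝[>] 0] (fun ℓ : ℝ => ℓ ^ 2) := by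
  have h := (upperRoot_asymptotics (c := 1) (by norm_num)).sub
    (upperRoot_asymptotics (c := -1) (by norm_num))
  refine h.congr_left fun ℓ => ?_
  have hs : 0 < Real.sinh Real.pi := Real.sinh_pos_iff.2 Real.pi_pos
  have h1 := cosh_pi_sub_one_pos
  -- The coefficients at `c = 1` and `c = -1` are subtracted, with `cosh² π - 1 = sinh² π`.
  have e : Real.sinh Real.pi / (Real.cosh Real.pi - 1)
      - Real.sinh Real.pi / (Real.cosh Real.pi - -1) = 2 / Real.sinh Real.pi := by
    have h2 : Real.cosh Real.pi - -1 ≠ 0 := by linarith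
    rw [div_sub_div _ _ h1.ne' h2, div_eq_div_iff (mul_ne_zero h1.ne' h2) hs.ne']
    linear_combination (-2) * Real.cosh_sq Real.pi
  rw [upperEnergy, upperEnergy, Real.cos_zero, Real.cos_pi]
  linear_combination (-ℓ) * e

end RingChain

/-- Spectrum of the ring chain as the length `ℓ` of the connecting links tends to `0`. -/
theorem theorem3 :
    -- the positive spectrum fills `[0, ∞)`: it is eventually `ε`-dense in each `[0, K]` ...
    (∀ K : ℝ, ∀ ε > 0, ∀ᶠ ℓ : ℝ in 𝓝[>] 0, ∀ x ∈ Icc 0 K,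
      ∃ y ∈ RingChain.posSpec (RingChain.chainH ℓ), |y - x| < ε) ∧
    -- ... and each point of `[0, ∞)` eventually belongs to the spectrum
    (∀ x : ℝ, 0 ≤ x → ∀ᶠ ℓ : ℝ in 𝓝[>] 0, (x : ℂ) ∈ RingChain.spec (RingChain.chainH ℓ)) ∧
    -- the dispersion functions `-κ²(ℓ; θ)` of the lower and of the upper negative band
    ∃ Elow Eup : ℝ → ℝ → ℝ,
      (∀ᶠ ℓ : ℝ in 𝓝[>] 0,
        (∀ θ ∈ Icc (-Real.pi) Real.pi,
          RingChain.negSpec (RingChain.fiberH ℓ θ) = {Elow ℓ θ, Eup ℓ θ}) ∧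
        Elow ℓ '' Icc (-Real.pi) Real.pi = Icc (Elow ℓ Real.pi) (Elow ℓ 0) ∧
        Eup ℓ '' Icc (-Real.pi) Real.pi = Icc (Eup ℓ 0) (Eup ℓ Real.pi) ∧
        Elow ℓ 0 < Eup ℓ 0 ∧
        RingChain.negSpec (RingChain.chainH ℓ) =
          Icc (Elow ℓ Real.pi) (Elow ℓ 0) ∪ Icc (Eup ℓ 0) (Eup ℓ Real.pi)) ∧
      -- lower edge of the upper negative band
      (fun ℓ : ℝ => Eup ℓ 0 - (-1 - ℓ * (Real.cosh (Real.pi / 2) / Real.sinh (Real.pi / 2))))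
        =O[𝓝[>] 0] (fun ℓ : ℝ => ℓ ^ 2) ∧
      -- width of the upper negative band
      (fun ℓ : ℝ => (Eup ℓ Real.pi - Eup ℓ 0) - 2 * ℓ / Real.sinh Real.pi)
        =O[𝓝[>] 0] (fun ℓ : ℝ => ℓ ^ 2) ∧
      (fun ℓ : ℝ => (Eup ℓ (-Real.pi) - Eup ℓ 0) - 2 * ℓ / Real.sinh Real.pi)
        =O[𝓝[>] 0] (fun ℓ : ℝ => ℓ ^ 2) ∧
      -- the lower negative band escapes to `-∞`, uniformly in the quasimomentum
      ∃ C : ℝ, ∀ᶠ ℓ : ℝ in 𝓝[>] 0, ∀ θ ∈ Icc (-Real.pi) Real.pi,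
        |Elow ℓ θ + (4 / ℓ) ^ (2 / 3 : ℝ)| ≤ C := by
  -- The uniform constant 14 is the one from `exists_far_root`, which holds for every `c` in `[-1,
  -- 1]`.
  refine ⟨fun K ε hε => RingChain.eventually_dense_posSpec K hε,
    fun x hx => RingChain.eventually_mem_spec_chainH hx,
    RingChain.lowerEnergy, RingChain.upperEnergy, ?_, RingChain.upperEnergy_zero_asymptotics,
    RingChain.upperEnergy_width_asymptotics, ?_, 14, ?_⟩
  · filter_upwards [RingChain.eventually_strictMonoOn_secular,
      RingChain.eventually_lt_nhdsGT_zero (by norm_num : (0 : ℝ) < 1 / 16)] with ℓ hmono hℓ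
    exact RingChain.negSpec_of_short_link hℓ.1 hℓ.2.le hmono
  · simpa [RingChain.upperEnergy] using RingChain.upperEnergy_width_asymptotics
  · filter_upwards [RingChain.eventually_strictMonoOn_secular,
      RingChain.eventually_lt_nhdsGT_zero (by norm_num : (0 : ℝ) < 1 / 16)] with ℓ hmono hℓ θ _
    have h := RingChain.roots_spec hℓ.1 hℓ.2.le hmono (Real.cos_mem_Icc θ)
    rw [RingChain.lowerEnergy, abs_le]
    constructor
    · linarith [h.2.2.2.1]
    · linarith [h.2.2.1]
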